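/- Let $d\in\{3,4,5\}$. Let $\mu$ be a probability measure on $\mathbb N=\{0,1,2,\dots\}$ with mean $1$ and finite variance, $\mu\neq\delta_1$. Let $\eta$ be a probability measure on $\mathbb Z^d$ such that the random walk on $\mathbb Z^d$ with jump distribution $\eta$ is irreducible and aperiodic, and such that $\eta$ has mean $0$ and finite moment of order $d+1$. Let $\theta$ be a probability measure on $\mathbb Z^d$ that is symmetric ($\theta(x)=\theta(-x)$ for all $x$), irreducible (in the same sense), and satisfies $\sum_x e^{c|x|}\theta(x)<\infty$ for some $c>0$. Let $(\mathcal T_k)_{k\ge 0}$ be independent Galton–Watson trees with offspring distribution $\mu$, and let $\mathcal T^{IGW}$ be the infinite tree obtained from an infinite ray $w_0,w_1,w_2,\dots$, rooted at $w_0$ and with $w_{k}$ the parent of $w_{k+1}$, by rooting $\mathcal T_k$ at $w_k$ for each $k\ge 0$. Independently of the tree, attach to its edges i.i.d. random variables with law $\theta$; for a vertex $u$ let $V_u\in\mathbb Z^d$ be the sum of these variables along the path from $w_0$ to $u$ (so $V_{w_0}=0$). Let $u_0,u_1,u_2,\dots$ be the vertices of $\mathcal T^{IGW}$ listed tree by tree,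 first those of $\mathcal T_0$, then those of $\mathcal T_1$, and so on, each tree being listed in depth-first (lexicographical) order from its root $w_k$. Put $R[0,n]=\{V_{u_0},\dots,V_{u_n}\}$. For a finite set $A\subset\mathbb Z^d$ let $$\mathrm{cap}_\eta(A)=\sum_{x\in A}P_x^{\eta}\big(S_n\notin A\text{ for all }n\ge 1\big),$$ where under $P_x^\eta$ the process $(S_n)_{n\ge0}$ is the random walk with jump distribution $\eta$ started at $x$. Then, almost surely, $$\mathrm{cap}_\eta\big(R[0,n]\big)=n^{\frac{d-2}{4}+o(1)}\qquad (n\to\infty),$$ that is, almost surely there is a (random) sequence $\varepsilon_n\to 0$ with $\mathrm{cap}_\eta(R[0,n])=n^{\frac{d-2}{4}+\varepsilon_n}$ for all sufficiently large $n$. -/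

import Mathlib

open MeasureTheory Filter Topology

noncomputable section

namespace BRWCapacity

/-- The lattice `ℤ^d`, with its discrete (product) σ-algebra. -/
abbrev Lattice (d : ℕ) : Type := Fin d → ℤ

/-- The Euclidean norm of a lattice point. -/
def euclNorm {d : ℕ} (x : Lattice d) : ℝ := Real.sqrt (∑ i, (x i : ℝ) ^ 2)

section RandomWalk

variable {d : ℕ}

/-- The trajectory `n ↦ x + ξ₀ + ⋯ + ξ_{n-1}` with starting point `x` and increments `ξ`. -/
def walkPath (x : Lattice d) (ξ : ℕ → Lattice d) (n : ℕ) : Lattice d :=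
  x + ∑ i ∈ Finset.range n, ξ i

theorem measurable_walkPath (x : Lattice d) : Measurable (walkPath x) := by
  refine measurable_pi_lambda _ fun n => ?_
  unfold walkPath
  fun_prop

/-- The law, on the space of trajectories, of the random walk with jump distribution `η`
started at `x`. -/
def walkLaw (η : Measure (Lattice d)) [IsProbabilityMeasure η] (x : Lattice d) :
    Measure (ℕ → Lattice d) :=
  (Measure.infinitePi fun _ : ℕ => η).map (walkPath x)

/-- The first return time `inf {n ≥ 1 : S n ∈ A}` of a trajectory `S` to `A`,
equal to `⊤` if there is no return. -/
def returnTime (A : Finset (Lattice d)) (S : ℕ → Lattice d) : ℕ∞ :=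
  ⨅ (n : ℕ) (_ : 1 ≤ n ∧ S n ∈ A), (n : ℕ∞)

/-- The `η`-capacity of a finite set. -/
def capacity (η : Measure (Lattice d)) [IsProbabilityMeasure η] (A : Finset (Lattice d)) : ℝ :=
  ∑ x ∈ A, (walkLaw η x).real {S | returnTime A S = ⊤}

/-- Every point is reached from every point with positive probability. -/
def IsIrreducible (η : Measure (Lattice d)) [IsProbabilityMeasure η] : Prop :=
  ∀ x y : Lattice d, ∃ n : ℕ, 0 < walkLaw η x {S | S n = y}

/-- The possible return times to the origin have greatest common divisor `1`. -/
def IsAperiodic (η : Measure (Lattice d)) [IsProbabilityMeasure η] : Prop :=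
  ∀ m : ℕ, (∀ n : ℕ, 1 ≤ n → 0 < walkLaw η 0 {S | S n = 0} → m ∣ n) → m = 1

end RandomWalk

section Forest

/-- Potential vertices of the forest. The pair `(k, [])` is the spine vertex `w_k`; the pair
`(k, j :: v)` is the child number `j` (counted from `0`) of the vertex `(k, v)` in the tree
attached to `w_k`. Thus `(k, v)` carries the Ulam–Harris word `v.reverse`. -/
abbrev Vertex : Type := ℕ × List ℕ

/-- Membership in the forest in which `(k, v)` has `N (k, v)` children inside its own tree. -/
def InForest (N : Vertex → ℕ) : Vertex → Prop
  | (_, []) => True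
  | (k, j :: v) => InForest N (k, v) ∧ j < N (k, v)

/-- Where the exploration continues once all descendants (in its own tree) of a vertex have been
visited: the next sibling of the vertex, or, if there is none, the same for its parent; when a
tree is exhausted, the next spine vertex. -/
def nextAfterSubtree (N : Vertex → ℕ) : Vertex → Vertex
  | (k, []) => (k + 1, [])
  | (k, j :: v) => if j + 1 < N (k, v) then (k, (j + 1) :: v) else nextAfterSubtree N (k, v)

/-- One step of the depth-first exploration: to the first child if there is one. -/
def dfsNext (N : Vertex → ℕ) (u : Vertex) : Vertex :=
  if 0 < N u then (u.1, 0 :: u.2) else nextAfterSubtree N u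

/-- The sequence `u₀, u₁, …` of the vertices in depth-first order. -/
def dfs (N : Vertex → ℕ) : ℕ → Vertex
  | 0 => (0, [])
  | i + 1 => dfsNext N (dfs N i)

/-- The lexicographical order: first the index of the tree, then the Ulam–Harris word. -/
def Precedes (u v : Vertex) : Prop :=
  u.1 < v.1 ∨ u.1 = v.1 ∧ u.2.reverse < v.2.reverse

theorem lex_append_of_not_prefix :
    ∀ {a b : List ℕ} (c : List ℕ), a < b → ¬ a <+: b → a ++ c < b
  | [], _, _, _, h => absurd (List.nil_prefix) h
  | _ :: _, [], _, h, _ => by simp at h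
  | x :: a, y :: b, c, h, h' => by
    rw [List.cons_append, List.cons_lt_cons_iff]
    rw [List.cons_lt_cons_iff] at h
    rcases h with h | ⟨rfl, h⟩
    · exact Or.inl h
    · exact Or.inr ⟨rfl, lex_append_of_not_prefix c h
        (fun hp => h' (by simpa using hp))⟩

theorem lex_append_left :
    ∀ (a : List ℕ) {b c : List ℕ}, a ++ b < a ++ c ↔ b < c
  | [], _, _ => Iff.rfl
  | x :: a, b, c => by
    simp [lex_append_left a]

theorem lex_lt_append : ∀ (a : List ℕ) (j : ℕ) (b : List ℕ), a < a ++ j :: b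
  | [], _, _ => by simp
  | x :: a, j, b => by
    rw [List.cons_append, List.cons_lt_cons_iff]
    exact Or.inr ⟨rfl, lex_lt_append a j b⟩

theorem nextAfterSubtree_spec (N : Vertex → ℕ) (k : ℕ) : ∀ w : List ℕ, InForest N (k, w) →
    InForest N (nextAfterSubtree N (k, w)) ∧
    (∀ t, Precedes (k, t ++ w) (nextAfterSubtree N (k, w))) ∧
    ∀ v, InForest N v → Precedes (k, w) v → ¬ (v.1 = k ∧ w.reverse <+: v.2.reverse) →
      v = nextAfterSubtree N (k, w) ∨ Precedes (nextAfterSubtree N (k, w)) v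
  | [], _ => by
    have hnext : nextAfterSubtree N (k, []) = (k + 1, []) := by simp [nextAfterSubtree]
    rw [hnext]
    refine ⟨by simp [InForest], by simp [Precedes], ?_⟩
    rintro ⟨l, v⟩ _ hp hn
    have hl : k < l := by
      rcases hp with h | ⟨h, -⟩
      · exact h
      · exact absurd ⟨h.symm, by simp⟩ hn
    rcases Nat.lt_or_ge (k + 1) l with h | h
    · exact Or.inr (Or.inl h)
    · obtain rfl : l = k + 1 := by omega
      cases v with
      | nil => exact Or.inl rfl
      | cons j v =>
        refine Or.inr (Or.inr ⟨rfl, ?_⟩)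
        simp only [List.reverse_nil, List.reverse_cons]
        rcases hv : v.reverse ++ [j] with _ | ⟨a, t⟩
        · simp at hv
        · simp
  | j :: w, hu => by
    obtain ⟨hw, hj⟩ : InForest N (k, w) ∧ j < N (k, w) := by simpa [InForest] using hu
    obtain ⟨ih1, ih2, ih3⟩ := nextAfterSubtree_spec N k w hw
    have key : ∀ v, InForest N v → Precedes (k, j :: w) v →
        ¬ (v.1 = k ∧ (j :: w).reverse <+: v.2.reverse) →
        (v.1 = k ∧ w.reverse <+: v.2.reverse) →
        ∃ a t, v = (k, t ++ a :: w) ∧ j < a ∧ a < N (k, w) := by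
      rintro ⟨l, v⟩ hv hp hn ⟨hl, hpre⟩
      obtain rfl : l = k := hl
      obtain ⟨t, ht⟩ := List.reverse_prefix.1 hpre
      have hp' : (j :: w).reverse < v.reverse := by
        rcases hp with h | ⟨-, h⟩
        · exact absurd h (lt_irrefl _)
        · exact h
      subst ht
      rcases List.eq_nil_or_concat t with rfl | ⟨t, a, rfl⟩
      · simp only [List.nil_append, List.reverse_cons] at hp'
        exact absurd hp' (lt_asymm (lex_lt_append _ _ _))
      · simp only [List.concat_eq_append, List.reverse_append, List.reverse_cons, List.reverse_nil,
          List.nil_append, List.singleton_append, lex_append_left, List.cons_lt_cons_iff] at hp'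
        have ha : a < N (l, w) := by
          have : ∀ t : List ℕ, InForest N (l, t ++ a :: w) → a < N (l, w) := by
            intro t
            induction t with
            | nil => intro h; simp only [List.nil_append, InForest] at h; exact h.2
            | cons b t ih => intro h; simp only [List.cons_append, InForest] at h; exact ih h.1
          exact this t (by simpa using hv)
        refine ⟨a, t, by simp, ?_, ha⟩
        rcases hp' with h | ⟨rfl, -⟩
        · exact h
        · exact absurd ⟨rfl, by simp⟩ hn
    have mono : ∀ v, Precedes (k, j :: w) v → Precedes (k, w) v := by
      rintro v (h | ⟨h, h'⟩)
      · exact Or.inl h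
      · refine Or.inr ⟨h, lt_trans ?_ h'⟩
        simpa using lex_lt_append w.reverse j []
    by_cases hs : j + 1 < N (k, w)
    · have hnext : nextAfterSubtree N (k, j :: w) = (k, (j + 1) :: w) := by
        simp [nextAfterSubtree, hs]
      rw [hnext]
      refine ⟨by simp [InForest, hw, hs], fun t => Or.inr ⟨rfl, ?_⟩, ?_⟩
      · simp [lex_append_left, List.cons_lt_cons_iff]
      · intro v hv hp hn
        by_cases hd : v.1 = k ∧ w.reverse <+: v.2.reverse
        · obtain ⟨a, t, rfl, hja, -⟩ := key v hv hp hn hd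
          rcases Nat.lt_or_ge (j + 1) a with h | h
          · refine Or.inr (Or.inr ⟨rfl, ?_⟩)
            simp [lex_append_left, List.cons_lt_cons_iff, h]
          · obtain rfl : a = j + 1 := by omega
            rcases List.eq_nil_or_concat t with rfl | ⟨t, b, rfl⟩
            · exact Or.inl rfl
            · refine Or.inr (Or.inr ⟨rfl, ?_⟩)
              simpa using lex_lt_append (w.reverse ++ [j + 1]) b t.reverse
        · rcases mono v hp with h | ⟨h, h'⟩
          · exact Or.inr (Or.inl h)
          · refine Or.inr (Or.inr ⟨h, ?_⟩)
            rw [List.reverse_cons]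
            exact lex_append_of_not_prefix _ h' (fun hc => hd ⟨h.symm, hc⟩)
    · have hnext : nextAfterSubtree N (k, j :: w) = nextAfterSubtree N (k, w) := by
        simp [nextAfterSubtree, hs]
      rw [hnext]
      have hnd : ∀ v, InForest N v → Precedes (k, j :: w) v →
          ¬ (v.1 = k ∧ (j :: w).reverse <+: v.2.reverse) →
          ¬ (v.1 = k ∧ w.reverse <+: v.2.reverse) := by
        intro v hv hp hn hd
        obtain ⟨a, t, -, h1, h2⟩ := key v hv hp hn hd
        omega
      refine ⟨ih1, fun t => ?_, fun v hv hp hn => ih3 v hv (mono v hp) (hnd v hv hp hn)⟩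
      simpa using ih2 (t ++ [j])

/-- The exploration starts at the root, stays in the forest, and `dfs N (i + 1)` is the least
vertex of the forest after `dfs N i` in the lexicographical order. -/
theorem dfs_spec (N : Vertex → ℕ) (i : ℕ) :
    InForest N (dfs N i) ∧ Precedes (dfs N i) (dfs N (i + 1)) ∧
    ∀ v, InForest N v → Precedes (dfs N i) v →
      v = dfs N (i + 1) ∨ Precedes (dfs N (i + 1)) v := by
  have step : ∀ u, InForest N u → InForest N (dfsNext N u) ∧ Precedes u (dfsNext N u) ∧
      ∀ v, InForest N v → Precedes u v → v = dfsNext N u ∨ Precedes (dfsNext N u) v := by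
    rintro ⟨k, w⟩ hu
    obtain ⟨h1, h2, h3⟩ := nextAfterSubtree_spec N k w hu
    by_cases hs : 0 < N (k, w)
    · have hnext : dfsNext N (k, w) = (k, 0 :: w) := by simp [dfsNext, hs]
      rw [hnext]
      have hlt : w.reverse < (0 :: w).reverse := by simpa using lex_lt_append w.reverse 0 []
      refine ⟨by simp [InForest, hu, hs], Or.inr ⟨rfl, hlt⟩, ?_⟩
      rintro ⟨l, v⟩ - (h | ⟨h, h'⟩)
      · exact Or.inr (Or.inl h)
      · obtain rfl : k = l := h
        by_cases hp : w.reverse <+: v.reverse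
        · obtain ⟨t, rfl⟩ := List.reverse_prefix.1 hp
          rcases List.eq_nil_or_concat t with rfl | ⟨t, a, rfl⟩
          · exact absurd h' (lt_irrefl _)
          · rcases Nat.eq_zero_or_pos a with rfl | ha
            · rcases List.eq_nil_or_concat t with rfl | ⟨t, b, rfl⟩
              · exact Or.inl rfl
              · refine Or.inr (Or.inr ⟨rfl, ?_⟩)
                have h := lex_lt_append (w.reverse ++ [0]) b t.reverse
                rw [List.append_assoc] at h
                simpa using h
            · refine Or.inr (Or.inr ⟨rfl, ?_⟩)
              simp [lex_append_left, List.cons_lt_cons_iff, ha]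
        · refine Or.inr (Or.inr ⟨rfl, ?_⟩)
          rw [List.reverse_cons]
          exact lex_append_of_not_prefix _ h' hp
    · have hnext : dfsNext N (k, w) = nextAfterSubtree N (k, w) := by simp [dfsNext, hs]
      rw [hnext]
      refine ⟨h1, by simpa using h2 [], fun v hv hp => h3 v hv hp ?_⟩
      rintro ⟨hl, hpre⟩
      obtain ⟨l, v⟩ := v
      obtain rfl : l = k := hl
      obtain ⟨t, rfl⟩ := List.reverse_prefix.1 hpre
      rcases List.eq_nil_or_concat t with rfl | ⟨t, a, rfl⟩
      · rcases hp with h | ⟨-, h⟩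
        · exact lt_irrefl _ h
        · exact lt_irrefl _ h
      · have : ∀ t : List ℕ, InForest N (l, t ++ a :: w) → a < N (l, w) := by
          intro t
          induction t with
          | nil => intro h; simp only [List.nil_append, InForest] at h; exact h.2
          | cons b t ih => intro h; simp only [List.cons_append, InForest] at h; exact ih h.1
        have := this t (by simpa using hv)
        omega
  have mem : ∀ i, InForest N (dfs N i) := by
    intro i
    induction i with
    | zero => simp [dfs, InForest]
    | succ i ih => exact (step _ ih).1
  exact ⟨mem i, (step _ (mem i)).2⟩

end Forest

section BranchingWalk

variable {d : ℕ}

/-- The position of a vertex: the sum of the displacements on the path from the root `(0, [])`.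
`X u` is the displacement on the edge between `u` and its parent; the parent of `(k + 1, [])` is
`(k, [])`. -/
def position (X : Vertex → Lattice d) : Vertex → Lattice d
  | (k, []) => ∑ i ∈ Finset.range k, X (i + 1, [])
  | (k, j :: v) => position X (k, v) + X (k, j :: v)

/-- The set `R[0,n]` of the positions of the first `n + 1` vertices in depth-first order. -/
def range (N : Vertex → ℕ) (X : Vertex → Lattice d) (n : ℕ) : Finset (Lattice d) :=
  (Finset.range (n + 1)).image fun i => position X (dfs N i)

/-- The law of the numbers of children and of the displacements: i.i.d. numbers of children with
law `μ` and, independently, i.i.d. displacements with law `θ`. -/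
def brwLaw (μ : Measure ℕ) [IsProbabilityMeasure μ] (θ : Measure (Lattice d))
    [IsProbabilityMeasure θ] : Measure ((Vertex → ℕ) × (Vertex → Lattice d)) :=
  (Measure.infinitePi fun _ : Vertex => μ).prod (Measure.infinitePi fun _ : Vertex => θ)

end BranchingWalk

end BRWCapacity

end

open scoped ENNReal

noncomputable section

namespace BRWCapacity

/-!
With high probability the first `n` vertices lie in the first `n ^ (1/2 + o(1))` trees, and these
have height at most `n ^ (1/2 + o(1))`: a second moment bounds from below the number of vertices up
to height `n ^ (1/2)`, and a critical tree reaches height `h` with probability `O(1/h)`.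

Both bounds on the capacity come from the last-exit decomposition
`∑ y ∈ A, G (y - x) * P_y (no return to A) = P_x (A is hit)`, where `G` is the Green function of
`η`. For the upper bound, an exponential moment puts all the `V_u` into a box of side
`R = n ^ (1/4 + o(1))`. Since `η` is centred with finite variance, the potential `G` of the box is
at least `c * R ^ 2` at each of its points, so its capacity is `O(R ^ (d - 2))`.

For the lower bound, summing the decomposition over `m` points whose total potential is at most
`K` at each of them gives `m ≤ K * cap`. Discarding from `u_0, …, u_n` the vertices whose
potential is more than twice the average leaves at least half of them, so
`n ^ 2 ≤ 4 * (∑ i j, G (V_{u_i} - V_{u_j})) * cap`. As `θ` is symmetric, `V_u - V_v` is a random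
walk with jump law `θ` at the time given by the tree distance of `u` and `v`. By irreducibility, a
power of its law dominates a multiple of a product of laws uniform on pairs `{0, a}`, whence the
local bound `sup_z P (S_k = z) = O (k ^ (-d/2))` and `E G (S_k) = O (k ^ (-(d - 2)/2))`. Summing
over pairs of vertices according to their last common ancestor, the energy has expectation
`n ^ (2 - (d - 2)/4 + o(1))` when `d ≤ 5`.

Both bounds fail with probability at most `n ^ (-δ)` after an arbitrarily small loss in the
exponent, so they hold almost surely along `n = 2 ^ k`, and then for all `n` because the capacity
of the range is monotone in `n`.
-/

section InfiniteProduct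

open ProbabilityTheory

variable {ι E : Type*} [MeasurableSpace E] (ν : Measure E) [IsProbabilityMeasure ν]

/-- The σ-algebra generated by the coordinates with index in `S`. -/
abbrev coordinateSigma (E : Type*) [MeasurableSpace E] (S : Set ι) : MeasurableSpace (ι → E) :=
  ⨆ i ∈ S, MeasurableSpace.comap (fun ξ : ι → E => ξ i) inferInstance

lemma measurable_eval_coordinateSigma {S : Set ι} {i : ι} (hi : i ∈ S) :
    Measurable[coordinateSigma E S] fun ξ : ι → E => ξ i :=
  (comap_measurable _).mono
    (le_iSup₂ (f := fun i (_ : i ∈ S) =>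
      MeasurableSpace.comap (fun ξ : ι → E => ξ i) inferInstance) i hi) le_rfl

lemma coordinateSigma_le (S : Set ι) : coordinateSigma E S ≤ MeasurableSpace.pi :=
  iSup₂_le fun i _ => (measurable_pi_apply i).comap_le

lemma iIndepFun_eval : iIndepFun (fun i (ξ : ι → E) => ξ i) (Measure.infinitePi fun _ : ι => ν) :=
  iIndepFun_infinitePi (X := fun _ (x : E) => x) fun _ => measurable_id

lemma indep_coordinateSigma {S T : Set ι} (hST : Disjoint S T) :
    Indep (coordinateSigma E S) (coordinateSigma E T) (Measure.infinitePi fun _ : ι => ν) :=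
  indep_iSup_of_disjoint (fun i => (measurable_pi_apply i).comap_le) (iIndepFun_eval ν) hST

end InfiniteProduct

section Convolution

variable {M : Type*} [MeasurableSpace M]

lemma conv_singleton [AddCommGroup M] [MeasurableAdd₂ M] [MeasurableSingletonClass M]
    (ρ ν : Measure M) [SFinite ν] (z : M) : (ρ ∗ ν) {z} = ∫⁻ x, ν {z - x} ∂ρ := by
  rw [Measure.conv, Measure.map_apply measurable_add (measurableSet_singleton z),
    Measure.prod_apply (measurable_add (measurableSet_singleton z))]
  congr! with x
  ext y
  simp [eq_sub_iff_add_eq']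

/-- The `n`-fold convolution power of `η`: the law of the sum of `n` independent variables with
law `η`. -/
def convPow [AddMonoid M] (η : Measure M) : ℕ → Measure M
  | 0 => Measure.dirac 0
  | n + 1 => η ∗ convPow η n

instance isProbabilityMeasure_convPow [AddMonoid M] [MeasurableAdd₂ M] (η : Measure M)
    [IsProbabilityMeasure η] (n : ℕ) : IsProbabilityMeasure (convPow η n) := by
  induction n with
  | zero => unfold convPow; infer_instance
  | succ n ih => unfold convPow; infer_instance

lemma convPow_add [AddMonoid M] [MeasurableAdd₂ M] (η : Measure M) [IsProbabilityMeasure η]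
    (m n : ℕ) : convPow η (m + n) = convPow η m ∗ convPow η n := by
  induction m with
  | zero => simp [convPow]
  | succ m ih => rw [Nat.succ_add, convPow, ih, convPow, Measure.conv_assoc]

lemma convPow_convPow [AddMonoid M] [MeasurableAdd₂ M] (η : Measure M) [IsProbabilityMeasure η]
    (m n : ℕ) : convPow (convPow η m) n = convPow η (m * n) := by
  induction n with
  | zero => rfl
  | succ n ih =>
    calc convPow η m ∗ convPow (convPow η m) n = convPow η m ∗ convPow η (m * n) := by rw [ih]
      _ = convPow η (m * (n + 1)) := by rw [← convPow_add, Nat.mul_succ, add_comm]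

lemma convPow_neg [AddCommGroup M] [MeasurableAdd₂ M] [MeasurableNeg M] (η : Measure M)
    [IsProbabilityMeasure η] (n : ℕ) : convPow η.neg n = (convPow η n).neg := by
  induction n with
  | zero => simp [convPow, Measure.neg, Measure.map_dirac' measurable_neg]
  | succ n ih =>
    rw [convPow, ih, convPow]
    exact (Measure.map_conv_addMonoidHom (negAddMonoidHom : M →+ M) measurable_neg).symm

open ProbabilityTheory in
lemma map_sum_eq_convPow [AddCommMonoid M] [MeasurableAdd₂ M] {Ω ι : Type*}
    [MeasurableSpace Ω] {P : Measure Ω} [IsProbabilityMeasure P] {η : Measure M} {Y : ι → Ω → M}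
    (hm : ∀ i, Measurable (Y i)) (hindep : iIndepFun Y P) (hlaw : ∀ i, P.map (Y i) = η)
    (F : Finset ι) : P.map (∑ i ∈ F, Y i) = convPow η F.card := by
  classical
  induction F using Finset.induction_on with
  | empty =>
    rw [Finset.sum_empty, Finset.card_empty, convPow]
    exact (Measure.map_const P (0 : M)).trans (by simp)
  | insert i F hi ih =>
    rw [Finset.sum_insert hi, Finset.card_insert_of_notMem hi, convPow, ← ih, ← hlaw i]
    exact (hindep.indepFun_finsetSum_of_notMem hm hi).symm.map_add_eq_map_conv_map (hm i)
      (Finset.sum_induction _ Measurable (fun _ _ h₁ h₂ => h₁.add h₂) measurable_zero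
        fun j _ => hm j)

lemma pi_conv_pi {ι : Type*} [Fintype ι] [AddMonoid M] [MeasurableAdd₂ M] (ρ ν : ι → Measure M)
    [∀ i, IsProbabilityMeasure (ρ i)] [∀ i, IsProbabilityMeasure (ν i)] :
    Measure.pi ρ ∗ Measure.pi ν = Measure.pi fun i => ρ i ∗ ν i := by
  have hprod := (measurePreserving_arrowProdEquivProdArrow M M ι ρ ν).map_eq
  have hadd := Measure.pi_map_pi (μ := fun i => (ρ i).prod (ν i)) (f := fun _ x => x.1 + x.2)
    fun i => (measurable_fst.add measurable_snd).aemeasurable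
  unfold Measure.conv
  rw [← hadd, ← hprod, Measure.map_map (by fun_prop) (MeasurableEquiv.measurable _)]
  rfl

lemma convPow_pi {ι : Type*} [Fintype ι] [AddMonoid M] [MeasurableAdd₂ M] (ρ : ι → Measure M)
    [∀ i, IsProbabilityMeasure (ρ i)] (k : ℕ) :
    convPow (Measure.pi ρ) k = Measure.pi fun i => convPow (ρ i) k := by
  induction k with
  | zero =>
    simp only [convPow]
    rw [← Measure.infinitePi_eq_pi, Measure.infinitePi_dirac]
    rfl
  | succ k ih => rw [convPow, ih, pi_conv_pi]; rfl

lemma map_sum_range_infinitePi [AddCommMonoid M] [MeasurableAdd₂ M] (η : Measure M)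
    [IsProbabilityMeasure η] (n : ℕ) :
    (Measure.infinitePi fun _ : ℕ => η).map (fun ξ => ∑ i ∈ Finset.range n, ξ i) =
      convPow η n := by
  have h := map_sum_eq_convPow (fun i => measurable_pi_apply i) (iIndepFun_eval η)
    (fun i => Measure.infinitePi_map_eval (fun _ : ℕ => η) i) (Finset.range n)
  rwa [Finset.sum_fn, Finset.card_range] at h

end Convolution

section Green

variable {G : Type*} [MeasurableSpace G] [AddCommGroup G]

/-- The Green function of the random walk with jump law `η`: `green η z` is the expected number
of visits to `z` of the walk started at `0`. -/
def green (η : Measure G) (z : G) : ℝ≥0∞ := ∑' n, convPow η n {z}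

/-- Transience of the random walk with jump law `η`: its Green function is finite. -/
def IsTransient (η : Measure G) : Prop := ∀ z, green η z ≠ ∞

variable [MeasurableAdd₂ G] [MeasurableNeg G]

lemma green_neg (η : Measure G) [IsProbabilityMeasure η] (z : G) :
    green η.neg z = green η (-z) := by
  simp only [green, convPow_neg, Measure.neg_apply, Set.neg_singleton]

lemma IsTransient.neg {η : Measure G} [IsProbabilityMeasure η] (hη : IsTransient η) :
    IsTransient η.neg := fun z => by
  rw [green_neg]
  exact hη _

end Green

section LastExit

open ProbabilityTheory

variable {d : ℕ}

/-- The law of the sequence of increments of the walk with jump distribution `η`. -/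
abbrev stepsLaw (η : Measure (Lattice d)) : Measure (ℕ → Lattice d) :=
  Measure.infinitePi fun _ : ℕ => η

lemma walkPath_add (x : Lattice d) (ξ : ℕ → Lattice d) (n m : ℕ) :
    walkPath x ξ (n + m) = walkPath (walkPath x ξ n) (fun k => ξ (n + k)) m := by
  simp only [walkPath, Finset.sum_range_add, add_assoc]

@[fun_prop]
lemma measurable_walkPath_apply (x : Lattice d) (n : ℕ) :
    Measurable fun ξ : ℕ → Lattice d => walkPath x ξ n :=
  (measurable_pi_apply n).comp (measurable_walkPath x)

/-- The event that the walk started at `y` does not return to `A`. -/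
def escapeEvent (A : Finset (Lattice d)) (y : Lattice d) : Set (ℕ → Lattice d) :=
  {ξ | ∀ m, 1 ≤ m → walkPath y ξ m ∉ A}

/-- The event that the walk started at `x` is at `y` at time `n` and avoids `A` afterwards. -/
def lastVisitEvent (A : Finset (Lattice d)) (x y : Lattice d) (n : ℕ) : Set (ℕ → Lattice d) :=
  {ξ | walkPath x ξ n = y ∧ ∀ m, 1 ≤ m → walkPath x ξ (n + m) ∉ A}

/-- The probability that the walk started at `y` does not return to `A`. -/
def escapeProb (η : Measure (Lattice d)) (A : Finset (Lattice d)) (y : Lattice d) : ℝ≥0∞ :=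
  stepsLaw η (escapeEvent A y)

/-- The probability that the walk started at `x` visits `A`, at time `0` or later. -/
def hitProb (η : Measure (Lattice d)) (A : Finset (Lattice d)) (x : Lattice d) : ℝ≥0∞ :=
  stepsLaw η {ξ | ∃ n, walkPath x ξ n ∈ A}

lemma measurableSet_escapeEvent (A : Finset (Lattice d)) (y : Lattice d) :
    MeasurableSet (escapeEvent A y) := by
  simp only [escapeEvent, Set.ofPred_forall]
  exact MeasurableSet.iInter fun m => MeasurableSet.iInter fun _ =>
    (measurable_walkPath_apply y m A.measurableSet).compl

lemma lastVisitEvent_eq_inter (A : Finset (Lattice d)) (x y : Lattice d) (n : ℕ) :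
    lastVisitEvent A x y n =
      {ξ | walkPath x ξ n = y} ∩ (fun ξ k => ξ (n + k)) ⁻¹' escapeEvent A y := by
  ext ξ
  simp only [lastVisitEvent, escapeEvent, walkPath_add, Set.mem_ofPred_eq, Set.mem_inter_iff,
    Set.mem_preimage]
  refine and_congr_right ?_
  rintro rfl
  rfl

lemma measurableSet_lastVisitEvent (A : Finset (Lattice d)) (x y : Lattice d) (n : ℕ) :
    MeasurableSet (lastVisitEvent A x y n) := by
  rw [lastVisitEvent_eq_inter]
  exact (measurable_walkPath_apply x n (measurableSet_singleton y)).inter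
    (measurableSet_preimage (by fun_prop) (measurableSet_escapeEvent A y))

lemma pairwise_disjoint_lastVisitEvent (A : Finset (Lattice d)) (x : Lattice d) :
    Pairwise (Function.onFun Disjoint fun p : A × ℕ => lastVisitEvent A x p.1 p.2) := by
  have hle : ∀ {y y' : A} {n n' : ℕ} {ξ : ℕ → Lattice d}, ξ ∈ lastVisitEvent A x y n →
      ξ ∈ lastVisitEvent A x y' n' → n' ≤ n := by
    rintro y y' n n' ξ ⟨-, havoid⟩ ⟨hvisit, -⟩
    by_contra! hlt
    refine havoid (n' - n) (by omega) ?_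
    rw [Nat.add_sub_cancel' hlt.le, hvisit]
    exact y'.2
  rintro ⟨y, n⟩ ⟨y', n'⟩ hne
  refine Set.disjoint_left.2 fun ξ hξ hξ' => hne ?_
  obtain rfl : n = n' := le_antisymm (hle hξ' hξ) (hle hξ hξ')
  exact Prod.ext (Subtype.ext (hξ.1.symm.trans hξ'.1)) rfl

lemma exists_mem_lastVisitEvent {A : Finset (Lattice d)} {x : Lattice d} {ξ : ℕ → Lattice d}
    (hfin : ∀ᶠ n in atTop, walkPath x ξ n ∉ A) (hhit : ∃ n, walkPath x ξ n ∈ A) :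
    ∃ p : A × ℕ, ξ ∈ lastVisitEvent A x p.1 p.2 := by
  have hfinite : {n | walkPath x ξ n ∈ A}.Finite := by
    rw [← Nat.cofinite_eq_atTop] at hfin
    simpa using hfin
  obtain ⟨n, hn, hmax⟩ := hfinite.exists_maximal hhit
  refine ⟨(⟨walkPath x ξ n, hn⟩, n), rfl, fun m hm hmem => ?_⟩
  have := hmax hmem (Nat.le_add_right n m)
  omega

variable (η : Measure (Lattice d)) [IsProbabilityMeasure η]

lemma stepsLaw_walkPath_eq (x y : Lattice d) (n : ℕ) :
    stepsLaw η {ξ | walkPath x ξ n = y} = convPow η n {y - x} := by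
  rw [← map_sum_range_infinitePi, Measure.map_apply (by fun_prop) (measurableSet_singleton _)]
  congr 1
  ext ξ
  simp [walkPath, eq_sub_iff_add_eq']

lemma stepsLaw_lastVisitEvent (A : Finset (Lattice d)) (x y : Lattice d) (n : ℕ) :
    stepsLaw η (lastVisitEvent A x y n) = convPow η n {y - x} * escapeProb η A y := by
  have hpast : MeasurableSet[coordinateSigma (Lattice d) (Set.Iio n)]
      {ξ | walkPath x ξ n = y} := by
    refine measurableSet_eq_fun (f := fun ξ => walkPath x ξ n) (g := fun _ => y) ?_
      measurable_const
    exact measurable_const.add <| Finset.measurable_sum _ fun i hi =>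
      measurable_eval_coordinateSigma (Finset.mem_range.1 hi)
  have hfuture : MeasurableSet[coordinateSigma (Lattice d) (Set.Ici n)]
      ((fun ξ k => ξ (n + k)) ⁻¹' escapeEvent A y) :=
    (@measurable_pi_iff _ _ _ (coordinateSigma (Lattice d) (Set.Ici n)) _ _).2
      (fun k => measurable_eval_coordinateSigma (Nat.le_add_right n k))
      (measurableSet_escapeEvent A y)
  have hdisj : Disjoint (Set.Iio n) (Set.Ici n) := Set.Iio_disjoint_Ici le_rfl
  rw [lastVisitEvent_eq_inter,
    (Indep_iff _ _ _).1 (indep_coordinateSigma η hdisj) _ _ hpast hfuture,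
    stepsLaw_walkPath_eq, escapeProb, ← Measure.map_apply (by fun_prop)
      (measurableSet_escapeEvent A y),
    Measure.map_infinitePi_infinitePi_of_inj (add_right_injective n)]

lemma escapeProb_ne_top (A : Finset (Lattice d)) (y : Lattice d) : escapeProb η A y ≠ ∞ :=
  measure_ne_top _ _

lemma hitProb_le_one (A : Finset (Lattice d)) (x : Lattice d) : hitProb η A x ≤ 1 := prob_le_one

lemma hitProb_of_mem {A : Finset (Lattice d)} {x : Lattice d} (hx : x ∈ A) :
    hitProb η A x = 1 := by
  have huniv : {ξ : ℕ → Lattice d | ∃ n, walkPath x ξ n ∈ A} = Set.univ :=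
    Set.eq_univ_of_forall fun ξ => ⟨0, by simpa [walkPath] using hx⟩
  rw [hitProb, huniv, measure_univ]

variable {η}

lemma IsTransient.ae_eventually_walkPath_notMem (hη : IsTransient η) (A : Finset (Lattice d))
    (x : Lattice d) : ∀ᵐ ξ ∂stepsLaw η, ∀ᶠ n in atTop, walkPath x ξ n ∉ A := by
  refine ae_eventually_notMem (s := fun n => {ξ | walkPath x ξ n ∈ A}) ?_
  have hvisit : ∀ n, stepsLaw η {ξ | walkPath x ξ n ∈ A} ≤ ∑ y ∈ A, convPow η n {y - x} := by
    intro n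
    have hunion : {ξ : ℕ → Lattice d | walkPath x ξ n ∈ A} = ⋃ y ∈ A, {ξ | walkPath x ξ n = y} := by
      ext ξ; simp
    simpa only [hunion, stepsLaw_walkPath_eq] using
      measure_biUnion_finset_le (μ := stepsLaw η) A fun y => {ξ | walkPath x ξ n = y}
  refine ne_top_of_le_ne_top ?_ (ENNReal.tsum_le_tsum hvisit)
  rw [Summable.tsum_finsetSum fun _ _ => ENNReal.summable]
  exact ENNReal.sum_ne_top.2 fun y _ => hη (y - x)

theorem IsTransient.sum_green_mul_escapeProb (hη : IsTransient η) (A : Finset (Lattice d))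
    (x : Lattice d) : ∑ y ∈ A, green η (y - x) * escapeProb η A y = hitProb η A x := by
  calc ∑ y ∈ A, green η (y - x) * escapeProb η A y
      = ∑' p : A × ℕ, stepsLaw η (lastVisitEvent A x p.1 p.2) := by
        simp_rw [stepsLaw_lastVisitEvent, ENNReal.tsum_prod', tsum_fintype, ENNReal.tsum_mul_right]
        exact (Finset.sum_coe_sort A fun y => green η (y - x) * escapeProb η A y).symm
    _ = stepsLaw η (⋃ p : A × ℕ, lastVisitEvent A x p.1 p.2) :=
        (measure_iUnion (pairwise_disjoint_lastVisitEvent A x)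
          fun p => measurableSet_lastVisitEvent A x p.1 p.2).symm
    _ = hitProb η A x := by
        refine measure_congr ?_
        filter_upwards [hη.ae_eventually_walkPath_notMem A x] with ξ hξ
        refine propext ⟨fun h => ?_, fun h => Set.mem_iUnion.2 (exists_mem_lastVisitEvent hξ h)⟩
        obtain ⟨p, hp⟩ := Set.mem_iUnion.1 h
        exact ⟨p.2, hp.1 ▸ p.1.2⟩

end LastExit

section Capacity

variable {d : ℕ} {η : Measure (Lattice d)} [IsProbabilityMeasure η]

/-- The capacity as an extended nonnegative number. -/
def ecapacity (η : Measure (Lattice d)) (A : Finset (Lattice d)) : ℝ≥0∞ :=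
  ∑ x ∈ A, escapeProb η A x

lemma returnTime_eq_top (A : Finset (Lattice d)) (S : ℕ → Lattice d) :
    returnTime A S = ⊤ ↔ ∀ m, 1 ≤ m → S m ∉ A := by
  simp only [returnTime, iInf_eq_top, ENat.natCast_ne_top, imp_false, not_and]

lemma walkLaw_returnTime_eq_top (η : Measure (Lattice d)) [IsProbabilityMeasure η]
    (A : Finset (Lattice d)) (x : Lattice d) :
    walkLaw η x {S | returnTime A S = ⊤} = escapeProb η A x := by
  have hmeas : MeasurableSet {S : ℕ → Lattice d | returnTime A S = ⊤} := by
    simp only [returnTime_eq_top, Set.ofPred_forall]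
    exact MeasurableSet.iInter fun m => MeasurableSet.iInter fun _ =>
      (measurable_pi_apply (X := fun _ => Lattice d) m A.measurableSet).compl
  rw [walkLaw, Measure.map_apply (measurable_walkPath x) hmeas]
  simp only [returnTime_eq_top]
  rfl

lemma ecapacity_ne_top (η : Measure (Lattice d)) [IsProbabilityMeasure η]
    (A : Finset (Lattice d)) : ecapacity η A ≠ ∞ :=
  ENNReal.sum_ne_top.2 fun x _ => escapeProb_ne_top η A x

lemma capacity_eq_toReal (η : Measure (Lattice d)) [IsProbabilityMeasure η]
    (A : Finset (Lattice d)) : capacity η A = (ecapacity η A).toReal := by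
  rw [ecapacity, ENNReal.toReal_sum fun x _ => escapeProb_ne_top η A x]
  simp_rw [capacity, Measure.real, walkLaw_returnTime_eq_top]

instance isProbabilityMeasure_neg : IsProbabilityMeasure η.neg :=
  Measure.isProbabilityMeasure_map measurable_neg.aemeasurable

-- Each point of `A` is hit with probability one by the reversed walk, so expand `1` by the last
-- exit decomposition for the reversed walk and `B`, and resum with that for the walk and `A`.
lemma IsTransient.ecapacity_le_ecapacity_neg (hη : IsTransient η) {A B : Finset (Lattice d)}
    (hAB : A ⊆ B) : ecapacity η A ≤ ecapacity η.neg B := by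
  calc ecapacity η A
      = ∑ x ∈ A, escapeProb η A x * ∑ y ∈ B, green η.neg (y - x) * escapeProb η.neg B y := by
        refine Finset.sum_congr rfl fun x hx => ?_
        rw [hη.neg.sum_green_mul_escapeProb, hitProb_of_mem _ (hAB hx), mul_one]
    _ = ∑ y ∈ B, escapeProb η.neg B y * ∑ x ∈ A, green η (x - y) * escapeProb η A x := by
        simp_rw [Finset.mul_sum]
        rw [Finset.sum_comm]
        refine Finset.sum_congr rfl fun y _ => Finset.sum_congr rfl fun x _ => ?_
        rw [green_neg, neg_sub]
        ring
    _ ≤ ecapacity η.neg B := by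
        refine Finset.sum_le_sum fun y _ => ?_
        rw [hη.sum_green_mul_escapeProb]
        exact mul_le_of_le_one_right' (hitProb_le_one η A y)

theorem IsTransient.ecapacity_mono (hη : IsTransient η) {A B : Finset (Lattice d)} (hAB : A ⊆ B) :
    ecapacity η A ≤ ecapacity η B :=
  calc ecapacity η A ≤ ecapacity η.neg B := hη.ecapacity_le_ecapacity_neg hAB
    _ ≤ ecapacity η.neg.neg B := hη.neg.ecapacity_le_ecapacity_neg subset_rfl
    _ = ecapacity η B := by simp only [Measure.neg_neg]

end Capacity

section Energy

variable {ι : Type*}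

lemma exists_subset_le_two_mul_average (I : Finset ι) (g : ι → ℝ≥0∞) :
    ∃ J ⊆ I, (I.card : ℝ≥0∞) ≤ 2 * J.card ∧ ∀ j ∈ J, g j ≤ 2 * (∑ i ∈ I, g i) / I.card := by
  classical
  set E := ∑ i ∈ I, g i with hE
  have le_E : ∀ j ∈ I, g j ≤ E := fun j hj => Finset.single_le_sum (fun _ _ => zero_le) hj
  rcases eq_or_ne E 0 with hE0 | hE0
  · exact ⟨I, subset_rfl, le_mul_of_one_le_left' one_le_two, fun j hj =>
      ((le_E j hj).trans_eq hE0).trans zero_le⟩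
  rcases eq_or_ne E ∞ with hEtop | hEtop
  · refine ⟨I, subset_rfl, le_mul_of_one_le_left' one_le_two, fun j _ => ?_⟩
    simp [hEtop, ENNReal.top_div]
  set J := I.filter fun j => g j ≤ 2 * E / I.card with hJ
  have hbad : ((I \ J).card : ℝ≥0∞) * (2 * E) ≤ I.card * E := by
    rcases I.eq_empty_or_nonempty with rfl | hI
    · simp
    rw [← ENNReal.div_le_iff' (by simp [hI.ne_empty]) (by simp), mul_div_assoc, ← nsmul_eq_mul]
    refine (Finset.card_nsmul_le_sum _ g _ fun j hj => ?_).trans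
      (Finset.sum_le_sum_of_subset Finset.sdiff_subset)
    simp only [hJ, Finset.mem_sdiff, Finset.mem_filter, not_and, not_le] at hj
    exact (hj.2 hj.1).le
  have hcard : 2 * (I \ J).card ≤ I.card := by
    rw [← mul_assoc, ENNReal.mul_le_mul_iff_left hE0 hEtop] at hbad
    rw [mul_comm]
    exact_mod_cast hbad
  have hsplit : (I \ J).card + J.card = I.card :=
    Finset.card_sdiff_add_card_eq_card (Finset.filter_subset _ _)
  refine ⟨J, Finset.filter_subset _ _, ?_, fun j hj => (Finset.mem_filter.1 hj).2⟩
  exact_mod_cast (show I.card ≤ 2 * J.card by omega)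

variable {d : ℕ} {η : Measure (Lattice d)} [IsProbabilityMeasure η]

lemma IsTransient.card_le_mul_ecapacity (hη : IsTransient η) (J : Finset ι) (V : ι → Lattice d)
    {K : ℝ≥0∞} (hK : ∀ j ∈ J, ∑ i ∈ J, green η (V j - V i) ≤ K) :
    (J.card : ℝ≥0∞) ≤ K * ecapacity η (J.image V) := by
  calc (J.card : ℝ≥0∞) = ∑ i ∈ J, hitProb η (J.image V) (V i) := by
        rw [Finset.sum_congr rfl fun i hi => hitProb_of_mem η (Finset.mem_image_of_mem V hi)]
        simp
    _ = ∑ y ∈ J.image V, (∑ i ∈ J, green η (y - V i)) * escapeProb η (J.image V) y := by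
        simp_rw [← hη.sum_green_mul_escapeProb, Finset.sum_mul]
        rw [Finset.sum_comm]
    _ ≤ ∑ y ∈ J.image V, K * escapeProb η (J.image V) y := by
        refine Finset.sum_le_sum fun y hy => ?_
        obtain ⟨j, hj, rfl⟩ := Finset.mem_image.1 hy
        gcongr
        exact hK j hj
    _ = K * ecapacity η (J.image V) := by rw [ecapacity, Finset.mul_sum]

theorem IsTransient.card_sq_le_mul_ecapacity (hη : IsTransient η) (I : Finset ι)
    (V : ι → Lattice d) :
    (I.card : ℝ≥0∞) ^ 2 ≤
      4 * (∑ j ∈ I, ∑ i ∈ I, green η (V j - V i)) * ecapacity η (I.image V) := by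
  rcases I.eq_empty_or_nonempty with rfl | hI
  · simp
  set E := ∑ j ∈ I, ∑ i ∈ I, green η (V j - V i)
  obtain ⟨J, hJI, hcard, hJ⟩ :=
    exists_subset_le_two_mul_average I fun j => ∑ i ∈ I, green η (V j - V i)
  have hJcap : (J.card : ℝ≥0∞) ≤ 2 * E / I.card * ecapacity η (J.image V) :=
    hη.card_le_mul_ecapacity J V fun j hj =>
      (Finset.sum_le_sum_of_subset hJI).trans (hJ j hj)
  calc (I.card : ℝ≥0∞) ^ 2 = I.card * I.card := sq _
    _ ≤ I.card * (2 * (2 * E / I.card * ecapacity η (J.image V))) := by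
      gcongr
      exact hcard.trans (by gcongr)
    _ ≤ I.card * (2 * (2 * E / I.card * ecapacity η (I.image V))) := by
      gcongr
      exact hη.ecapacity_mono (Finset.image_subset_image hJI)
    _ = 4 * (I.card * (E / I.card)) * ecapacity η (I.image V) := by
      rw [mul_div_assoc]
      ring
    _ = 4 * E * ecapacity η (I.image V) := by
      rw [ENNReal.mul_div_cancel (by simp [hI.ne_empty]) (by simp)]

end Energy

section Box

open ProbabilityTheory

lemma convPow_le_abs_le {M : Type*} [MeasurableSpace M] [AddCommMonoid M] [MeasurableAdd₂ M]
    {η : Measure M} [IsProbabilityMeasure η] {φ : M →+ ℝ} (hφ : Measurable φ)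
    (hmean : ∫ x, φ x ∂η = 0) (hL2 : MemLp φ 2 η) (n : ℕ) {r : ℝ} (hr : 0 < r) :
    convPow η n {z | r ≤ |φ z|} ≤ ENNReal.ofReal (n * Var[φ; η] / r ^ 2) := by
  set P : Measure (ℕ → M) := Measure.infinitePi fun _ => η
  set Y : ℕ → (ℕ → M) → ℝ := fun j ξ => φ (ξ j)
  have hident : ∀ j, IdentDistrib (Y j) φ P η := fun j =>
    IdentDistrib.comp (f := fun ξ : ℕ → M => ξ j) (g := id)
      ⟨(measurable_pi_apply j).aemeasurable, aemeasurable_id,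
      (Measure.infinitePi_map_eval _ j).trans Measure.map_id.symm⟩ hφ
  have hmem : ∀ j, MemLp (Y j) 2 P := fun j => (hident j).memLp_iff.2 hL2
  have hindep : iIndepFun Y P := (iIndepFun_eval η).comp (fun _ => φ) fun _ => hφ
  have hmean_sum : ∫ ξ, (∑ j ∈ Finset.range n, Y j) ξ ∂P = 0 := by
    simp_rw [Finset.sum_apply]
    rw [integral_finsetSum _ fun j _ => (hmem j).integrable one_le_two]
    exact Finset.sum_eq_zero fun j _ => (hident j).integral_eq.trans hmean
  have hvar : Var[∑ j ∈ Finset.range n, Y j; P] = n * Var[φ; η] := by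
    rw [IndepFun.variance_sum (fun j _ => hmem j) fun j _ k _ hjk => hindep.indepFun hjk,
      Finset.sum_congr rfl fun j _ => (hident j).variance_eq]
    simp
  have hcheb := meas_ge_le_variance_div_sq (memLp_finsetSum' (Finset.range n) fun j _ => hmem j) hr
  rw [hmean_sum, hvar] at hcheb
  rw [← map_sum_range_infinitePi, Measure.map_apply (by fun_prop)
    (measurableSet_le measurable_const hφ.abs)]
  simpa [Y] using hcheb

/-- The lattice points of the cube `[-R, R]^d`. -/
def box (d : ℕ) (R : ℕ) : Finset (Lattice d) :=
  Fintype.piFinset fun _ => Finset.Icc (-(R : ℤ)) R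

lemma mem_box {d R : ℕ} {x : Lattice d} : x ∈ box d R ↔ ∀ i, |x i| ≤ R := by
  simp [box, abs_le]

lemma card_box (d R : ℕ) : (box d R).card = (2 * R + 1) ^ d := by
  simp only [box, Fintype.card_piFinset, Int.card_Icc, Finset.prod_const, Finset.card_univ,
    Fintype.card_fin]
  congr 1
  omega

variable {d : ℕ} {η : Measure (Lattice d)}

lemma sum_green_box_le_sum_green_sub {R : ℕ} {y : Lattice d} (hy : y ∈ box d R) :
    ∑ z ∈ box d R, green η z ≤ ∑ x ∈ box d (2 * R), green η (y - x) := by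
  calc ∑ z ∈ box d R, green η z
      = ∑ x ∈ (box d R).image (fun z => y - z), green η (y - x) := by
        rw [Finset.sum_image fun a _ b _ hab => sub_right_injective hab]
        simp only [sub_sub_cancel]
    _ ≤ ∑ x ∈ box d (2 * R), green η (y - x) := by
        refine Finset.sum_le_sum_of_subset (Finset.image_subset_iff.2 fun z hz => mem_box.2 ?_)
        intro i
        have := abs_sub (y i) (z i)
        have := mem_box.1 hy i
        have := mem_box.1 hz i
        simp only [Pi.sub_apply, Nat.cast_mul, Nat.cast_ofNat]
        linarith

variable [IsProbabilityMeasure η]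

lemma half_le_convPow_box (hmean : ∀ i, ∫ x, (x i : ℝ) ∂η = 0)
    (hL2 : ∀ i, MemLp (fun x : Lattice d => (x i : ℝ)) 2 η) {n R : ℕ} (hR : 0 < R)
    (hn : n * ∑ i, Var[fun x : Lattice d => (x i : ℝ); η] ≤ (R : ℝ) ^ 2 / 2) :
    1 / 2 ≤ convPow η n (box d R) := by
  have hR' : (0 : ℝ) < R := by exact_mod_cast hR
  have hcompl : convPow η n (box d R : Set (Lattice d))ᶜ ≤ 1 / 2 := by
    have hsub : (box d R : Set (Lattice d))ᶜ ⊆ ⋃ i, {z | (R : ℝ) ≤ |(z i : ℝ)|} := by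
      intro z hz
      simp only [Set.mem_compl_iff, Finset.mem_coe, mem_box, not_forall, not_le] at hz
      obtain ⟨i, hi⟩ := hz
      exact Set.mem_iUnion.2 ⟨i, by exact_mod_cast hi.le⟩
    calc convPow η n (box d R : Set (Lattice d))ᶜ
        ≤ ∑ i, convPow η n {z | (R : ℝ) ≤ |(z i : ℝ)|} := by
          refine (measure_mono hsub).trans ((measure_iUnion_le _).trans_eq ?_)
          rw [tsum_fintype]
      _ ≤ ∑ i, ENNReal.ofReal (n * Var[fun x : Lattice d => (x i : ℝ); η] / R ^ 2) :=
          Finset.sum_le_sum fun i _ => convPow_le_abs_le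
            (φ := (Int.castAddHom ℝ).comp (Pi.evalAddMonoidHom (fun _ => ℤ) i))
            Measurable.of_discrete (hmean i) (hL2 i) n hR'
      _ = ENNReal.ofReal (n * (∑ i, Var[fun x : Lattice d => (x i : ℝ); η]) / R ^ 2) := by
          rw [← ENNReal.ofReal_sum_of_nonneg fun i _ => div_nonneg
            (mul_nonneg n.cast_nonneg (variance_nonneg _ _)) (sq_nonneg _), ← Finset.sum_div,
            ← Finset.mul_sum]
      _ ≤ ENNReal.ofReal (1 / 2) := by
          refine ENNReal.ofReal_le_ofReal ((div_le_iff₀ (by positivity)).2 (hn.trans_eq ?_))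
          ring
      _ = 1 / 2 := by rw [ENNReal.ofReal_div_of_pos two_pos]; simp
  calc (1 / 2 : ℝ≥0∞) = 1 - 1 / 2 := by simp
    _ ≤ 1 - convPow η n (box d R : Set (Lattice d))ᶜ := tsub_le_tsub_left hcompl _
    _ = convPow η n (box d R) := by
      rw [← prob_compl_eq_one_sub (box d R).measurableSet.compl, compl_compl]

lemma exists_le_sum_green_box (hmean : ∀ i, ∫ x, (x i : ℝ) ∂η = 0)
    (hL2 : ∀ i, MemLp (fun x : Lattice d => (x i : ℝ)) 2 η) :
    ∃ c : ℝ, 0 < c ∧ ∀ R : ℕ, ENNReal.ofReal (c * R ^ 2) ≤ ∑ z ∈ box d R, green η z := by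
  set s : ℝ := ∑ i, Var[fun x : Lattice d => (x i : ℝ); η] + 1
  have hs0 : 0 ≤ ∑ i, Var[fun x : Lattice d => (x i : ℝ); η] :=
    Finset.sum_nonneg fun i _ => variance_nonneg _ _
  have hspos : 0 < s := by linarith
  refine ⟨1 / (4 * s), by positivity, fun R => ?_⟩
  rcases R.eq_zero_or_pos with rfl | hR
  · simp
  set T := ⌊(R : ℝ) ^ 2 / (2 * s)⌋₊ + 1 with hT
  have hhalf : ∀ n ∈ Finset.range T, (1 / 2 : ℝ≥0∞) ≤ convPow η n (box d R) := by
    intro n hn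
    have hn' : (n : ℝ) ≤ (R : ℝ) ^ 2 / (2 * s) :=
      (Nat.le_floor_iff (by positivity)).1 (Nat.lt_succ_iff.1 (Finset.mem_range.1 hn))
    refine half_le_convPow_box hmean hL2 hR ?_
    calc n * ∑ i, Var[fun x : Lattice d => (x i : ℝ); η] ≤ (R : ℝ) ^ 2 / (2 * s) * s := by
          gcongr
          linarith
      _ = (R : ℝ) ^ 2 / 2 := by field_simp
  calc ENNReal.ofReal (1 / (4 * s) * R ^ 2) ≤ ENNReal.ofReal (T / 2) := by
        have hfloor : (R : ℝ) ^ 2 / (2 * s) ≤ T := by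
          rw [hT, Nat.cast_add, Nat.cast_one]
          exact (Nat.lt_floor_add_one _).le
        refine ENNReal.ofReal_le_ofReal ?_
        calc 1 / (4 * s) * (R : ℝ) ^ 2 = ((R : ℝ) ^ 2 / (2 * s)) / 2 := by field_simp; ring
          _ ≤ (T : ℝ) / 2 := by gcongr
    _ = ∑ n ∈ Finset.range T, (1 / 2 : ℝ≥0∞) := by
        rw [ENNReal.ofReal_div_of_pos two_pos]
        simp [div_eq_mul_inv]
    _ ≤ ∑ n ∈ Finset.range T, convPow η n (box d R) := Finset.sum_le_sum hhalf
    _ ≤ ∑' n, convPow η n (box d R) := ENNReal.sum_le_tsum _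
    _ = ∑ z ∈ box d R, green η z := by
        simp_rw [green]
        rw [← Summable.tsum_finsetSum fun _ _ => ENNReal.summable]
        simp_rw [sum_measure_singleton]

lemma IsTransient.ecapacity_mul_sum_green_box_le (hη : IsTransient η) {R : ℕ}
    {A : Finset (Lattice d)} (hA : A ⊆ box d R) :
    ecapacity η A * ∑ z ∈ box d R, green η z ≤ (box d (2 * R)).card := by
  calc ecapacity η A * ∑ z ∈ box d R, green η z
      ≤ ∑ y ∈ A, escapeProb η A y * ∑ x ∈ box d (2 * R), green η (y - x) := by
        rw [ecapacity, Finset.sum_mul]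
        gcongr with y hy
        exact sum_green_box_le_sum_green_sub (hA hy)
    _ = ∑ x ∈ box d (2 * R), hitProb η A x := by
        simp_rw [← hη.sum_green_mul_escapeProb, Finset.mul_sum]
        rw [Finset.sum_comm]
        simp_rw [mul_comm]
    _ ≤ ∑ x ∈ box d (2 * R), 1 := Finset.sum_le_sum fun x _ => hitProb_le_one η A x
    _ = (box d (2 * R)).card := by simp

theorem IsTransient.exists_ecapacity_le_of_subset_box (hη : IsTransient η) (hd : 2 ≤ d)
    (hmean : ∀ i, ∫ x, (x i : ℝ) ∂η = 0)
    (hL2 : ∀ i, MemLp (fun x : Lattice d => (x i : ℝ)) 2 η) :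
    ∃ C : ℝ, 0 < C ∧ ∀ (R : ℕ) (A : Finset (Lattice d)), 0 < R → A ⊆ box d R →
      ecapacity η A ≤ ENNReal.ofReal (C * (R : ℝ) ^ (d - 2)) := by
  obtain ⟨c, hc, hgreen⟩ := exists_le_sum_green_box hmean hL2
  refine ⟨5 ^ d / c, by positivity, fun R A hR hA => ?_⟩
  have hbox : 0 < c * (R : ℝ) ^ 2 := by positivity
  have hkey : ecapacity η A * ENNReal.ofReal (c * R ^ 2) ≤ ENNReal.ofReal ((5 * R) ^ d) := by
    grw [hgreen R, hη.ecapacity_mul_sum_green_box_le hA, card_box, ← ENNReal.ofReal_natCast]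
    refine ENNReal.ofReal_le_ofReal ?_
    exact_mod_cast Nat.pow_le_pow_left (show 2 * (2 * R) + 1 ≤ 5 * R by omega) d
  rw [← ENNReal.le_div_iff_mul_le (Or.inl (ENNReal.ofReal_pos.2 hbox).ne')
    (Or.inl ENNReal.ofReal_ne_top), ← ENNReal.ofReal_div_of_pos hbox] at hkey
  refine hkey.trans_eq (congrArg _ ?_)
  obtain ⟨e, rfl⟩ := Nat.exists_eq_add_of_le hd
  rw [Nat.add_sub_cancel_left, mul_pow]
  field_simp
  ring

end Box

section Coin

lemma centralBinom_sq_mul_le (m : ℕ) : m.centralBinom ^ 2 * (2 * m + 1) ≤ 16 ^ m := by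
  induction m with
  | zero => simp
  | succ m ih =>
    have h := Nat.succ_mul_centralBinom_succ m
    have h2 : (m + 1) ^ 2 * ((m + 1).centralBinom ^ 2 * (2 * (m + 1) + 1)) ≤
        (m + 1) ^ 2 * 16 ^ (m + 1) := by
      calc (m + 1) ^ 2 * ((m + 1).centralBinom ^ 2 * (2 * (m + 1) + 1))
          = ((m + 1) * (m + 1).centralBinom) ^ 2 * (2 * m + 3) := by ring
        _ = (m.centralBinom ^ 2 * (2 * m + 1)) * (4 * ((2 * m + 1) * (2 * m + 3))) := by
          rw [h]; ring
        _ ≤ 16 ^ m * (4 * (4 * (m + 1) ^ 2)) := by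
          exact Nat.mul_le_mul ih (Nat.mul_le_mul_left 4 (by nlinarith))
        _ = (m + 1) ^ 2 * 16 ^ (m + 1) := by ring
    exact Nat.le_of_mul_le_mul_left h2 (by positivity)

lemma choose_sq_mul_le (k s : ℕ) : k.choose s ^ 2 * (k + 1) ≤ 4 ^ k := by
  rcases Nat.even_or_odd' k with ⟨m, rfl | rfl⟩
  · have h := centralBinom_sq_mul_le m
    have h2 := Nat.choose_le_centralBinom s m
    calc (2 * m).choose s ^ 2 * (2 * m + 1) ≤ m.centralBinom ^ 2 * (2 * m + 1) := by gcongr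
      _ ≤ 16 ^ m := h
      _ = 4 ^ (2 * m) := by rw [pow_mul]; norm_num
  · have h := centralBinom_sq_mul_le (m + 1)
    have h1 : (m + 1).centralBinom = 2 * (2 * m + 1).choose m := by
      rw [Nat.centralBinom_eq_two_mul_choose, show 2 * (m + 1) = 2 * m + 1 + 1 by ring,
        Nat.choose_succ_succ, Nat.choose_symm_half]
      ring
    have h2 : (2 * m + 1).choose s ≤ (2 * m + 1).choose m := by
      have := Nat.choose_le_middle s (2 * m + 1)
      rwa [show (2 * m + 1) / 2 = m by omega] at this
    have h3 : 4 * ((2 * m + 1).choose s ^ 2 * (2 * m + 1 + 1)) ≤ 4 * 4 ^ (2 * m + 1) := by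
      calc 4 * ((2 * m + 1).choose s ^ 2 * (2 * m + 1 + 1))
          ≤ 4 * ((2 * m + 1).choose m ^ 2 * (2 * (m + 1) + 1)) := by
            gcongr; omega
        _ = (m + 1).centralBinom ^ 2 * (2 * (m + 1) + 1) := by rw [h1]; ring
        _ ≤ 16 ^ (m + 1) := h
        _ = 4 * 4 ^ (2 * m + 1) := by
          rw [← pow_succ', show 2 * m + 1 + 1 = 2 * (m + 1) by ring, pow_mul]; norm_num
    omega

/-- The uniform measure on `{0, a} ⊆ ℤ`, the step of a lazy monotone walk whose point masses are
explicit binomial probabilities. -/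
def coin (a : ℕ) : Measure ℤ :=
  (2⁻¹ : ℝ≥0∞) • Measure.dirac 0 + (2⁻¹ : ℝ≥0∞) • Measure.dirac (a : ℤ)

instance isProbabilityMeasure_coin (a : ℕ) : IsProbabilityMeasure (coin a) :=
  ⟨by simp [coin, ENNReal.inv_two_add_inv_two]⟩

lemma lintegral_coin (a : ℕ) (f : ℤ → ℝ≥0∞) :
    ∫⁻ x, f x ∂coin a = 2⁻¹ * f 0 + 2⁻¹ * f a := by
  rw [coin, lintegral_add_measure, lintegral_smul_measure, lintegral_smul_measure, lintegral_dirac,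
    lintegral_dirac, smul_eq_mul, smul_eq_mul]

lemma convPow_coin_succ_singleton (a k : ℕ) (t : ℤ) :
    convPow (coin a) (k + 1) {t} =
      2⁻¹ * convPow (coin a) k {t} + 2⁻¹ * convPow (coin a) k {t - a} := by
  rw [convPow, conv_singleton, lintegral_coin, sub_zero]

lemma convPow_coin_singleton_eq_zero {a : ℕ} (k : ℕ) {t : ℤ} (ht : ∀ s : ℕ, t ≠ a * s) :
    convPow (coin a) k {t} = 0 := by
  induction k generalizing t with
  | zero =>
    have : (0 : ℤ) ≠ t := fun h => ht 0 (by simp [← h])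
    simp [convPow, this]
  | succ k ih =>
    rw [convPow_coin_succ_singleton, ih ht,
      ih fun s hs => ht (s + 1) (by push_cast; linarith), mul_zero, add_zero]

lemma convPow_coin_singleton_mul {a : ℕ} (ha : 0 < a) (k s : ℕ) :
    convPow (coin a) k {(a * s : ℤ)} = k.choose s * (2⁻¹ : ℝ≥0∞) ^ k := by
  induction k generalizing s with
  | zero =>
    cases s with
    | zero => simp [convPow]
    | succ s =>
      have : (0 : ℤ) ≠ a * ((s + 1 : ℕ) : ℤ) := by positivity
      simp only [convPow, measurableSet_singleton, Measure.dirac_apply', Set.mem_singleton_iff,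
        this, not_false_eq_true, Set.indicator_of_notMem]
      simp
  | succ k ih =>
    rw [convPow_coin_succ_singleton, ih]
    cases s with
    | zero =>
      rw [convPow_coin_singleton_eq_zero (t := (a : ℤ) * (0 : ℕ) - a) k, mul_zero, add_zero]
      · simp [pow_succ']
      · intro s
        have : (0 : ℤ) < a * (s + 1) := by positivity
        push_cast
        linarith
    | succ s =>
      rw [show (a : ℤ) * ((s + 1 : ℕ) : ℤ) - a = a * s by push_cast; ring, ih,
        Nat.choose_succ_succ, pow_succ]
      push_cast
      ring

lemma choose_mul_inv_two_pow_le (k s : ℕ) :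
    (k.choose s : ℝ) * 2⁻¹ ^ k ≤ ((k : ℝ) + 1) ^ (-(1 / 2 : ℝ)) := by
  have h : (k.choose s : ℝ) ^ 2 * (k + 1) ≤ 4 ^ k := by exact_mod_cast choose_sq_mul_le k s
  rw [Real.rpow_neg (by positivity), ← Real.sqrt_eq_rpow]
  refine (sq_le_sq₀ (by positivity) (by positivity)).1 ?_
  rw [inv_pow √_, Real.sq_sqrt (by positivity), mul_pow, ← pow_mul, mul_comm k 2, pow_mul,
    inv_eq_one_div ((k : ℝ) + 1), le_div_iff₀ (by positivity)]
  calc (k.choose s : ℝ) ^ 2 * (2⁻¹ ^ 2) ^ k * (k + 1)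
      = ((k.choose s : ℝ) ^ 2 * (k + 1)) * (2⁻¹ ^ 2) ^ k := by ring
    _ ≤ 4 ^ k * (2⁻¹ ^ 2) ^ k := by gcongr
    _ = 1 := by rw [← mul_pow]; norm_num

lemma convPow_coin_singleton_le {a : ℕ} (ha : 0 < a) (k : ℕ) (t : ℤ) :
    convPow (coin a) k {t} ≤ ENNReal.ofReal (((k : ℝ) + 1) ^ (-(1 / 2 : ℝ))) := by
  by_cases h : ∃ s : ℕ, t = a * s
  · obtain ⟨s, rfl⟩ := h
    have hcast : (k.choose s : ℝ≥0∞) * (2⁻¹ : ℝ≥0∞) ^ k =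
        ENNReal.ofReal ((k.choose s : ℝ) * (2⁻¹ : ℝ) ^ k) := by
      rw [ENNReal.ofReal_mul (by positivity), ENNReal.ofReal_natCast,
        ENNReal.ofReal_pow (by positivity), ENNReal.ofReal_inv_of_pos (by norm_num)]
      simp
    rw [convPow_coin_singleton_mul ha, hcast]
    exact ENNReal.ofReal_le_ofReal (choose_mul_inv_two_pow_le k s)
  · rw [convPow_coin_singleton_eq_zero k fun s hs => h ⟨s, hs⟩]
    exact zero_le

end Coin

section MaxAtom

variable {M : Type*} [MeasurableSpace M]

/-- The largest mass that `ν` gives to a point. -/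
def maxAtom (ν : Measure M) : ℝ≥0∞ := ⨆ z, ν {z}

lemma le_maxAtom (ν : Measure M) (z : M) : ν {z} ≤ maxAtom ν :=
  le_iSup (fun z => ν {z}) z

lemma maxAtom_le_one (ν : Measure M) [IsProbabilityMeasure ν] : maxAtom ν ≤ 1 :=
  iSup_le fun _ => prob_le_one

lemma lintegral_singleton_le_min_maxAtom [Countable M] [MeasurableSingletonClass M]
    (ρ ν : Measure M) [IsProbabilityMeasure ρ] [IsProbabilityMeasure ν] :
    ∫⁻ z, ν {z} ∂ρ ≤ min (maxAtom ρ) (maxAtom ν) := by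
  refine le_min ?_ ?_
  · rw [lintegral_countable']
    calc ∑' z, ν {z} * ρ {z} ≤ ∑' z, ν {z} * maxAtom ρ := by
          gcongr with z; exact le_maxAtom ρ z
      _ = maxAtom ρ := by
          have h := Measure.tsum_indicator_apply_singleton ν Set.univ MeasurableSet.univ
          simp only [Set.indicator_univ, measure_univ] at h
          rw [ENNReal.tsum_mul_right, h, one_mul]
  · exact (lintegral_mono fun z => le_maxAtom ν z).trans (by simp)

lemma le_one_of_smul_le {κ π : Measure M} [IsProbabilityMeasure κ] [IsProbabilityMeasure π]
    {c : ℝ≥0∞} (hle : c • π ≤ κ) : c ≤ 1 := by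
  simpa using hle Set.univ

variable [AddCommGroup M] [MeasurableAdd₂ M] [MeasurableSingletonClass M]

lemma maxAtom_conv_le (ρ ν : Measure M) [SFinite ν] :
    maxAtom (ρ ∗ ν) ≤ ρ Set.univ * maxAtom ν := by
  refine iSup_le fun z => ?_
  rw [conv_singleton]
  refine (lintegral_mono fun x => le_maxAtom ν (z - x)).trans ?_
  rw [lintegral_const, mul_comm]

lemma antitone_maxAtom_convPow (η : Measure M) [IsProbabilityMeasure η] :
    Antitone fun m => maxAtom (convPow η m) := by
  refine antitone_nat_of_succ_le fun m => ?_
  rw [convPow]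
  exact (maxAtom_conv_le η _).trans (by rw [measure_univ, one_mul])

lemma maxAtom_conv_le_of_smul_le {κ π : Measure M} [IsProbabilityMeasure κ]
    [IsProbabilityMeasure π] {c : ℝ≥0∞} (hle : c • π ≤ κ) (ν : Measure M) [SFinite ν] :
    maxAtom (κ ∗ ν) ≤ (1 - c) * maxAtom ν + c * maxAtom (π ∗ ν) := by
  have hc : c ≠ ∞ := ne_top_of_le_ne_top ENNReal.one_ne_top (le_one_of_smul_le hle)
  have : IsFiniteMeasure (c • π) := ⟨by simp [hc.lt_top]⟩
  have hsplit : κ - c • π + c • π = κ := Measure.sub_add_cancel_of_le hle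
  have hmass : (κ - c • π) Set.univ = 1 - c := by
    rw [Measure.sub_apply MeasurableSet.univ hle]
    simp
  have : IsFiniteMeasure (κ - c • π) := ⟨by rw [hmass]; exact tsub_le_self.trans_lt (by simp)⟩
  conv_lhs => rw [← hsplit, Measure.add_conv, Measure.conv_smul_left]
  refine iSup_le fun z => ?_
  rw [Measure.add_apply, Measure.smul_apply, smul_eq_mul, ← hmass]
  exact add_le_add ((le_maxAtom _ z).trans (maxAtom_conv_le _ _))
    (mul_le_mul_right (le_maxAtom _ z) c)

/-- The `m` independent steps with law `κ` each contain, with probability `c`, a step with law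
`π`; the term with `2 ^ L` bounds the probability that fewer than `L` of them do. -/
lemma maxAtom_convPow_conv_le {κ π : Measure M} [IsProbabilityMeasure κ] [IsProbabilityMeasure π]
    {c : ℝ≥0∞} (hle : c • π ≤ κ) {B : ℝ≥0∞} {L : ℕ}
    (hB : ∀ k, L ≤ k → maxAtom (convPow π k) ≤ B) (m k : ℕ) :
    maxAtom (convPow κ m ∗ convPow π k) ≤ B + 2 ^ L * (c / 2 + (1 - c)) ^ m * 2⁻¹ ^ k := by
  induction m generalizing k with
  | zero =>
    rw [convPow, Measure.dirac_zero_conv, pow_zero, mul_one]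
    rcases le_or_gt L k with hk | hk
    · exact (hB k hk).trans le_self_add
    · refine le_add_left ((maxAtom_le_one _).trans ?_)
      obtain ⟨j, rfl⟩ := Nat.exists_eq_add_of_lt hk
      rw [show k + j + 1 = (j + 1) + k by ring, pow_add, mul_assoc, ← mul_pow,
        ENNReal.mul_inv_cancel (by simp) (by simp), one_pow, mul_one]
      exact one_le_pow₀ (by norm_num)
  | succ m ih =>
    set X : ℝ≥0∞ := 2 ^ L * (c / 2 + (1 - c)) ^ m * 2⁻¹ ^ k with hX
    have hcomm : π ∗ (convPow κ m ∗ convPow π k) = convPow κ m ∗ convPow π (k + 1) := by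
      rw [convPow, ← Measure.conv_assoc, ← Measure.conv_assoc, Measure.conv_comm π]
    calc maxAtom (convPow κ (m + 1) ∗ convPow π k)
        ≤ (1 - c) * maxAtom (convPow κ m ∗ convPow π k) +
          c * maxAtom (convPow κ m ∗ convPow π (k + 1)) := by
          rw [convPow, Measure.conv_assoc, ← hcomm]
          exact maxAtom_conv_le_of_smul_le hle _
      _ ≤ (1 - c) * (B + X) + c * (B + X * 2⁻¹) := by
          gcongr
          · exact ih k
          · exact (ih (k + 1)).trans_eq (by rw [hX, pow_succ]; ring)
      _ = ((1 - c) + c) * B + X * (c / 2 + (1 - c)) := by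
          rw [div_eq_mul_inv]; ring
      _ = B + 2 ^ L * (c / 2 + (1 - c)) ^ (m + 1) * 2⁻¹ ^ k := by
          rw [tsub_add_cancel_of_le (le_one_of_smul_le hle), one_mul, hX, pow_succ]; ring

end MaxAtom

section HeatKernel

section Support

variable {M : Type*} [MeasurableSpace M] [AddCommGroup M] [MeasurableAdd₂ M]
  [MeasurableSingletonClass M] {η : Measure M} [IsProbabilityMeasure η]

lemma convPow_singleton_pos_add {m n : ℕ} {x y : M} (hx : 0 < convPow η m {x})
    (hy : 0 < convPow η n {y}) : 0 < convPow η (m + n) {x + y} := by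
  rw [convPow_add, conv_singleton]
  calc 0 < convPow η n {y} * convPow η m {x} := ENNReal.mul_pos hy.ne' hx.ne'
    _ = ∫⁻ z in {x}, convPow η n {x + y - z} ∂(convPow η m) := by
      rw [lintegral_singleton, add_sub_cancel_left]
    _ ≤ _ := setLIntegral_le_lintegral _ _

lemma convPow_singleton_pos_nsmul {m : ℕ} {x : M} (hx : 0 < convPow η m {x}) (k : ℕ) :
    0 < convPow η (k * m) {k • x} := by
  induction k with
  | zero => simp [convPow]
  | succ k ih =>
    rw [Nat.succ_mul, succ_nsmul]
    exact convPow_singleton_pos_add ih hx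

lemma convPow_singleton_pos_sum {ι : Type*} {n : ι → ℕ} {x : ι → M} (s : Finset ι)
    (h : ∀ i, 0 < convPow η (n i) {x i}) : 0 < convPow η (∑ i ∈ s, n i) {∑ i ∈ s, x i} := by
  classical
  induction s using Finset.induction_on with
  | empty => simp [convPow]
  | insert i s hi ih =>
    rw [Finset.sum_insert hi, Finset.sum_insert hi]
    exact convPow_singleton_pos_add (h i) ih

end Support

variable {d : ℕ}

lemma maxAtom_convPow_pi_coin_le {a : Fin d → ℕ} (ha : ∀ i, 0 < a i) (k : ℕ) :
    maxAtom (convPow (Measure.pi fun i => coin (a i)) k) ≤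
      ENNReal.ofReal (((k : ℝ) + 1) ^ (-(d / 2 : ℝ))) := by
  refine iSup_le fun z => ?_
  rw [convPow_pi, Measure.pi_singleton]
  calc ∏ i, convPow (coin (a i)) k {z i}
      ≤ ∏ _i : Fin d, ENNReal.ofReal (((k : ℝ) + 1) ^ (-(1 / 2 : ℝ))) :=
        Finset.prod_le_prod' fun i _ => convPow_coin_singleton_le (ha i) k (z i)
    _ = ENNReal.ofReal (((k : ℝ) + 1) ^ (-(d / 2 : ℝ))) := by
        rw [Finset.prod_const, Finset.card_univ, Fintype.card_fin,
          ← ENNReal.ofReal_pow (by positivity), ← Real.rpow_natCast,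
          ← Real.rpow_mul (by positivity)]
        congr 2
        ring

variable {η : Measure (Lattice d)} [IsProbabilityMeasure η]

lemma IsIrreducible.exists_convPow_pos (h : IsIrreducible η) (z : Lattice d) :
    ∃ n, 0 < convPow η n {z} := by
  obtain ⟨n, hn⟩ := h 0 z
  refine ⟨n, ?_⟩
  rw [walkLaw, Measure.map_apply (measurable_walkPath 0)
    (measurableSet_eq_fun (measurable_pi_apply n) measurable_const)] at hn
  rw [← sub_zero z, ← stepsLaw_walkPath_eq η 0 z n]
  exact hn

lemma IsIrreducible.exists_convPow_pos_zero_and_single (h : IsIrreducible η) (i : Fin d) :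
    ∃ n a : ℕ, 0 < n ∧ 0 < a ∧ 0 < convPow η n {0} ∧ 0 < convPow η n {Pi.single i (a : ℤ)} := by
  obtain ⟨p, hp⟩ := h.exists_convPow_pos (Pi.single i (1 : ℤ))
  obtain ⟨q, hq⟩ := h.exists_convPow_pos (Pi.single i (-1 : ℤ))
  have hp0 : 0 < p := by
    refine Nat.pos_of_ne_zero ?_
    rintro rfl
    have hne : (0 : Lattice d) ≠ Pi.single i (1 : ℤ) := fun h => by simpa using congrFun h i
    simp [convPow, hne] at hp
  have hreturn : 0 < convPow η (p + q) {0} := by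
    have := convPow_singleton_pos_add hp hq
    rwa [← Pi.single_add, add_neg_cancel, Pi.single_zero] at this
  refine ⟨(p + q) * p, p + q, by positivity, by positivity, ?_, ?_⟩
  · simpa [mul_comm] using convPow_singleton_pos_nsmul hreturn p
  · simpa [← Pi.single_smul] using convPow_singleton_pos_nsmul hp (p + q)

lemma IsIrreducible.exists_convPow_pos_cube (hd : 0 < d) (h : IsIrreducible η) :
    ∃ (n : ℕ) (a : Fin d → ℕ), 0 < n ∧ (∀ i, 0 < a i) ∧
      ∀ ε : Fin d → Bool, 0 < convPow η n {fun i => if ε i then (a i : ℤ) else 0} := by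
  choose n a hn ha hzero hsingle using h.exists_convPow_pos_zero_and_single
  refine ⟨∑ i, n i, a, Finset.sum_pos (fun i _ => hn i) ⟨⟨0, hd⟩, Finset.mem_univ _⟩, ha,
    fun ε => ?_⟩
  rw [← Finset.univ_sum_single fun i => if ε i then (a i : ℤ) else 0]
  refine convPow_singleton_pos_sum _ fun i => ?_
  split_ifs
  · exact hsingle i
  · rw [Pi.single_zero]; exact hzero i

lemma IsIrreducible.exists_smul_pi_coin_le (hd : 0 < d) (h : IsIrreducible η) :
    ∃ (n : ℕ) (a : Fin d → ℕ) (c : ℝ≥0∞), 0 < n ∧ (∀ i, 0 < a i) ∧ 0 < c ∧ c ≠ ∞ ∧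
      c • Measure.pi (fun i => coin (a i)) ≤ convPow η n := by
  obtain ⟨n, a, hn, ha, hpos⟩ := h.exists_convPow_pos_cube hd
  obtain ⟨ε₀, hε₀⟩ := Finite.exists_min
    (fun ε : Fin d → Bool => convPow η n {fun i => if ε i then (a i : ℤ) else 0})
  refine ⟨n, a, _, hn, ha, hpos ε₀, measure_ne_top _ _, ?_⟩
  set c := convPow η n {fun i => if ε₀ i then (a i : ℤ) else 0} 
  refine Measure.le_iff.2 fun s hs => ?_
  rw [← Measure.tsum_indicator_apply_singleton _ s hs,
    ← Measure.tsum_indicator_apply_singleton _ s hs]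
  refine ENNReal.tsum_le_tsum fun x => Set.indicator_le_indicator ?_
  rw [Measure.smul_apply, smul_eq_mul]
  by_cases hx : ∃ ε : Fin d → Bool, (fun i => if ε i then (a i : ℤ) else 0) = x
  · obtain ⟨ε, rfl⟩ := hx
    exact (mul_le_of_le_one_right' prob_le_one).trans (hε₀ ε)
  · obtain ⟨i, hi₀, hia⟩ : ∃ i, x i ≠ 0 ∧ x i ≠ a i := by
      by_contra hcon
      push Not at hcon
      refine hx ⟨fun i => decide (x i ≠ 0), funext fun i => ?_⟩
      by_cases hi : x i = 0
      · simp [hi]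
      · rw [if_pos (by simpa using hi), hcon i hi]
    rw [Measure.pi_singleton, Finset.prod_eq_zero (Finset.mem_univ i), mul_zero]
    · exact zero_le
    · simp [coin, hi₀.symm, hia.symm]

lemma exists_two_inv_pow_le_rpow (d : ℕ) : ∃ C : ℝ, 0 < C ∧ ∀ L : ℕ,
    (2⁻¹ : ℝ) ^ L ≤ C * ((L : ℝ) + 1) ^ (-(d / 2 : ℝ)) := by
  have h := tendsto_pow_const_mul_const_pow_of_abs_lt_one d (r := (2⁻¹ : ℝ))
    (by rw [abs_of_pos (by norm_num)]; norm_num)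
  obtain ⟨C, hC⟩ := h.bddAbove_range
  have hC' : ∀ n : ℕ, (n : ℝ) ^ d * 2⁻¹ ^ n ≤ C := fun n => hC ⟨n, rfl⟩
  refine ⟨2 * (|C| + 1), by positivity, fun L => ?_⟩
  have h1 := hC' (L + 1)
  have hL : (1 : ℝ) ≤ (L : ℝ) + 1 := by simp
  have h2 : ((L : ℝ) + 1) ^ (d / 2 : ℝ) ≤ ((L : ℝ) + 1) ^ d := by
    rw [← Real.rpow_natCast]
    exact Real.rpow_le_rpow_of_exponent_le hL (by have : (0 : ℝ) ≤ d := by positivity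
                                                  linarith)
  rw [Real.rpow_neg (by positivity), ← div_eq_mul_inv, le_div_iff₀ (by positivity)]
  calc (2⁻¹ : ℝ) ^ L * ((L : ℝ) + 1) ^ (d / 2 : ℝ) ≤ (2⁻¹ : ℝ) ^ L * ((L : ℝ) + 1) ^ d := by gcongr
    _ = 2 * (((L + 1 : ℕ) : ℝ) ^ d * 2⁻¹ ^ (L + 1)) := by push_cast; ring
    _ ≤ 2 * (|C| + 1) := by
      have := le_abs_self C
      linarith

lemma exists_two_mul_pow_le {q : ℝ≥0∞} (hq : q < 1) : ∃ j, 0 < j ∧ 2 * q ^ j ≤ 2⁻¹ := by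
  obtain ⟨j, hj, hj0⟩ := (((ENNReal.tendsto_pow_atTop_nhds_zero_of_lt_one hq).eventually_lt_const
    (show 0 < (4⁻¹ : ℝ≥0∞) by simp)).and (eventually_gt_atTop 0)).exists
  refine ⟨j, hj0, ?_⟩
  calc 2 * q ^ j ≤ 2 * 4⁻¹ := by gcongr
    _ = 2⁻¹ := by
      rw [show (4 : ℝ≥0∞) = 2 * 2 by norm_num, ENNReal.mul_inv (by simp) (by simp), ← mul_assoc,
        ENNReal.mul_inv_cancel (by simp) (by simp), one_mul]

/-- Along multiples of a suitable `N`, the walk makes enough steps with a coin law for the explicit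
binomial bound to apply. -/
lemma IsIrreducible.exists_maxAtom_convPow_mul_le (hd : 0 < d) (h : IsIrreducible η) :
    ∃ N : ℕ, 0 < N ∧ ∃ C : ℝ, 0 < C ∧ ∀ L : ℕ,
      maxAtom (convPow η (N * L)) ≤ ENNReal.ofReal (C * ((L : ℝ) + 1) ^ (-(d / 2 : ℝ))) := by
  obtain ⟨n, a, c, hn, ha, hc0, hctop, hle⟩ := h.exists_smul_pi_coin_le hd
  obtain ⟨C, hC, hexp⟩ := exists_two_inv_pow_le_rpow d
  set q : ℝ≥0∞ := c / 2 + (1 - c)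
  have hq : q < 1 := by
    calc q < c + (1 - c) := ENNReal.add_lt_add_right
          (ne_top_of_le_ne_top (by simp) tsub_le_self) (ENNReal.half_lt_self hc0.ne' hctop)
      _ = 1 := add_tsub_cancel_of_le (le_one_of_smul_le hle)
  obtain ⟨j, hj, hqj⟩ := exists_two_mul_pow_le hq
  refine ⟨n * j, Nat.mul_pos hn hj, 1 + C, by positivity, fun L => ?_⟩
  have hcoin : ∀ k, L ≤ k → maxAtom (convPow (Measure.pi fun i => coin (a i)) k) ≤
      ENNReal.ofReal (((L : ℝ) + 1) ^ (-(d / 2 : ℝ))) := fun k hk =>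
    (maxAtom_convPow_pi_coin_le ha k).trans <| ENNReal.ofReal_le_ofReal <|
      Real.rpow_le_rpow_of_nonpos (by positivity) (by gcongr) (neg_nonpos.2 (by positivity))
  have hmix := maxAtom_convPow_conv_le hle hcoin (j * L) 0
  rw [convPow, Measure.conv_dirac_zero, pow_zero, mul_one, pow_mul, ← mul_pow, convPow_convPow,
    ← mul_assoc] at hmix
  calc maxAtom (convPow η (n * j * L))
      ≤ ENNReal.ofReal (((L : ℝ) + 1) ^ (-(d / 2 : ℝ))) + (2 * q ^ j) ^ L := hmix
    _ ≤ ENNReal.ofReal (((L : ℝ) + 1) ^ (-(d / 2 : ℝ))) + ENNReal.ofReal (2⁻¹ ^ L) := by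
        rw [ENNReal.ofReal_pow (by positivity), ENNReal.ofReal_inv_of_pos (by norm_num),
          ENNReal.ofReal_ofNat]
        gcongr
    _ = ENNReal.ofReal (((L : ℝ) + 1) ^ (-(d / 2 : ℝ)) + 2⁻¹ ^ L) :=
        (ENNReal.ofReal_add (by positivity) (by positivity)).symm
    _ ≤ ENNReal.ofReal ((1 + C) * ((L : ℝ) + 1) ^ (-(d / 2 : ℝ))) := by
        refine ENNReal.ofReal_le_ofReal ?_
        rw [add_mul, one_mul]
        exact add_le_add le_rfl (hexp L)

lemma div_add_one_rpow_neg_le {N : ℕ} (hN : 0 < N) (m : ℕ) {a : ℝ} (ha : 0 ≤ a) :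
    (((m / N : ℕ) : ℝ) + 1) ^ (-a) ≤ (N : ℝ) ^ a * ((m : ℝ) + 1) ^ (-a) := by
  have hN' : (0 : ℝ) < N := by exact_mod_cast hN
  have hm : (m : ℝ) + 1 ≤ N * (((m / N : ℕ) : ℝ) + 1) := by
    exact_mod_cast Nat.lt_mul_div_succ m hN
  calc (((m / N : ℕ) : ℝ) + 1) ^ (-a) = (N : ℝ) ^ a * (N * (((m / N : ℕ) : ℝ) + 1)) ^ (-a) := by
        rw [Real.mul_rpow hN'.le (by positivity), ← mul_assoc, ← Real.rpow_add hN', add_neg_cancel,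
          Real.rpow_zero, one_mul]
    _ ≤ (N : ℝ) ^ a * ((m : ℝ) + 1) ^ (-a) := by
        gcongr ?_ * ?_
        exact Real.rpow_le_rpow_of_nonpos (by positivity) hm (neg_nonpos.2 ha)

theorem IsIrreducible.exists_maxAtom_convPow_le (hd : 0 < d) (h : IsIrreducible η) :
    ∃ C : ℝ, 0 < C ∧ ∀ m : ℕ,
      maxAtom (convPow η m) ≤ ENNReal.ofReal (C * ((m : ℝ) + 1) ^ (-(d / 2 : ℝ))) := by
  obtain ⟨N, hN, C, hC, hle⟩ := h.exists_maxAtom_convPow_mul_le hd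
  have : (0 : ℝ) < N := by exact_mod_cast hN
  refine ⟨C * (N : ℝ) ^ (d / 2 : ℝ), by positivity, fun m => ?_⟩
  refine (antitone_maxAtom_convPow η (Nat.mul_div_le m N)).trans
    ((hle (m / N)).trans (ENNReal.ofReal_le_ofReal ?_))
  rw [mul_assoc]
  exact mul_le_mul_of_nonneg_left (div_add_one_rpow_neg_le hN m (by positivity)) hC.le

lemma summable_add_one_rpow_neg {a : ℝ} (ha : 1 < a) :
    Summable fun b : ℕ => ((b : ℝ) + 1) ^ (-a) := by
  simpa using (summable_nat_add_iff 1).2 (Real.summable_nat_rpow.2 (neg_lt_neg ha))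

theorem IsIrreducible.isTransient (hd : 3 ≤ d) (hη : IsIrreducible η) : IsTransient η := by
  intro z
  obtain ⟨C, hC, hle⟩ := hη.exists_maxAtom_convPow_le (by omega)
  have hd' : (3 : ℝ) ≤ d := by exact_mod_cast hd
  have hsummable : Summable fun b : ℕ => C * ((b : ℝ) + 1) ^ (-(d / 2 : ℝ)) :=
    (summable_add_one_rpow_neg (by linarith)).mul_left _
  refine ne_top_of_le_ne_top ?_
    (ENNReal.tsum_le_tsum fun m => (le_maxAtom (convPow η m) z).trans (hle m))
  rw [← ENNReal.ofReal_tsum_of_nonneg (fun b => by positivity) hsummable]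
  exact ENNReal.ofReal_ne_top

lemma lintegral_convPow_singleton_le {M : Type*} [MeasurableSpace M] [AddCommGroup M]
    [MeasurableAdd₂ M] [MeasurableSingletonClass M] [Countable M] {θ η : Measure M}
    [IsProbabilityMeasure θ] [IsProbabilityMeasure η] {a C : ℝ} (ha : 0 ≤ a) (hC : 0 ≤ C)
    (hθ : ∀ m : ℕ, maxAtom (convPow θ m) ≤ ENNReal.ofReal (C * ((m : ℝ) + 1) ^ (-a)))
    (hη : ∀ m : ℕ, maxAtom (convPow η m) ≤ ENNReal.ofReal (C * ((m : ℝ) + 1) ^ (-a)))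
    (D m : ℕ) : ∫⁻ z, convPow η m {z} ∂(convPow θ D) ≤
      ENNReal.ofReal (C * 2 ^ a) * ENNReal.ofReal ((((D + 1 : ℕ) : ℝ) + m) ^ (-a)) := by
  have hhalf : ∀ n : ℕ, D + 1 + m ≤ 2 * (n + 1) → ENNReal.ofReal (C * ((n : ℝ) + 1) ^ (-a)) ≤
      ENNReal.ofReal (C * 2 ^ a) * ENNReal.ofReal ((((D + 1 : ℕ) : ℝ) + m) ^ (-a)) := by
    intro n hn
    rw [← ENNReal.ofReal_mul (by positivity), mul_assoc]
    refine ENNReal.ofReal_le_ofReal (mul_le_mul_of_nonneg_left ?_ hC)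
    have hn' : (((D + 1 : ℕ) : ℝ) + m) / 2 ≤ (n : ℝ) + 1 := by
      rw [div_le_iff₀' (by norm_num)]
      exact_mod_cast hn
    refine (Real.rpow_le_rpow_of_nonpos (by positivity) hn' (neg_nonpos.2 ha)).trans_eq ?_
    rw [Real.div_rpow (by positivity) (by positivity), Real.rpow_neg (by norm_num : (0 : ℝ) ≤ 2),
      div_inv_eq_mul, mul_comm]
  refine (lintegral_singleton_le_min_maxAtom _ _).trans ?_
  rcases le_total m D with hmD | hmD
  · exact (min_le_left _ _).trans ((hθ D).trans (hhalf D (by omega)))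
  · exact (min_le_right _ _).trans ((hη m).trans (hhalf m (by omega)))

lemma tsum_shift_rpow_le {a : ℝ} (ha : 0 ≤ a) (x : ℕ) [NeZero x] :
    ∑' m : ℕ, ENNReal.ofReal (((x : ℝ) + m) ^ (-a)) ≤
      ENNReal.ofReal ((x : ℝ) ^ (1 - a)) * ∑' b : ℕ, ENNReal.ofReal (((b : ℝ) + 1) ^ (-a)) := by
  have hx : (0 : ℝ) < x := by exact_mod_cast Nat.pos_of_ne_zero (NeZero.ne x)
  rw [← (Nat.divModEquiv x).symm.tsum_eq, ENNReal.tsum_prod', ← ENNReal.tsum_mul_left]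
  refine ENNReal.tsum_le_tsum fun b => ?_
  rw [tsum_fintype, ← ENNReal.ofReal_mul (by positivity)]
  calc ∑ i : Fin x, ENNReal.ofReal (((x : ℝ) + ((Nat.divModEquiv x).symm (b, i) : ℕ)) ^ (-a))
      ≤ ∑ _i : Fin x, ENNReal.ofReal (((x : ℝ) * (b + 1)) ^ (-a)) := by
        refine Finset.sum_le_sum fun i _ => ENNReal.ofReal_le_ofReal ?_
        refine Real.rpow_le_rpow_of_nonpos (by positivity) ?_ (by linarith)
        simp only [Nat.divModEquiv_symm_apply]
        push_cast
        have : (0 : ℝ) ≤ ((i : ℕ) : ℝ) := by positivity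
        linarith
    _ = ENNReal.ofReal ((x : ℝ) ^ (1 - a) * ((b : ℝ) + 1) ^ (-a)) := by
        rw [Finset.sum_const, Finset.card_univ, Fintype.card_fin, nsmul_eq_mul,
          ← ENNReal.ofReal_natCast, ← ENNReal.ofReal_mul (by positivity),
          Real.mul_rpow (by positivity) (by positivity), sub_eq_add_neg, Real.rpow_add hx,
          Real.rpow_one, mul_assoc]

theorem exists_lintegral_green_le {θ η : Measure (Lattice d)} [IsProbabilityMeasure θ]
    [IsProbabilityMeasure η] (hd : 3 ≤ d) (hθ : IsIrreducible θ) (hη : IsIrreducible η) :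
    ∃ C : ℝ, 0 < C ∧ ∀ D : ℕ, ∫⁻ z, green η z ∂(convPow θ D) ≤
      ENNReal.ofReal (C * ((D : ℝ) + 1) ^ (-(((d : ℝ) - 2) / 2))) := by
  obtain ⟨C₁, hC₁, hθC⟩ := hθ.exists_maxAtom_convPow_le (by omega)
  obtain ⟨C₂, -, hηC⟩ := hη.exists_maxAtom_convPow_le (by omega)
  have hd' : (3 : ℝ) ≤ d := by exact_mod_cast hd
  set a : ℝ := d / 2 with ha
  set C := max C₁ C₂
  have hC : 0 < C := lt_max_of_lt_left hC₁
  have hsummable := summable_add_one_rpow_neg (a := a) (by linarith)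
  set Z := ∑' b : ℕ, ((b : ℝ) + 1) ^ (-a)
  have hZ : 0 < Z := hsummable.tsum_pos (fun b => by positivity) 0 (by positivity)
  have hterm := lintegral_convPow_singleton_le (θ := θ) (η := η) (a := a) (by positivity) hC.le
    (fun m => (hθC m).trans (ENNReal.ofReal_le_ofReal (by gcongr; exact le_max_left _ _)))
    (fun m => (hηC m).trans (ENNReal.ofReal_le_ofReal (by gcongr; exact le_max_right _ _)))
  refine ⟨C * 2 ^ a * Z, by positivity, fun D => ?_⟩
  calc ∫⁻ z, green η z ∂(convPow θ D)
      = ∑' m, ∫⁻ z, convPow η m {z} ∂(convPow θ D) :=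
        lintegral_tsum fun m => Measurable.of_discrete.aemeasurable
    _ ≤ ∑' m : ℕ, ENNReal.ofReal (C * 2 ^ a) *
          ENNReal.ofReal ((((D + 1 : ℕ) : ℝ) + m) ^ (-a)) := ENNReal.tsum_le_tsum (hterm D)
    _ ≤ ENNReal.ofReal (C * 2 ^ a) *
          (ENNReal.ofReal (((D + 1 : ℕ) : ℝ) ^ (1 - a)) * ENNReal.ofReal Z) := by
        rw [ENNReal.tsum_mul_left, ENNReal.ofReal_tsum_of_nonneg (fun b => by positivity) hsummable]
        exact mul_le_mul_right (tsum_shift_rpow_le (by positivity) (D + 1)) _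
    _ = ENNReal.ofReal (C * 2 ^ a * Z * ((D : ℝ) + 1) ^ (-(((d : ℝ) - 2) / 2))) := by
        rw [← ENNReal.ofReal_mul (by positivity), ← ENNReal.ofReal_mul (by positivity),
          show (1 - a : ℝ) = -(((d : ℝ) - 2) / 2) by rw [ha]; ring]
        push_cast
        ring_nf

end HeatKernel

section ForestLaw

variable (μ : Measure ℕ)

/-- The probability that a vertex has more than `j` children, that is, that its child number `j`
exists. -/
def tailProb (j : ℕ) : ℝ≥0∞ := μ {n | j < n}

lemma tsum_ite_lt (n : ℕ) : ∑' j : ℕ, (if j < n then (1 : ℝ≥0∞) else 0) = n := by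
  rw [tsum_eq_sum (s := Finset.range n) fun j hj => if_neg (by simpa using hj),
    Finset.sum_congr rfl fun j hj => if_pos (Finset.mem_range.1 hj)]
  simp

lemma tailProb_eq_lintegral (j : ℕ) : tailProb μ j = ∫⁻ n, (if j < n then 1 else 0) ∂μ := by
  rw [tailProb, ← lintegral_indicator_one MeasurableSet.of_discrete]
  refine lintegral_congr fun n => ?_
  simp [Set.indicator_apply]

lemma tsum_tailProb : ∑' j, tailProb μ j = ∫⁻ n, (n : ℝ≥0∞) ∂μ := by
  simp_rw [tailProb_eq_lintegral]
  rw [← lintegral_tsum fun j => Measurable.of_discrete.aemeasurable]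
  simp_rw [tsum_ite_lt]

lemma tsum_tailProb_max :
    ∑' p : ℕ × ℕ, tailProb μ (max p.1 p.2) = ∫⁻ n, (n : ℝ≥0∞) ^ 2 ∂μ := by
  simp_rw [tailProb_eq_lintegral]
  rw [← lintegral_tsum fun j => Measurable.of_discrete.aemeasurable]
  refine lintegral_congr fun n => ?_
  calc ∑' p : ℕ × ℕ, (if max p.1 p.2 < n then (1 : ℝ≥0∞) else 0)
      = ∑' (i : ℕ) (j : ℕ), (if i < n then 1 else 0) * (if j < n then 1 else 0) := by
        rw [ENNReal.tsum_prod']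
        refine tsum_congr fun i => tsum_congr fun j => ?_
        by_cases hi : i < n <;> by_cases hj : j < n <;> simp [hi, hj]
    _ = (n : ℝ≥0∞) ^ 2 := by
        simp only [ENNReal.tsum_mul_left, ENNReal.tsum_mul_right, tsum_ite_lt, sq]

/-- The conditions on the numbers of children under which `(k, x ++ w)` belongs to the forest as
soon as `(k, w)` does: the pair `(v, j)` demands that `v` has more than `j` children. -/
def pathConditions (k : ℕ) (w : List ℕ) : List ℕ → List (Vertex × ℕ)
  | [] => []
  | j :: x => ((k, x ++ w), j) :: pathConditions k w x

/-- The numbers of children `N` fulfil every condition of the list `L`. -/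
def Satisfies (N : Vertex → ℕ) (L : List (Vertex × ℕ)) : Prop := ∀ p ∈ L, p.2 < N p.1

lemma satisfies_append (N : Vertex → ℕ) (L L' : List (Vertex × ℕ)) :
    Satisfies N (L ++ L') ↔ Satisfies N L ∧ Satisfies N L' := by
  simp [Satisfies, or_imp, forall_and]

lemma inForest_append (N : Vertex → ℕ) (k : ℕ) (w x : List ℕ) :
    InForest N (k, x ++ w) ↔ Satisfies N (pathConditions k w x) ∧ InForest N (k, w) := by
  induction x with
  | nil => simp [Satisfies, pathConditions]
  | cons j x ih =>
    simp only [List.cons_append, InForest, ih, Satisfies, pathConditions, List.forall_mem_cons]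
    tauto

lemma inForest_iff_satisfies (N : Vertex → ℕ) (k : ℕ) (x : List ℕ) :
    InForest N (k, x) ↔ Satisfies N (pathConditions k [] x) := by
  simpa [InForest] using inForest_append N k [] x

lemma inForest_cons_max (N : Vertex → ℕ) (k i j : ℕ) (z : List ℕ) :
    InForest N (k, max i j :: z) ↔ InForest N (k, i :: z) ∧ InForest N (k, j :: z) := by
  simp only [InForest, max_lt_iff]
  tauto

lemma of_mem_map_fst_pathConditions {k : ℕ} {w x : List ℕ} {v : Vertex}
    (hv : v ∈ (pathConditions k w x).map Prod.fst) :
    v.1 = k ∧ w <:+ v.2 ∧ v.2.length < x.length + w.length := by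
  induction x with
  | nil => simp [pathConditions] at hv
  | cons j x ih =>
    rw [pathConditions, List.map_cons, List.mem_cons] at hv
    rcases hv with rfl | hv
    · exact ⟨rfl, List.suffix_append x w, by simp⟩
    · obtain ⟨htree, hsuffix, hlength⟩ := ih hv
      exact ⟨htree, hsuffix, by rw [List.length_cons]; omega⟩

lemma nodup_map_fst_pathConditions (k : ℕ) (w x : List ℕ) :
    ((pathConditions k w x).map Prod.fst).Nodup := by
  induction x with
  | nil => simp [pathConditions]
  | cons j x ih =>
    rw [pathConditions, List.map_cons, List.nodup_cons]
    refine ⟨fun h => ?_, ih⟩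
    have hlength := (of_mem_map_fst_pathConditions h).2.2
    rw [List.length_append] at hlength
    exact lt_irrefl _ hlength

/-- The probability that the word `x` belongs to a Galton–Watson tree with offspring law `μ`. -/
def wordProb (x : List ℕ) : ℝ≥0∞ := (x.map (tailProb μ)).prod

lemma prod_pathConditions (k : ℕ) (w x : List ℕ) :
    ((pathConditions k w x).map fun p => tailProb μ p.2).prod = wordProb μ x := by
  induction x with
  | nil => simp [pathConditions, wordProb]
  | cons j x ih =>
    simp only [pathConditions, List.map_cons, List.prod_cons, ih]
    simp [wordProb]

lemma wordProb_append (x y : List ℕ) : wordProb μ (x ++ y) = wordProb μ x * wordProb μ y := by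
  simp [wordProb]

lemma wordProb_cons (j : ℕ) (x : List ℕ) : wordProb μ (j :: x) = tailProb μ j * wordProb μ x := by
  simp [wordProb]

lemma tsum_list (F : List ℕ → ℝ≥0∞) :
    ∑' x, F x = F [] + ∑' j, ∑' x, F (j :: x) := by
  let e : Unit ⊕ (ℕ × List ℕ) ≃ List ℕ :=
    { toFun := fun p => match p with
        | Sum.inl _ => []
        | Sum.inr p => p.1 :: p.2
      invFun := fun l => match l with
        | [] => Sum.inl ()
        | j :: x => Sum.inr (j, x)
      left_inv := fun p => by rcases p with _ | _ <;> rfl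
      right_inv := fun l => by cases l <;> rfl }
  rw [← e.tsum_eq, Summable.tsum_sum ENNReal.summable ENNReal.summable, ENNReal.tsum_prod']
  simp [e]

lemma tsum_wordProb_ite_length (hmean : ∫⁻ n, (n : ℝ≥0∞) ∂μ = 1) (h : ℕ) :
    ∑' x, wordProb μ x * (if x.length = h then 1 else 0) = 1 := by
  induction h with
  | zero =>
    rw [tsum_list]
    simp [wordProb]
  | succ h ih =>
    rw [tsum_list]
    simp only [List.length_nil, List.length_cons, Nat.add_right_cancel_iff, wordProb_cons,
      mul_assoc, ENNReal.tsum_mul_left, ih]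
    simp [tsum_tailProb, hmean]

lemma tsum_wordProb_mul (hmean : ∫⁻ n, (n : ℝ≥0∞) ∂μ = 1) (φ : ℕ → ℝ≥0∞) :
    ∑' x, wordProb μ x * φ x.length = ∑' h, φ h := by
  have hlevel : ∀ x : List ℕ, wordProb μ x * φ x.length =
      ∑' h, φ h * (wordProb μ x * (if x.length = h then 1 else 0)) := fun x => by
    rw [tsum_eq_single x.length fun h hh => by simp [hh.symm]]
    simp [mul_comm]
  simp_rw [hlevel]
  rw [ENNReal.tsum_comm]
  simp_rw [ENNReal.tsum_mul_left, tsum_wordProb_ite_length μ hmean, mul_one]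

lemma tsum_wordProb_mul_wordProb (hmean : ∫⁻ n, (n : ℝ≥0∞) ∂μ = 1)
    (χ φ : ℕ → ℝ≥0∞) :
    ∑' z, ∑' x, (wordProb μ z * wordProb μ x) * (χ z.length * φ x.length) =
      (∑' h, χ h) * ∑' a, φ a := by
  have hfactor : ∀ z x : List ℕ, (wordProb μ z * wordProb μ x) * (χ z.length * φ x.length) =
      (wordProb μ z * χ z.length) * (wordProb μ x * φ x.length) := fun z x => by ring
  simp_rw [hfactor, ENNReal.tsum_mul_left, ENNReal.tsum_mul_right, tsum_wordProb_mul μ hmean]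

variable [IsProbabilityMeasure μ]

/-- The law of the numbers of children of all potential vertices of the forest. -/
abbrev childLaw : Measure (Vertex → ℕ) := Measure.infinitePi fun _ : Vertex => μ

lemma childLaw_satisfies {L : List (Vertex × ℕ)} (hL : (L.map Prod.fst).Nodup) :
    childLaw μ {N | Satisfies N L} = (L.map fun p => tailProb μ p.2).prod := by
  classical
  have hset : {N : Vertex → ℕ | Satisfies N L} =
      Set.pi ((L.map Prod.fst).toFinset : Set Vertex)
        fun v => {n | ∀ p ∈ L, p.1 = v → p.2 < n} := by
    ext N
    simp only [Satisfies, Set.mem_ofPred_eq, Set.mem_pi, List.coe_toFinset, List.mem_map]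
    constructor
    · rintro h v ⟨p, -, rfl⟩ q hq hqp
      rw [← hqp]
      exact h q hq
    · intro h p hp
      exact h p.1 ⟨p, hp, rfl⟩ p hp rfl
  rw [hset, Measure.infinitePi_pi _ (fun _ _ => MeasurableSet.of_discrete),
    List.prod_toFinset _ hL, List.map_map]
  congr 1
  refine List.map_congr_left fun p hp => congrArg μ ?_
  ext n
  refine ⟨fun h => h p hp rfl, fun h q hq hqp => ?_⟩
  rw [List.inj_on_of_nodup_map hL hq hp hqp]
  exact h

lemma childLaw_inForest (k : ℕ) (x : List ℕ) :
    childLaw μ {N | InForest N (k, x)} = wordProb μ x := by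
  simp_rw [inForest_iff_satisfies]
  rw [childLaw_satisfies μ (nodup_map_fst_pathConditions k [] x), prod_pathConditions]

lemma childLaw_inForest_append_le (k : ℕ) (x z : List ℕ) :
    childLaw μ {N | InForest N (k, x ++ z) ∧ InForest N (k, z)} ≤ wordProb μ z * wordProb μ x := by
  refine (measure_mono (t := {N | InForest N (k, x ++ z)}) fun N h => h.1).trans_eq ?_
  rw [childLaw_inForest, wordProb_append, mul_comm]

lemma childLaw_inForest_of_ne {k l : ℕ} (hkl : k ≠ l) (x y : List ℕ) :
    childLaw μ {N | InForest N (k, x) ∧ InForest N (l, y)} = wordProb μ x * wordProb μ y := by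
  simp_rw [inForest_iff_satisfies, ← satisfies_append]
  rw [childLaw_satisfies, List.map_append, List.prod_append, prod_pathConditions,
    prod_pathConditions]
  rw [List.map_append]
  refine (nodup_map_fst_pathConditions _ _ _).append (nodup_map_fst_pathConditions _ _ _) ?_
  intro v hx hy
  exact hkl ((of_mem_map_fst_pathConditions hx).1.symm.trans (of_mem_map_fst_pathConditions hy).1)

lemma eq_of_cons_suffix {i j : ℕ} {v z : List ℕ} (hi : i :: z <:+ v) (hj : j :: z <:+ v) :
    i = j :=
  (List.cons.inj ((List.suffix_of_suffix_length_le hi hj (by simp)).eq_of_length (by simp))).1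

lemma nodup_branch_pathConditions (k : ℕ) {i j : ℕ} (hij : i ≠ j) (m : ℕ) (x y z : List ℕ) :
    ((pathConditions k (i :: z) x ++ (pathConditions k (j :: z) y ++
      pathConditions k [] (m :: z))).map Prod.fst).Nodup := by
  have hstem : ∀ i x, List.Disjoint ((pathConditions k (i :: z) x).map Prod.fst)
      ((pathConditions k [] (m :: z)).map Prod.fst) := fun i x v hx hz => by
    have hlong := (of_mem_map_fst_pathConditions hx).2.1.length_le
    have hshort := (of_mem_map_fst_pathConditions hz).2.2
    simp only [List.length_cons, List.length_nil] at hlong hshort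
    omega
  have hbranches : List.Disjoint ((pathConditions k (i :: z) x).map Prod.fst)
      ((pathConditions k (j :: z) y).map Prod.fst) := fun v hx hy =>
    hij (eq_of_cons_suffix (of_mem_map_fst_pathConditions hx).2.1
      (of_mem_map_fst_pathConditions hy).2.1)
  rw [List.map_append, List.map_append]
  exact (nodup_map_fst_pathConditions _ _ _).append
    ((nodup_map_fst_pathConditions _ _ _).append (nodup_map_fst_pathConditions _ _ _) (hstem _ _))
    (List.disjoint_append_right.2 ⟨hbranches, hstem _ _⟩)

lemma childLaw_inForest_branch (k : ℕ) {i j : ℕ} (hij : i ≠ j) (x y z : List ℕ) :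
    childLaw μ {N | InForest N (k, x ++ i :: z) ∧ InForest N (k, y ++ j :: z)} =
      wordProb μ x * wordProb μ y * wordProb μ z * tailProb μ (max i j) := by
  have hset : {N : Vertex → ℕ | InForest N (k, x ++ i :: z) ∧ InForest N (k, y ++ j :: z)} =
      {N | Satisfies N (pathConditions k (i :: z) x ++ (pathConditions k (j :: z) y ++
        pathConditions k [] (max i j :: z)))} := by
    ext N
    simp only [Set.mem_ofPred_eq, satisfies_append, inForest_append, ← inForest_iff_satisfies,
      inForest_cons_max]
    tauto
  rw [hset, childLaw_satisfies μ (nodup_branch_pathConditions k hij _ x y z)]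
  simp only [List.map_append, List.prod_append, prod_pathConditions, wordProb_cons]
  ring

lemma exists_common_prefix {α : Type*} (a b : List α) :
    (∃ x, a = b ++ x) ∨ (∃ x, b = a ++ x) ∨
      ∃ x y z i j, i ≠ j ∧ a = z ++ i :: x ∧ b = z ++ j :: y := by
  induction a generalizing b with
  | nil => exact Or.inr (Or.inl ⟨b, rfl⟩)
  | cons i a ih =>
    cases b with
    | nil => exact Or.inl ⟨i :: a, rfl⟩
    | cons j b =>
      by_cases hij : i = j
      · subst hij
        rcases ih b with ⟨x, rfl⟩ | ⟨x, rfl⟩ | ⟨x, y, z, i', j', h', rfl, rfl⟩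
        · exact Or.inl ⟨x, rfl⟩
        · exact Or.inr (Or.inl ⟨x, rfl⟩)
        · exact Or.inr (Or.inr ⟨x, y, i :: z, i', j', h', rfl, rfl⟩)
      · exact Or.inr (Or.inr ⟨a, b, [], i, j, hij, rfl, rfl⟩)

lemma exists_common_suffix {α : Type*} (u v : List α) :
    (∃ x, u = x ++ v) ∨ (∃ x, v = x ++ u) ∨
      ∃ x y z i j, i ≠ j ∧ u = x ++ i :: z ∧ v = y ++ j :: z := by
  rcases exists_common_prefix u.reverse v.reverse with
    ⟨x, hx⟩ | ⟨x, hx⟩ | ⟨x, y, z, i, j, hij, hx, hy⟩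
  · exact Or.inl ⟨x.reverse, List.reverse_injective (by simpa using hx)⟩
  · exact Or.inr (Or.inl ⟨x.reverse, List.reverse_injective (by simpa using hx)⟩)
  · exact Or.inr (Or.inr ⟨x.reverse, y.reverse, z.reverse, i, j, hij,
      List.reverse_injective (by simpa using hx), List.reverse_injective (by simpa using hy)⟩)

lemma tsum_tsum_le_common_suffix (F : List ℕ → List ℕ → ℝ≥0∞) :
    ∑' u, ∑' v, F u v ≤ ∑' z, ∑' x, F (x ++ z) z + ∑' z, ∑' x, F z (x ++ z) +
      ∑' z, ∑' x, ∑' y, ∑' p : ℕ × ℕ,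
        if p.1 ≠ p.2 then F (x ++ p.1 :: z) (y ++ p.2 :: z) else 0 := by
  let B := {q : List ℕ × List ℕ × List ℕ × ℕ × ℕ | q.2.2.2.1 ≠ q.2.2.2.2}
  let g : (List ℕ × List ℕ) ⊕ (List ℕ × List ℕ) ⊕ B → List ℕ × List ℕ
    | Sum.inl (z, x) => (x ++ z, z)
    | Sum.inr (Sum.inl (z, x)) => (z, x ++ z)
    | Sum.inr (Sum.inr ⟨(z, x, y, i, j), _⟩) => (x ++ i :: z, y ++ j :: z)
  have hg : Function.Surjective g := by
    rintro ⟨u, v⟩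
    rcases exists_common_suffix u v with ⟨x, rfl⟩ | ⟨x, rfl⟩ | ⟨x, y, z, i, j, hij, rfl, rfl⟩
    · exact ⟨Sum.inl (v, x), rfl⟩
    · exact ⟨Sum.inr (Sum.inl (u, x)), rfl⟩
    · exact ⟨Sum.inr (Sum.inr ⟨(z, x, y, i, j), hij⟩), rfl⟩
  rw [← ENNReal.tsum_prod]
  refine (ENNReal.tsum_le_tsum_comp_of_surjective hg fun q => F q.1 q.2).trans_eq ?_
  rw [Summable.tsum_sum ENNReal.summable ENNReal.summable,
    Summable.tsum_sum ENNReal.summable ENNReal.summable, ← add_assoc]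
  congr 1
  · rw [ENNReal.tsum_prod', ENNReal.tsum_prod']
  · refine (tsum_subtype B fun q => F (q.2.1 ++ q.2.2.2.1 :: q.1)
      (q.2.2.1 ++ q.2.2.2.2 :: q.1)).trans ?_
    rw [ENNReal.tsum_prod']
    simp_rw [ENNReal.tsum_prod' (α := List ℕ)]
    refine tsum_congr fun z => tsum_congr fun x => tsum_congr fun y => tsum_congr fun p => ?_
    simp [Set.indicator_apply, B]

section SecondMoment

variable {μ} (hmean : ∫⁻ n, (n : ℝ≥0∞) ∂μ = 1)
include hmean

lemma tsum_inForest_append_mul_le (k : ℕ) {g : List ℕ → List ℕ → ℝ≥0∞} {χ φ : ℕ → ℝ≥0∞}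
    (hg : ∀ x z, g x z ≤ χ z.length * φ x.length) :
    ∑' z, ∑' x, childLaw μ {N | InForest N (k, x ++ z) ∧ InForest N (k, z)} * g x z ≤
      (∑' h, χ h) * ∑' a, φ a := by
  rw [← tsum_wordProb_mul_wordProb μ hmean]
  gcongr with z x
  · exact childLaw_inForest_append_le μ k x z
  · exact hg x z

lemma tsum_inForest_branch_mul_le (k : ℕ) {g : List ℕ → List ℕ → ℝ≥0∞} {χ φ : ℕ → ℝ≥0∞}
    (hg : ∀ x y z i j, i ≠ j → g (x ++ i :: z) (y ++ j :: z) ≤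
      χ z.length * φ x.length * φ y.length) :
    ∑' z, ∑' x, ∑' y, ∑' p : ℕ × ℕ, (if p.1 ≠ p.2 then
      childLaw μ {N | InForest N (k, x ++ p.1 :: z) ∧ InForest N (k, y ++ p.2 :: z)} *
        g (x ++ p.1 :: z) (y ++ p.2 :: z) else 0) ≤
      (∑' h, χ h) * ((∫⁻ n, (n : ℝ≥0∞) ^ 2 ∂μ) * (∑' a, φ a) ^ 2) := by
  calc _ ≤ ∑' z, ∑' x, ∑' y, ∑' p : ℕ × ℕ, (wordProb μ z * χ z.length) *
        ((wordProb μ x * φ x.length) *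
          ((wordProb μ y * φ y.length) * tailProb μ (max p.1 p.2))) := by
        gcongr with z x y p
        split_ifs with hp
        · rw [childLaw_inForest_branch μ k hp]
          exact (mul_le_mul_right (hg x y z _ _ hp) _).trans_eq (by ring)
        · exact zero_le
    _ = _ := by
        simp_rw [ENNReal.tsum_mul_left, tsum_tailProb_max, ENNReal.tsum_mul_right,
          tsum_wordProb_mul μ hmean]
        ring

/-- Two vertices of one tree are handled through their last common ancestor `z`; when both branch
off at `z`, the two children of `z` account for the second moment of `μ`. -/
lemma tsum_same_tree_le (k : ℕ) {g : List ℕ → List ℕ → ℝ≥0∞} {χ φ : ℕ → ℝ≥0∞}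
    (hdesc : ∀ x z, g (x ++ z) z ≤ χ z.length * φ x.length)
    (hanc : ∀ x z, g z (x ++ z) ≤ χ z.length * φ x.length)
    (hbranch : ∀ x y z i j, i ≠ j → g (x ++ i :: z) (y ++ j :: z) ≤
      χ z.length * φ x.length * φ y.length) :
    ∑' u, ∑' v, childLaw μ {N | InForest N (k, u) ∧ InForest N (k, v)} * g u v ≤
      (∑' h, χ h) * (2 * ∑' a, φ a + (∫⁻ n, (n : ℝ≥0∞) ^ 2 ∂μ) * (∑' a, φ a) ^ 2) := by
  refine (tsum_tsum_le_common_suffix _).trans ?_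
  have hcomm : ∀ x z, {N : Vertex → ℕ | InForest N (k, z) ∧ InForest N (k, x ++ z)} =
      {N | InForest N (k, x ++ z) ∧ InForest N (k, z)} := fun x z => Set.ext fun N => and_comm
  simp_rw [hcomm]
  calc _ ≤ _ := add_le_add (add_le_add (tsum_inForest_append_mul_le hmean k hdesc)
        (tsum_inForest_append_mul_le hmean k hanc)) (tsum_inForest_branch_mul_le hmean k hbranch)
    _ = _ := by ring

lemma tsum_distinct_trees_le {k l : ℕ} (hkl : k ≠ l) {g : List ℕ → List ℕ → ℝ≥0∞}
    {φ : ℕ → ℝ≥0∞} (hg : ∀ x y, g x y ≤ φ x.length * φ y.length) :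
    ∑' u, ∑' v, childLaw μ {N | InForest N (k, u) ∧ InForest N (l, v)} * g u v ≤
      (∑' a, φ a) ^ 2 := by
  rw [sq, ← tsum_wordProb_mul_wordProb μ hmean]
  gcongr with u v
  · rw [childLaw_inForest_of_ne μ hkl]
  · exact hg u v

end SecondMoment

end ForestLaw

section Positions

/-- The vertices, other than the root, on the path from the root to a vertex. -/
def pathVertices : Vertex → Finset Vertex
  | (k, []) => (Finset.range k).image fun i => (i + 1, [])
  | (k, j :: v) => insert (k, j :: v) (pathVertices (k, v))

lemma mem_pathVertices {k : ℕ} {v : List ℕ} {f : Vertex} : f ∈ pathVertices (k, v) ↔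
    (f.1 = k ∧ f.2 ≠ [] ∧ f.2 <:+ v) ∨ (f.2 = [] ∧ 1 ≤ f.1 ∧ f.1 ≤ k) := by
  induction v with
  | nil =>
    obtain ⟨l, w⟩ := f
    simp only [pathVertices, Finset.mem_image, Finset.mem_range, Prod.mk.injEq, List.suffix_nil]
    constructor
    · rintro ⟨i, hi, rfl, rfl⟩
      exact Or.inr ⟨rfl, by omega, by omega⟩
    · rintro (⟨-, h1, h2⟩ | ⟨rfl, h1, h2⟩)
      · exact absurd h2 h1
      · exact ⟨l - 1, by omega, by omega, rfl⟩
  | cons j v ih =>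
    obtain ⟨l, w⟩ := f
    simp only [pathVertices, Finset.mem_insert, ih, List.suffix_cons_iff, Prod.mk.injEq]
    constructor
    · rintro (⟨rfl, rfl⟩ | ⟨h1, h2, h3⟩ | h)
      · exact Or.inl ⟨rfl, by simp, Or.inl rfl⟩
      · exact Or.inl ⟨h1, h2, Or.inr h3⟩
      · exact Or.inr h
    · rintro (⟨h1, h2, h3 | h3⟩ | h)
      · exact Or.inl ⟨h1, h3⟩
      · exact Or.inr (Or.inl ⟨h1, h2, h3⟩)
      · exact Or.inr (Or.inr h)

lemma notMem_pathVertices_parent (k j : ℕ) (v : List ℕ) : (k, j :: v) ∉ pathVertices (k, v) := by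
  rw [mem_pathVertices]
  rintro (⟨-, -, h⟩ | ⟨h, -⟩)
  · simpa using h.length_le
  · simp at h

lemma position_eq_sum {d : ℕ} (X : Vertex → Lattice d) (k : ℕ) (v : List ℕ) :
    position X (k, v) = ∑ f ∈ pathVertices (k, v), X f := by
  induction v with
  | nil =>
    rw [position, pathVertices, Finset.sum_image]
    intro i _ j _ hij
    simpa using hij
  | cons j v ih =>
    rw [position, pathVertices, Finset.sum_insert (notMem_pathVertices_parent k j v), ih, add_comm]

lemma card_pathVertices (k : ℕ) (v : List ℕ) : (pathVertices (k, v)).card = k + v.length := by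
  induction v with
  | nil =>
    rw [pathVertices, Finset.card_image_of_injective]
    · simp
    · intro i j hij
      simpa using hij
  | cons j v ih =>
    rw [pathVertices, Finset.card_insert_of_notMem (notMem_pathVertices_parent k j v), ih,
      List.length_cons, add_assoc]

/-- The graph distance between two vertices. -/
def treeDist (u v : Vertex) : ℕ :=
  (pathVertices u \ pathVertices v).card + (pathVertices v \ pathVertices u).card

lemma treeDist_comm (u v : Vertex) : treeDist u v = treeDist v u := add_comm _ _

lemma length_le_card_sdiff {k l : ℕ} {x w v : List ℕ}
    (h : ∀ t, t <:+ x → t ≠ [] → (k, t ++ w) ∉ pathVertices (l, v)) :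
    x.length ≤ (pathVertices (k, x ++ w) \ pathVertices (l, v)).card := by
  calc x.length = ((Finset.range x.length).image fun i => ((k, x.drop i ++ w) : Vertex)).card := by
        rw [Finset.card_image_of_injOn, Finset.card_range]
        intro i hi j hj hij
        simp only [Finset.coe_range, Set.mem_Iio] at hi hj
        have := congrArg (fun f : Vertex => f.2.length) hij
        simp only [List.length_append, List.length_drop] at this
        omega
    _ ≤ _ := by
        refine Finset.card_le_card fun f hf => ?_
        obtain ⟨i, hi, rfl⟩ := Finset.mem_image.1 hf
        rw [Finset.mem_range] at hi
        have hne : x.drop i ≠ [] := by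
          rw [Ne, List.drop_eq_nil_iff]; omega
        exact Finset.mem_sdiff.2 ⟨mem_pathVertices.2 (Or.inl ⟨rfl, by simp [hne],
          (List.suffix_append_inj_of_length_eq rfl).2 ⟨List.drop_suffix i x, rfl⟩⟩),
          h _ (List.drop_suffix i x) hne⟩

lemma length_le_treeDist (k : ℕ) (x z : List ℕ) : x.length ≤ treeDist (k, x ++ z) (k, z) := by
  refine (length_le_card_sdiff fun t _ ht hmem => ?_).trans (Nat.le_add_right _ _)
  rcases mem_pathVertices.1 hmem with ⟨-, -, h⟩ | ⟨h, -⟩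
  · have hle : (t ++ z).length ≤ z.length := h.length_le
    have hpos := List.length_pos_iff.2 ht
    rw [List.length_append] at hle
    omega
  · simp [ht] at h

lemma length_add_length_le_treeDist_of_ne {k l : ℕ} (hkl : k ≠ l) (x y : List ℕ) :
    x.length + y.length ≤ treeDist (k, x) (l, y) := by
  have hside : ∀ {k l : ℕ}, k ≠ l → ∀ x y : List ℕ,
      x.length ≤ (pathVertices (k, x) \ pathVertices (l, y)).card := by
    intro k l hkl x y
    rw [← List.append_nil x]
    refine le_of_eq_of_le (by simp) (length_le_card_sdiff fun t _ ht hmem => ?_)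
    rcases mem_pathVertices.1 hmem with ⟨h, -⟩ | ⟨h, -⟩
    · exact hkl h
    · simp [ht] at h
  exact Nat.add_le_add (hside hkl x y) (hside hkl.symm y x)

lemma length_add_length_le_treeDist_branch (k : ℕ) {i j : ℕ} (hij : i ≠ j) (x y z : List ℕ) :
    x.length + y.length ≤ treeDist (k, x ++ i :: z) (k, y ++ j :: z) := by
  have hside : ∀ {i j : ℕ}, i ≠ j → ∀ x y : List ℕ, x.length ≤
      (pathVertices (k, x ++ i :: z) \ pathVertices (k, y ++ j :: z)).card := by
    intro i j hij x y
    refine length_le_card_sdiff fun t _ _ hmem => ?_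
    rcases mem_pathVertices.1 hmem with ⟨-, -, h⟩ | ⟨h, -⟩
    · exact hij (eq_of_cons_suffix ((List.suffix_append t _).trans h) (List.suffix_append y _))
    · simp at h
  exact Nat.add_le_add (hside hij x y) (hside hij.symm y x)

lemma map_sum_sub_sum {ι M : Type*} [AddCommGroup M] [MeasurableSpace M] [MeasurableAdd₂ M]
    [MeasurableNeg M] (θ : Measure M) [IsProbabilityMeasure θ] [θ.IsNegInvariant]
    {A B : Finset ι} (hAB : Disjoint A B) :
    (Measure.infinitePi fun _ : ι => θ).map (fun X => ∑ i ∈ A, X i - ∑ i ∈ B, X i) =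
      convPow θ (A.card + B.card) := by
  classical
  let s : ι → M → M := fun i x => if i ∈ B then -x else x
  have hs : ∀ i, Measurable (s i) := fun i => by
    by_cases hi : i ∈ B <;> simp only [s, hi, if_true, if_false] <;> fun_prop
  have hmap : ∀ i, θ.map (s i) = θ := fun i => by
    by_cases hi : i ∈ B
    · simp only [s, hi, if_true]
      exact Measure.IsNegInvariant.neg_eq_self
    · simp only [s, hi, if_false, Measure.map_id']
  have hlaw : ∀ i, (Measure.infinitePi fun _ : ι => θ).map (fun X => s i (X i)) = θ := fun i => by
    have hcomp := Measure.map_map (μ := Measure.infinitePi fun _ : ι => θ) (hs i)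
      (measurable_pi_apply i)
    rw [Measure.infinitePi_map_eval (fun _ : ι => θ) i, hmap i] at hcomp
    exact hcomp.symm
  rw [← Finset.card_union_of_disjoint hAB, ← map_sum_eq_convPow
    (fun i => (hs i).comp (measurable_pi_apply i)) (ProbabilityTheory.iIndepFun_infinitePi hs) hlaw]
  congr 1
  ext X
  have hA : ∑ i ∈ A, s i (X i) = ∑ i ∈ A, X i :=
    Finset.sum_congr rfl fun i hi => if_neg (Finset.disjoint_left.1 hAB hi)
  have hB : ∑ i ∈ B, s i (X i) = -∑ i ∈ B, X i := by
    rw [← Finset.sum_neg_distrib]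
    exact Finset.sum_congr rfl fun i hi => if_pos hi
  simp only [Finset.sum_apply, Finset.sum_union hAB, Function.comp_apply, hA, hB, sub_eq_add_neg]

variable {d : ℕ}

@[fun_prop]
lemma measurable_position (u : Vertex) :
    Measurable fun X : Vertex → Lattice d => position X u := by
  obtain ⟨k, v⟩ := u
  simp_rw [position_eq_sum]
  fun_prop

/-- The law of the displacements along the edges, as an i.i.d. family indexed by all potential
vertices. -/
abbrev displacementLaw (θ : Measure (Lattice d)) : Measure (Vertex → Lattice d) :=
  Measure.infinitePi fun _ : Vertex => θ

variable (θ : Measure (Lattice d)) [IsProbabilityMeasure θ]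

lemma map_position (k : ℕ) (v : List ℕ) :
    (displacementLaw θ).map (fun X => position X (k, v)) = convPow θ (k + v.length) := by
  rw [← card_pathVertices, ← map_sum_eq_convPow (fun f => measurable_pi_apply f) (iIndepFun_eval θ)
    (fun f => Measure.infinitePi_map_eval (fun _ : Vertex => θ) f) (pathVertices (k, v))]
  congr 1
  ext X : 1
  simp only [position_eq_sum, Finset.sum_apply]

variable [θ.IsNegInvariant]

lemma map_position_sub (u v : Vertex) :
    (displacementLaw θ).map (fun X => position X u - position X v) = convPow θ (treeDist u v) := by
  rw [treeDist, ← map_sum_sub_sum θ disjoint_sdiff_sdiff]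
  congr 1
  ext X : 1
  rw [position_eq_sum, position_eq_sum, Finset.sum_sdiff_sub_sum_sdiff]

lemma lintegral_position_sub (u v : Vertex) (G : Lattice d → ℝ≥0∞) :
    ∫⁻ X, G (position X u - position X v) ∂(displacementLaw θ) =
      ∫⁻ z, G z ∂(convPow θ (treeDist u v)) := by
  rw [← map_position_sub θ u v, lintegral_map Measurable.of_discrete (by fun_prop)]

end Positions

section Truncation

/-- The vertex `u` belongs to the truncated forest, formed by the vertices of height at most `H`
in the first `K` trees. -/
def InTrunc (N : Vertex → ℕ) (K H : ℕ) (u : Vertex) : Prop :=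
  u.1 < K ∧ u.2.length ≤ H ∧ InForest N u

lemma measurableSet_satisfies (L : List (Vertex × ℕ)) :
    MeasurableSet {N : Vertex → ℕ | Satisfies N L} := by
  have hinter : {N : Vertex → ℕ | Satisfies N L} =
      ⋂ p ∈ {p | p ∈ L}, {N | N p.1 ∈ Set.Ioi p.2} := by
    ext N; simp [Satisfies]
  rw [hinter]
  exact MeasurableSet.biInter (Set.to_countable _) fun p _ =>
    measurable_pi_apply p.1 MeasurableSet.of_discrete

lemma measurableSet_inForest (u : Vertex) : MeasurableSet {N : Vertex → ℕ | InForest N u} := by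
  obtain ⟨k, x⟩ := u
  simp_rw [inForest_iff_satisfies]
  exact measurableSet_satisfies _

lemma measurableSet_inTrunc (K H : ℕ) (u : Vertex) :
    MeasurableSet {N : Vertex → ℕ | InTrunc N K H u} :=
  (MeasurableSet.const _).inter ((MeasurableSet.const _).inter (measurableSet_inForest u))

open Classical in
/-- The indicator function of the truncated forest. -/
def truncIndicator (K H : ℕ) (u : Vertex) (N : Vertex → ℕ) : ℝ≥0∞ :=
  if InTrunc N K H u then 1 else 0

@[fun_prop]
lemma measurable_truncIndicator (K H : ℕ) (u : Vertex) : Measurable (truncIndicator K H u) :=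
  Measurable.ite (measurableSet_inTrunc K H u) measurable_const measurable_const

lemma lintegral_truncIndicator (P : Measure (Vertex → ℕ)) (K H : ℕ) (u : Vertex) :
    ∫⁻ N, truncIndicator K H u N ∂P = P {N | InTrunc N K H u} := by
  classical
  rw [← lintegral_indicator_one (measurableSet_inTrunc K H u)]
  refine lintegral_congr fun N => ?_
  simp [truncIndicator, Set.indicator_apply]

lemma lintegral_truncIndicator_mul (P : Measure (Vertex → ℕ)) (K H : ℕ) (u v : Vertex) :
    ∫⁻ N, truncIndicator K H u N * truncIndicator K H v N ∂P =
      P {N | InTrunc N K H u ∧ InTrunc N K H v} := by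
  classical
  have hmeas : MeasurableSet {N : Vertex → ℕ | InTrunc N K H u ∧ InTrunc N K H v} :=
    (measurableSet_inTrunc K H u).inter (measurableSet_inTrunc K H v)
  rw [← lintegral_indicator_one hmeas]
  refine lintegral_congr fun N => ?_
  by_cases hu : InTrunc N K H u <;> by_cases hv : InTrunc N K H v <;>
    simp [truncIndicator, hu, hv]

lemma tsum_ite_le (H : ℕ) (φ : ℕ → ℝ≥0∞) :
    ∑' a : ℕ, (if a ≤ H then φ a else 0) = ∑ a ∈ Finset.range (H + 1), φ a := by
  rw [tsum_eq_sum (s := Finset.range (H + 1)) fun a ha => if_neg (by simpa using ha)]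
  exact Finset.sum_congr rfl fun a ha => if_pos (by simpa [Nat.lt_succ_iff] using ha)

lemma tsum_tsum_vertex_le {F : Vertex → Vertex → ℝ≥0∞} {K : ℕ} {a b : ℝ≥0∞}
    (hF : ∀ u v, K ≤ u.1 ∨ K ≤ v.1 → F u v = 0)
    (hsame : ∀ k, ∑' x, ∑' y, F (k, x) (k, y) ≤ b)
    (hdist : ∀ k l, k ≠ l → ∑' x, ∑' y, F (k, x) (l, y) ≤ a) :
    ∑' u, ∑' v, F u v ≤ K * K * a + K * b := by
  have hout : ∀ k l, K ≤ k ∨ K ≤ l → ∑' x, ∑' y, F (k, x) (l, y) = 0 := fun k l hkl => by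
    simp only [hF (k, _) (l, _) hkl, tsum_zero]
  have hpair : ∀ k l, ∑' x, ∑' y, F (k, x) (l, y) ≤ a + if k = l then b else 0 := fun k l => by
    split_ifs with hkl
    · subst hkl
      exact (hsame k).trans le_add_self
    · simpa only [add_zero] using hdist k l hkl
  calc ∑' u, ∑' v, F u v = ∑' k, ∑' l, ∑' x, ∑' y, F (k, x) (l, y) := by
        simp_rw [ENNReal.tsum_prod' (f := fun v => F _ v)]
        rw [ENNReal.tsum_prod']
        exact tsum_congr fun k => ENNReal.tsum_comm
    _ = ∑ k ∈ Finset.range K, ∑ l ∈ Finset.range K, ∑' x, ∑' y, F (k, x) (l, y) := by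
        rw [tsum_eq_sum (s := Finset.range K) fun k hk => ENNReal.tsum_eq_zero.2 fun l =>
          hout k l (Or.inl (by simpa using hk))]
        exact Finset.sum_congr rfl fun k _ => tsum_eq_sum fun l hl =>
          hout k l (Or.inr (by simpa using hl))
    _ ≤ ∑ k ∈ Finset.range K, ∑ l ∈ Finset.range K, (a + if k = l then b else 0) := by
        gcongr
        exact hpair _ _
    _ = ∑ _k ∈ Finset.range K, (K * a + b) := by
        refine Finset.sum_congr rfl fun k hk => ?_
        rw [Finset.sum_add_distrib, Finset.sum_ite_eq, if_pos hk]
        simp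
    _ = K * K * a + K * b := by
        rw [Finset.sum_const, Finset.card_range, nsmul_eq_mul]
        ring

lemma mul_measure_le_half_le {Ω : Type*} [MeasurableSpace Ω] {P : Measure Ω}
    [IsProbabilityMeasure P] {S : Ω → ℝ≥0∞} (hS : Measurable S) {a b : ℝ≥0∞} (ha : a ≠ ∞)
    (hmean : ∫⁻ ω, S ω ∂P = a) (hsq : ∫⁻ ω, S ω ^ 2 ∂P ≤ a ^ 2 + b) :
    a ^ 2 * P {ω | 2 * S ω ≤ a} ≤ 4 * b := by
  have hexpand : ∀ s : ℝ≥0∞, (a - s) ^ 2 + 2 * a * s ≤ s ^ 2 + a ^ 2 := fun s => by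
    rcases le_total s a with h | h
    · obtain ⟨c, rfl⟩ := exists_add_of_le h
      rw [ENNReal.add_sub_cancel_left (ne_top_of_le_ne_top ha h)]
      exact le_of_eq (by ring)
    · obtain ⟨c, rfl⟩ := exists_add_of_le h
      rw [tsub_eq_zero_of_le h]
      exact le_of_le_of_eq le_self_add (show _ + c ^ 2 = _ by ring)
  have hvar : ∫⁻ ω, (a - S ω) ^ 2 ∂P ≤ b := by
    have h := lintegral_mono (μ := P) fun ω => hexpand (S ω)
    rw [lintegral_add_right _ (by fun_prop), lintegral_const_mul _ hS, hmean,
      lintegral_add_right _ measurable_const, lintegral_const, measure_univ, mul_one] at h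
    refine (ENNReal.add_le_add_iff_right (a := 2 * a * a) (by finiteness)).1 (h.trans ?_)
    exact (add_le_add_left hsq _).trans_eq (by ring)
  calc a ^ 2 * P {ω | 2 * S ω ≤ a} ≤ a ^ 2 * P {ω | a ^ 2 ≤ 4 * (a - S ω) ^ 2} := by
        refine mul_le_mul_right (measure_mono fun ω hω => ?_) _
        rw [Set.mem_ofPred_eq] at hω ⊢
        obtain ⟨c, hc⟩ := exists_add_of_le ((le_mul_of_one_le_left' one_le_two).trans hω)
        have hS' : S ω ≠ ∞ := ne_top_of_le_ne_top ha (hc ▸ le_self_add)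
        rw [hc, two_mul, ENNReal.add_le_add_iff_left hS'] at hω
        rw [hc, ENNReal.add_sub_cancel_left hS']
        calc (S ω + c) ^ 2 ≤ (c + c) ^ 2 := by gcongr
          _ = 4 * c ^ 2 := by ring
    _ ≤ ∫⁻ ω, 4 * (a - S ω) ^ 2 ∂P := mul_meas_ge_le_lintegral (by fun_prop) _
    _ ≤ 4 * b := by
        rw [lintegral_const_mul _ (by fun_prop)]
        gcongr

section SecondMoment

variable {μ : Measure ℕ} [IsProbabilityMeasure μ] (hmean : ∫⁻ n, (n : ℝ≥0∞) ∂μ = 1)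

lemma childLaw_inTrunc (K H k : ℕ) (x : List ℕ) :
    childLaw μ {N | InTrunc N K H (k, x)} =
      (if k < K then 1 else 0) * (wordProb μ x * (if x.length ≤ H then 1 else 0)) := by
  by_cases hk : k < K <;> by_cases hx : x.length ≤ H <;>
    simp only [InTrunc, hk, hx, true_and, false_and, if_true, if_false, mul_zero, zero_mul,
      one_mul, mul_one, Set.ofPred_false, measure_empty, childLaw_inForest]

omit [IsProbabilityMeasure μ] in
lemma childLaw_inTrunc_inTrunc_mul_le (K H : ℕ) (u v : Vertex) (c : ℝ≥0∞) :
    childLaw μ {N | InTrunc N K H u ∧ InTrunc N K H v} * c ≤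
      childLaw μ {N | InForest N u ∧ InForest N v} *
        (if u.2.length ≤ H ∧ v.2.length ≤ H then c else 0) := by
  split_ifs with huv
  · refine mul_le_mul_left (measure_mono fun N hN => ?_) _
    exact ⟨hN.1.2.2, hN.2.2.2⟩
  · have hempty : {N : Vertex → ℕ | InTrunc N K H u ∧ InTrunc N K H v} = ∅ :=
      Set.eq_empty_of_forall_notMem fun N hN => huv ⟨hN.1.2.1, hN.2.2.1⟩
    rw [hempty, measure_empty, zero_mul]
    exact zero_le

include hmean

lemma tsum_childLaw_inTrunc (K H : ℕ) :
    ∑' u, childLaw μ {N | InTrunc N K H u} = K * (H + 1) := by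
  simp_rw [ENNReal.tsum_prod', childLaw_inTrunc, ENNReal.tsum_mul_left,
    tsum_wordProb_mul μ hmean (fun h => if h ≤ H then 1 else 0), tsum_ite_le,
    ENNReal.tsum_mul_right, tsum_ite_lt]
  simp

lemma tsum_childLaw_inTrunc_mul_le (K H : ℕ) {c : ℝ≥0∞} {g : Vertex → ℝ≥0∞}
    (hg : ∀ u : Vertex, u.1 < K → u.2.length ≤ H → g u ≤ c) :
    ∑' u, childLaw μ {N | InTrunc N K H u} * g u ≤ K * (H + 1) * c := by
  rw [← tsum_childLaw_inTrunc hmean, ← ENNReal.tsum_mul_right]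
  refine ENNReal.tsum_le_tsum fun u => ?_
  by_cases hu : u.1 < K ∧ u.2.length ≤ H
  · gcongr
    exact hg u hu.1 hu.2
  · have hempty : {N : Vertex → ℕ | InTrunc N K H u} = ∅ :=
      Set.eq_empty_of_forall_notMem fun N hN => hu ⟨hN.1, hN.2.1⟩
    simp [hempty]

lemma tsum_same_tree_inTrunc_le (K H k : ℕ) {g : Vertex → Vertex → ℝ≥0∞} {φ : ℕ → ℝ≥0∞}
    (hdesc : ∀ x z, g (k, x ++ z) (k, z) ≤ φ x.length)
    (hanc : ∀ x z, g (k, z) (k, x ++ z) ≤ φ x.length)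
    (hbranch : ∀ x y z i j, i ≠ j →
      g (k, x ++ i :: z) (k, y ++ j :: z) ≤ φ x.length * φ y.length) :
    ∑' x, ∑' y, childLaw μ {N | InTrunc N K H (k, x) ∧ InTrunc N K H (k, y)} * g (k, x) (k, y) ≤
      (H + 1) * (2 * ∑ a ∈ Finset.range (H + 1), φ a +
        (∫⁻ n, (n : ℝ≥0∞) ^ 2 ∂μ) * (∑ a ∈ Finset.range (H + 1), φ a) ^ 2) := by
  have h := tsum_same_tree_le hmean k
    (g := fun x y => if x.length ≤ H ∧ y.length ≤ H then g (k, x) (k, y) else 0)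
    (χ := fun a => if a ≤ H then 1 else 0) (φ := fun a => if a ≤ H then φ a else 0)
    (fun x z => by split_ifs <;> first | exact zero_le | grind [List.length_append])
    (fun x z => by split_ifs <;> first | exact zero_le | grind [List.length_append])
    (fun x y z i j hij => by split_ifs <;> first | exact zero_le | grind [List.length_append])
  simp only [tsum_ite_le, Finset.sum_const, Finset.card_range, nsmul_one, Nat.cast_add,
    Nat.cast_one] at h
  exact (ENNReal.tsum_le_tsum fun x => ENNReal.tsum_le_tsum fun y =>
    childLaw_inTrunc_inTrunc_mul_le K H (k, x) (k, y) _).trans h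

lemma tsum_distinct_trees_inTrunc_le (K H : ℕ) {k l : ℕ} (hkl : k ≠ l)
    {g : Vertex → Vertex → ℝ≥0∞} {φ : ℕ → ℝ≥0∞}
    (hg : ∀ x y, g (k, x) (l, y) ≤ φ x.length * φ y.length) :
    ∑' x, ∑' y, childLaw μ {N | InTrunc N K H (k, x) ∧ InTrunc N K H (l, y)} * g (k, x) (l, y) ≤
      (∑ a ∈ Finset.range (H + 1), φ a) ^ 2 := by
  have h := tsum_distinct_trees_le hmean hkl
    (g := fun x y => if x.length ≤ H ∧ y.length ≤ H then g (k, x) (l, y) else 0)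
    (φ := fun a => if a ≤ H then φ a else 0) fun x y => by
      by_cases hx : x.length ≤ H <;> by_cases hy : y.length ≤ H <;> simp [hx, hy, hg x y]
  rw [tsum_ite_le] at h
  exact (ENNReal.tsum_le_tsum fun x => ENNReal.tsum_le_tsum fun y =>
    childLaw_inTrunc_inTrunc_mul_le K H (k, x) (l, y) _).trans h

lemma tsum_tsum_inTrunc_mul_le (K H : ℕ) {g : Vertex → Vertex → ℝ≥0∞} {φ : ℕ → ℝ≥0∞}
    (hdesc : ∀ k x z, g (k, x ++ z) (k, z) ≤ φ x.length)
    (hanc : ∀ k x z, g (k, z) (k, x ++ z) ≤ φ x.length)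
    (hbranch : ∀ k x y z i j, i ≠ j →
      g (k, x ++ i :: z) (k, y ++ j :: z) ≤ φ x.length * φ y.length)
    (hdist : ∀ k l x y, k ≠ l → g (k, x) (l, y) ≤ φ x.length * φ y.length) :
    ∑' u, ∑' v, childLaw μ {N | InTrunc N K H u ∧ InTrunc N K H v} * g u v ≤
      K * K * (∑ a ∈ Finset.range (H + 1), φ a) ^ 2 +
        K * ((H + 1) * (2 * ∑ a ∈ Finset.range (H + 1), φ a +
          (∫⁻ n, (n : ℝ≥0∞) ^ 2 ∂μ) * (∑ a ∈ Finset.range (H + 1), φ a) ^ 2)) := by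
  refine tsum_tsum_vertex_le (fun u v huv => ?_)
    (fun k => tsum_same_tree_inTrunc_le hmean K H k (hdesc k) (hanc k) (hbranch k))
    fun k l hkl => tsum_distinct_trees_inTrunc_le hmean K H hkl fun x y => hdist k l x y hkl
  have hempty : {N : Vertex → ℕ | InTrunc N K H u ∧ InTrunc N K H v} = ∅ :=
    Set.eq_empty_of_forall_notMem fun N hN =>
      huv.elim (fun h => h.not_gt hN.1.1) fun h => h.not_gt hN.2.1
  rw [hempty, measure_empty, zero_mul]

/-- The number of vertices of the truncated forest. -/
def truncCount (K H : ℕ) (N : Vertex → ℕ) : ℝ≥0∞ := ∑' u, truncIndicator K H u N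

omit hmean in
lemma measurable_truncCount (K H : ℕ) : Measurable (truncCount K H) :=
  Measurable.tsum fun u => measurable_truncIndicator K H u

lemma lintegral_truncCount (K H : ℕ) :
    ∫⁻ N, truncCount K H N ∂(childLaw μ) = K * (H + 1) := by
  simp_rw [truncCount, lintegral_tsum fun u => (measurable_truncIndicator K H u).aemeasurable,
    lintegral_truncIndicator, tsum_childLaw_inTrunc hmean]

lemma lintegral_truncCount_sq_le (K H : ℕ) :
    ∫⁻ N, truncCount K H N ^ 2 ∂(childLaw μ) ≤
      (K * (H + 1)) ^ 2 + K * (H + 1) ^ 3 * (2 + ∫⁻ n, (n : ℝ≥0∞) ^ 2 ∂μ) := by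
  have hpairs : ∫⁻ N, truncCount K H N ^ 2 ∂(childLaw μ) =
      ∑' u, ∑' v, childLaw μ {N | InTrunc N K H u ∧ InTrunc N K H v} := by
    simp_rw [truncCount, sq, ← ENNReal.tsum_mul_left, ← ENNReal.tsum_mul_right,
      ← lintegral_truncIndicator_mul]
    rw [lintegral_tsum fun u => by fun_prop]
    refine tsum_congr fun u => ?_
    rw [lintegral_tsum fun v => by fun_prop]
    simp_rw [mul_comm]
  have h := tsum_tsum_inTrunc_mul_le hmean K H (g := fun _ _ => 1) (φ := fun _ => 1) (by simp)
    (by simp) (by simp) (by simp)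
  simp only [mul_one, Finset.sum_const, Finset.card_range, nsmul_one, Nat.cast_add,
    Nat.cast_one] at h
  rw [hpairs]
  refine h.trans ?_
  set m := ∫⁻ n, (n : ℝ≥0∞) ^ 2 ∂μ
  calc (K : ℝ≥0∞) * K * (H + 1) ^ 2 + K * ((H + 1) * (2 * (H + 1) + m * (H + 1) ^ 2))
      = (K * (H + 1)) ^ 2 + (K * (H + 1) ^ 2) * (2 * 1 + m * (H + 1)) := by ring
    _ ≤ (K * (H + 1)) ^ 2 + (K * (H + 1) ^ 2) * (2 * (H + 1) + m * (H + 1)) := by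
        gcongr
        exact le_add_self
    _ = _ := by ring

lemma childLaw_truncCount_le {K H n : ℕ} (hK : 0 < K) (hn : 2 * n ≤ K * (H + 1)) :
    childLaw μ {N | truncCount K H N ≤ n} ≤
      4 * (2 + ∫⁻ n, (n : ℝ≥0∞) ^ 2 ∂μ) * (H + 1) / K := by
  have hK' : (K : ℝ≥0∞) ≠ 0 := Nat.cast_ne_zero.2 hK.ne'
  have hcheb := mul_measure_le_half_le (measurable_truncCount K H) (by finiteness)
    (lintegral_truncCount hmean K H) (lintegral_truncCount_sq_le hmean K H)
  rw [ENNReal.le_div_iff_mul_le (Or.inl hK') (Or.inl (by finiteness))]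
  refine (ENNReal.mul_le_mul_iff_right (a := K * (H + 1) ^ 2) (by simp [hK']) (by finiteness)).1 ?_
  calc (K : ℝ≥0∞) * (H + 1) ^ 2 * (childLaw μ {N | truncCount K H N ≤ n} * K)
      = (K * (H + 1)) ^ 2 * childLaw μ {N | truncCount K H N ≤ n} := by ring
    _ ≤ (K * (H + 1)) ^ 2 * childLaw μ {N | 2 * truncCount K H N ≤ K * (H + 1)} := by
        refine mul_le_mul_right (measure_mono fun N hN => ?_) _
        rw [Set.mem_ofPred_eq] at hN ⊢
        calc 2 * truncCount K H N ≤ 2 * n := by gcongr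
          _ ≤ K * (H + 1) := by exact_mod_cast hn
    _ ≤ _ := hcheb.trans_eq (by ring)

end SecondMoment

end Truncation

section Energy

variable {d : ℕ}

/-- The mutual energy, with respect to the Green function, of the positions of the vertices of the
truncated forest. -/
def energy (η : Measure (Lattice d)) (K H : ℕ) (ω : (Vertex → ℕ) × (Vertex → Lattice d)) : ℝ≥0∞ :=
  ∑' u, ∑' v, truncIndicator K H u ω.1 * truncIndicator K H v ω.1 *
    green η (position ω.2 u - position ω.2 v)

@[fun_prop]
lemma measurable_energy_term (η : Measure (Lattice d)) (K H : ℕ) (u v : Vertex) :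
    Measurable fun ω : (Vertex → ℕ) × (Vertex → Lattice d) =>
      truncIndicator K H u ω.1 * truncIndicator K H v ω.1 *
        green η (position ω.2 u - position ω.2 v) := by
  have hgreen : Measurable (green η) := Measurable.of_discrete
  fun_prop

lemma measurable_energy (η : Measure (Lattice d)) (K H : ℕ) : Measurable (energy η K H) :=
  Measurable.tsum fun u => Measurable.tsum fun v => measurable_energy_term η K H u v

lemma lintegral_energy (μ : Measure ℕ) [IsProbabilityMeasure μ] (θ η : Measure (Lattice d))
    [IsProbabilityMeasure θ] [θ.IsNegInvariant] (K H : ℕ) :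
    ∫⁻ ω, energy η K H ω ∂(brwLaw μ θ) =
      ∑' u, ∑' v, childLaw μ {N | InTrunc N K H u ∧ InTrunc N K H v} *
        ∫⁻ z, green η z ∂(convPow θ (treeDist u v)) := by
  unfold energy
  rw [lintegral_tsum fun u => (Measurable.tsum fun v =>
    measurable_energy_term η K H u v).aemeasurable]
  refine tsum_congr fun u => ?_
  rw [lintegral_tsum fun v => (measurable_energy_term η K H u v).aemeasurable]
  refine tsum_congr fun v => ?_
  have hgreen : Measurable (green η) := Measurable.of_discrete
  rw [← lintegral_truncIndicator_mul, ← lintegral_position_sub θ, brwLaw]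
  exact lintegral_prod_mul (f := fun N => truncIndicator K H u N * truncIndicator K H v N)
    (g := fun X => green η (position X u - position X v)) (by fun_prop) (by fun_prop)

lemma sub_one_rpow_add_le {s x : ℝ} (hs0 : 0 ≤ s) (hs1 : s ≤ 1) (hx : 1 ≤ x) :
    (x - 1) ^ s + s * x ^ (s - 1) ≤ x ^ s := by
  have hx0 : 0 < x := by linarith
  have hinv : x⁻¹ ≤ 1 := inv_le_one_of_one_le₀ hx
  have hbernoulli := rpow_one_add_le_one_add_mul_self (s := -x⁻¹) (by linarith) hs0 hs1
  have hsplit : x - 1 = x * (1 + -x⁻¹) := by field_simp; ring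
  rw [hsplit, Real.mul_rpow hx0.le (by linarith), Real.rpow_sub_one hx0.ne']
  calc x ^ s * (1 + -x⁻¹) ^ s + s * (x ^ s / x)
      ≤ x ^ s * (1 + s * -x⁻¹) + s * (x ^ s / x) := by gcongr
    _ = x ^ s := by ring

lemma sum_rpow_neg_le {r : ℝ} (hr0 : 0 ≤ r) (hr1 : r < 1) (M : ℕ) :
    ∑ a ∈ Finset.range M, ((a : ℝ) + 1) ^ (-r) ≤ (M : ℝ) ^ (1 - r) / (1 - r) := by
  have h1r : 0 < 1 - r := by linarith
  induction M with
  | zero => simp [Real.zero_rpow h1r.ne']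
  | succ M ih =>
    have hstep := sub_one_rpow_add_le (x := (M : ℝ) + 1) h1r.le (by linarith)
      (le_add_of_nonneg_left M.cast_nonneg)
    rw [add_sub_cancel_right, show 1 - r - 1 = -r by ring] at hstep
    rw [Finset.sum_range_succ, le_div_iff₀ h1r, add_mul, mul_comm _ (1 - r)]
    push_cast
    rw [le_div_iff₀ h1r] at ih
    linarith

lemma exists_lintegral_green_le_rpow_mul_rpow (hd : 3 ≤ d) {θ η : Measure (Lattice d)}
    [IsProbabilityMeasure θ] [IsProbabilityMeasure η] (hθ : IsIrreducible θ)
    (hη : IsIrreducible η) :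
    ∃ c : ℝ, 1 ≤ c ∧ ∀ D a b : ℕ, a + b ≤ D → ∫⁻ z, green η z ∂(convPow θ D) ≤
      ENNReal.ofReal (c * (((a : ℝ) + 1) ^ (-(((d : ℝ) - 2) / 4)) *
        ((b : ℝ) + 1) ^ (-(((d : ℝ) - 2) / 4)))) := by
  obtain ⟨C, -, hgreen⟩ := exists_lintegral_green_le hd hθ hη
  refine ⟨max 1 C, le_max_left _ _, fun D a b hab => (hgreen D).trans ?_⟩
  have hd' : (3 : ℝ) ≤ d := by exact_mod_cast hd
  have hanti : ∀ e : ℕ, e ≤ D → ((D : ℝ) + 1) ^ (-(((d : ℝ) - 2) / 4)) ≤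
      ((e : ℝ) + 1) ^ (-(((d : ℝ) - 2) / 4)) := fun e he => by
    have he' : (e : ℝ) ≤ D := by exact_mod_cast he
    exact Real.rpow_le_rpow_of_nonpos (by positivity) (by linarith) (by linarith)
  rw [show -(((d : ℝ) - 2) / 2) = -((d - 2) / 4) + -((d - 2) / 4) by ring,
    Real.rpow_add (by positivity)]
  refine ENNReal.ofReal_le_ofReal (mul_le_mul (le_max_right _ _) (mul_le_mul (hanti a (by omega))
    (hanti b (by omega)) (by positivity) (by positivity)) (by positivity) (by positivity))

lemma sum_ofReal_rpow_neg_le {r c : ℝ} (hr0 : 0 ≤ r) (hr1 : r < 1) (hc : 0 ≤ c) {H M : ℕ}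
    (hHM : H ≤ M) : ∑ a ∈ Finset.range H, ENNReal.ofReal (c * ((a : ℝ) + 1) ^ (-r)) ≤
      ENNReal.ofReal (c / (1 - r) * (M : ℝ) ^ (1 - r)) := by
  have : 0 < 1 - r := by linarith
  rw [← ENNReal.ofReal_sum_of_nonneg fun a _ => by positivity, ← Finset.mul_sum]
  refine ENNReal.ofReal_le_ofReal ?_
  calc c * ∑ a ∈ Finset.range H, ((a : ℝ) + 1) ^ (-r)
      ≤ c * ((H : ℝ) ^ (1 - r) / (1 - r)) := by gcongr; exact sum_rpow_neg_le hr0 hr1 _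
    _ ≤ c * ((M : ℝ) ^ (1 - r) / (1 - r)) := by gcongr
    _ = c / (1 - r) * (M : ℝ) ^ (1 - r) := by ring

section Mean

variable {μ : Measure ℕ} [IsProbabilityMeasure μ] (hmean : ∫⁻ n, (n : ℝ≥0∞) ∂μ = 1)
  {θ η : Measure (Lattice d)} [IsProbabilityMeasure θ] [θ.IsNegInvariant]
include hmean

lemma lintegral_energy_le {K H M : ℕ} (hK : K ≤ M) (hH : H + 1 ≤ M) {φ : ℕ → ℝ≥0∞} {B : ℝ≥0∞}
    (hB : 1 ≤ B) (hφ : ∑ a ∈ Finset.range (H + 1), φ a ≤ B)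
    (hone : ∀ D a, a ≤ D → ∫⁻ z, green η z ∂(convPow θ D) ≤ φ a)
    (htwo : ∀ D a b, a + b ≤ D → ∫⁻ z, green η z ∂(convPow θ D) ≤ φ a * φ b) :
    ∫⁻ ω, energy η K H ω ∂(brwLaw μ θ) ≤ (3 + ∫⁻ n, (n : ℝ≥0∞) ^ 2 ∂μ) * (M * B) ^ 2 := by
  rw [lintegral_energy μ θ η]
  refine (tsum_tsum_inTrunc_mul_le hmean K H
    (g := fun u v => ∫⁻ z, green η z ∂(convPow θ (treeDist u v))) (φ := φ)
    (fun k x z => hone _ _ (length_le_treeDist k x z))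
    (fun k x z => hone _ _ (by rw [treeDist_comm]; exact length_le_treeDist k x z))
    (fun k x y z i j hij => htwo _ _ _ (length_add_length_le_treeDist_branch k hij x y z))
    (fun k l x y hkl => htwo _ _ _ (length_add_length_le_treeDist_of_ne hkl x y))).trans ?_
  have hKM : (K : ℝ≥0∞) ≤ M := by exact_mod_cast hK
  have hHM : (H : ℝ≥0∞) + 1 ≤ M := by exact_mod_cast hH
  have hBsq : B ≤ B ^ 2 := by
    rw [sq]
    exact le_mul_of_one_le_left' hB
  set m := ∫⁻ n, (n : ℝ≥0∞) ^ 2 ∂μ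
  calc _ ≤ (M : ℝ≥0∞) * M * B ^ 2 + M * (M * (2 * B ^ 2 + m * B ^ 2)) := by
        gcongr
        exact hφ.trans hBsq
    _ = (3 + m) * (M * B) ^ 2 := by ring

theorem exists_lintegral_energy_le (hd3 : 3 ≤ d) (hd5 : d ≤ 5) [IsProbabilityMeasure η]
    (hvar : ∫⁻ n, (n : ℝ≥0∞) ^ 2 ∂μ ≠ ∞) (hθ : IsIrreducible θ) (hη : IsIrreducible η) :
    ∃ C : ℝ, 0 < C ∧ ∀ K H M : ℕ, K ≤ M → H + 1 ≤ M →
      ∫⁻ ω, energy η K H ω ∂(brwLaw μ θ) ≤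
        ENNReal.ofReal (C * (M : ℝ) ^ (4 - ((d : ℝ) - 2) / 2)) := by
  obtain ⟨c, hc1, hgreen⟩ := exists_lintegral_green_le_rpow_mul_rpow hd3 hθ hη
  set r : ℝ := ((d : ℝ) - 2) / 4 with hr
  have hd3' : (3 : ℝ) ≤ d := by exact_mod_cast hd3
  have hd5' : (d : ℝ) ≤ 5 := by exact_mod_cast hd5
  have hr0 : 0 ≤ r := by linarith
  have h1r : 0 < 1 - r := by linarith
  set m := (∫⁻ n, (n : ℝ≥0∞) ^ 2 ∂μ).toReal with hm
  refine ⟨(3 + m) * (c / (1 - r)) ^ 2, by positivity, fun K H M hK hH => ?_⟩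
  set B : ℝ := c / (1 - r) * (M : ℝ) ^ (1 - r) with hB
  have hM1 : (1 : ℝ) ≤ M := by exact_mod_cast (Nat.le_add_left 1 H).trans hH
  have hB1 : 1 ≤ B :=
    one_le_mul_of_one_le_of_one_le ((one_le_div h1r).2 (by linarith))
      (Real.one_le_rpow hM1 h1r.le)
  calc ∫⁻ ω, energy η K H ω ∂(brwLaw μ θ)
      ≤ (3 + ∫⁻ n, (n : ℝ≥0∞) ^ 2 ∂μ) * (M * ENNReal.ofReal B) ^ 2 := by
        refine lintegral_energy_le hmean hK hH (by simpa using hB1)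
          (sum_ofReal_rpow_neg_le (c := c) hr0 (by linarith) (by linarith) hH)
          (fun D a ha => by simpa using hgreen D a 0 ha) fun D a b hab => ?_
        rw [← ENNReal.ofReal_mul (by positivity)]
        refine (hgreen D a b hab).trans (ENNReal.ofReal_le_ofReal ?_)
        calc c * (((a : ℝ) + 1) ^ (-r) * ((b : ℝ) + 1) ^ (-r))
            ≤ c * c * (((a : ℝ) + 1) ^ (-r) * ((b : ℝ) + 1) ^ (-r)) := by
              gcongr
              exact le_mul_of_one_le_left (by linarith) hc1
          _ = _ := by ring
    _ = ENNReal.ofReal ((3 + m) * (M * B) ^ 2) := by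
        rw [ENNReal.ofReal_mul (p := 3 + m) (by positivity),
          ENNReal.ofReal_add (by positivity) (by positivity), hm, ENNReal.ofReal_toReal hvar,
          ENNReal.ofReal_pow (by positivity), ENNReal.ofReal_mul (p := (M : ℝ)) (by positivity),
          ENNReal.ofReal_natCast, ENNReal.ofReal_ofNat]
    _ = ENNReal.ofReal ((3 + m) * (c / (1 - r)) ^ 2 * (M : ℝ) ^ (4 - ((d : ℝ) - 2) / 2)) := by
        rw [show (4 - ((d : ℝ) - 2) / 2) = ((1 : ℝ) + (1 - r)) * (2 : ℕ) by push_cast; ring,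
          Real.rpow_mul_natCast (by positivity), Real.rpow_add (by positivity), Real.rpow_one, hB]
        congr 1
        ring

end Mean

end Energy

section Displacement

lemma exp_le_one_add_add_sq_mul (y : ℝ) : Real.exp y ≤ 1 + y + y ^ 2 * Real.exp |y| := by
  have h := Complex.norm_exp_sub_sum_le_norm_mul_exp y 2
  simp only [Finset.sum_range_succ, Finset.sum_range_zero, pow_zero, Nat.factorial_zero,
    Nat.cast_one, div_one, zero_add, pow_one, Nat.factorial_one, Complex.norm_real,
    Real.norm_eq_abs, sq_abs] at h
  have hreal : ‖Complex.exp y - (1 + (y : ℂ))‖ = |Real.exp y - (1 + y)| := by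
    rw [← Real.norm_eq_abs, ← Complex.norm_real]
    push_cast
    rfl
  rw [hreal] at h
  linarith [le_abs_self (Real.exp y - (1 + y))]

lemma exp_mul_le_of_abs_le {c t x y : ℝ} (hc : 0 < c) (ht : |t| ≤ c / 2) (hxy : |x| ≤ y) :
    Real.exp (t * x) ≤ 1 + t * x + t ^ 2 * (8 / c ^ 2) * Real.exp (c * y) := by
  have hy : 0 ≤ y := (abs_nonneg x).trans hxy
  have hsq : x ^ 2 ≤ 8 / c ^ 2 * Real.exp (c / 2 * y) := by
    have hquad := Real.quadratic_le_exp_of_nonneg (x := c / 2 * y) (by positivity)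
    calc x ^ 2 ≤ y ^ 2 := sq_le_sq' (abs_le.1 hxy).1 (abs_le.1 hxy).2
      _ = 8 / c ^ 2 * ((c / 2 * y) ^ 2 / 2) := by field_simp; norm_num
      _ ≤ _ := by
        gcongr
        linarith [mul_nonneg hc.le hy]
  refine (exp_le_one_add_add_sq_mul _).trans (add_le_add_right ?_ _)
  calc (t * x) ^ 2 * Real.exp |t * x|
      ≤ (t ^ 2 * (8 / c ^ 2 * Real.exp (c / 2 * y))) * Real.exp (c / 2 * y) := by
        rw [mul_pow, abs_mul]
        gcongr
    _ = t ^ 2 * (8 / c ^ 2) * Real.exp (c * y) := by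
        rw [show c * y = c / 2 * y + c / 2 * y by ring, Real.exp_add]
        ring

lemma lintegral_exp_mul_le {Ω : Type*} [MeasurableSpace Ω] {P : Measure Ω} [IsProbabilityMeasure P]
    {X Y : Ω → ℝ} {c : ℝ} (hc : 0 < c) (hX : AEStronglyMeasurable X P) (hXY : ∀ ω, |X ω| ≤ Y ω)
    (hint : Integrable (fun ω => Real.exp (c * Y ω)) P) (hmean : ∫ ω, X ω ∂P = 0) {t : ℝ}
    (ht : |t| ≤ c / 2) :
    ∫⁻ ω, ENNReal.ofReal (Real.exp (t * X ω)) ∂P ≤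
      ENNReal.ofReal (Real.exp (8 / c ^ 2 * (∫ ω, Real.exp (c * Y ω) ∂P) * t ^ 2)) := by
  have hXint : Integrable X P := by
    refine (hint.const_mul (1 / c)).mono' hX (ae_of_all _ fun ω => (hXY ω).trans ?_)
    rw [one_div, inv_mul_eq_div, le_div_iff₀ hc]
    linarith [Real.add_one_le_exp (c * Y ω)]
  have hlin : Integrable (fun ω => 1 + t * X ω) P := (integrable_const 1).add (hXint.const_mul t)
  have hrem : Integrable (fun ω => t ^ 2 * (8 / c ^ 2) * Real.exp (c * Y ω)) P := hint.const_mul _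
  have hpt := fun ω => exp_mul_le_of_abs_le hc ht (hXY ω)
  have hexp : Integrable (fun ω => Real.exp (t * X ω)) P :=
    (hlin.add hrem).mono' (by fun_prop) (ae_of_all _ fun ω =>
      (Real.norm_of_nonneg (Real.exp_pos _).le).trans_le (hpt ω))
  rw [← ofReal_integral_eq_lintegral_ofReal hexp (ae_of_all _ fun _ => (Real.exp_pos _).le)]
  refine ENNReal.ofReal_le_ofReal ?_
  calc ∫ ω, Real.exp (t * X ω) ∂P
      ≤ ∫ ω, (1 + t * X ω + t ^ 2 * (8 / c ^ 2) * Real.exp (c * Y ω)) ∂P :=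
        integral_mono hexp (hlin.add hrem) hpt
    _ = 8 / c ^ 2 * (∫ ω, Real.exp (c * Y ω) ∂P) * t ^ 2 + 1 := by
        rw [integral_add hlin hrem, integral_add (integrable_const 1) (hXint.const_mul t),
          integral_const_mul, integral_const_mul, hmean, integral_const, probReal_univ, smul_eq_mul]
        ring
    _ ≤ _ := Real.add_one_le_exp _

section Chernoff

variable {M : Type*} [AddCommMonoid M] [MeasurableSpace M] [DiscreteMeasurableSpace M]
  [Countable M] (θ : Measure M) (φ : M →+ ℝ)

lemma lintegral_exp_convPow (m : ℕ) :
    ∫⁻ z, ENNReal.ofReal (Real.exp (φ z)) ∂(convPow θ m) =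
      (∫⁻ x, ENNReal.ofReal (Real.exp (φ x)) ∂θ) ^ m := by
  induction m with
  | zero => simp [convPow]
  | succ m ih =>
    rw [convPow, Measure.lintegral_conv Measurable.of_discrete, pow_succ', ← ih]
    simp_rw [map_add, Real.exp_add, ENNReal.ofReal_mul (Real.exp_pos _).le,
      lintegral_const_mul _ (Measurable.of_discrete (α := M))]
    rw [lintegral_mul_const _ Measurable.of_discrete]

lemma convPow_le_of_lintegral_exp_le {L : ℝ}
    (hL : ∫⁻ x, ENNReal.ofReal (Real.exp (φ x)) ∂θ ≤ ENNReal.ofReal (Real.exp L)) (m : ℕ) (a : ℝ) :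
    convPow θ m {z | a ≤ φ z} ≤ ENNReal.ofReal (Real.exp (m * L - a)) := by
  have hmarkov : ENNReal.ofReal (Real.exp a) * convPow θ m {z | a ≤ φ z} ≤
      ENNReal.ofReal (Real.exp (m * L)) := by
    have hset : {z | a ≤ φ z} =
        {z | ENNReal.ofReal (Real.exp a) ≤ ENNReal.ofReal (Real.exp (φ z))} := by
      simp [ENNReal.ofReal_le_ofReal_iff (Real.exp_pos _).le]
    rw [hset, Real.exp_nat_mul, ENNReal.ofReal_pow (Real.exp_pos _).le]
    refine (mul_meas_ge_le_lintegral Measurable.of_discrete _).trans ?_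
    rw [lintegral_exp_convPow]
    gcongr
  rw [Real.exp_sub, ENNReal.ofReal_div_of_pos (Real.exp_pos a)]
  exact ENNReal.le_div_iff_mul_le (Or.inl (by simp [Real.exp_pos])) (Or.inl ENNReal.ofReal_ne_top)
    |>.2 (mul_comm (ENNReal.ofReal _) _ ▸ hmarkov)

end Chernoff

variable {d : ℕ}

lemma abs_le_euclNorm (x : Lattice d) (i : Fin d) : |(x i : ℝ)| ≤ euclNorm x :=
  Real.abs_le_sqrt (Finset.single_le_sum (f := fun i => (x i : ℝ) ^ 2) (fun _ _ => sq_nonneg _)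
    (Finset.mem_univ i))

lemma setOf_exists_le_abs_subset {t : ℝ} (ht : 0 < t) (R : ℝ) :
    {z : Lattice d | ∃ i, R ≤ |(z i : ℝ)|} ⊆
      ⋃ i, ({z | t * R ≤ t * z i} ∪ {z | t * R ≤ -t * z i}) := by
  rintro z ⟨i, hi⟩
  refine Set.mem_iUnion.2 ⟨i, (le_abs.1 hi).imp (fun h => ?_) fun h => ?_⟩
  · exact mul_le_mul_of_nonneg_left h ht.le
  · exact (mul_le_mul_of_nonneg_left h ht.le).trans_eq (neg_mul_comm t _).symm

variable (θ : Measure (Lattice d)) [θ.IsNegInvariant]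

lemma integral_coord_eq_zero (i : Fin d) : ∫ x, (x i : ℝ) ∂θ = 0 := by
  have h : ∫ x, (x i : ℝ) ∂θ = ∫ x, -(x i : ℝ) ∂θ := by
    rw [← integral_neg_eq_self]
    simp
  rw [integral_neg] at h
  linarith

variable [IsProbabilityMeasure θ]

lemma exists_convPow_tail_le
    (hexp : ∃ c : ℝ, 0 < c ∧ Integrable (fun x => Real.exp (c * euclNorm x)) θ) :
    ∃ C t₀ : ℝ, 0 < C ∧ 0 < t₀ ∧ ∀ (m : ℕ) (t R : ℝ), 0 < t → t ≤ t₀ →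
      convPow θ m {z | ∃ i, R ≤ |(z i : ℝ)|} ≤
        ENNReal.ofReal (2 * d * Real.exp (C * t ^ 2 * m - t * R)) := by
  obtain ⟨c, hc, hint⟩ := hexp
  refine ⟨8 / c ^ 2 * ∫ x, Real.exp (c * euclNorm x) ∂θ, c / 2,
    mul_pos (by positivity) (integral_exp_pos hint), by positivity, fun m t R ht htc => ?_⟩
  set C := 8 / c ^ 2 * ∫ x, Real.exp (c * euclNorm x) ∂θ
  have hside : ∀ (i : Fin d) (s : ℝ), |s| = t →
      convPow θ m {z | t * R ≤ s * z i} ≤ ENNReal.ofReal (Real.exp (C * t ^ 2 * m - t * R)) := by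
    rintro i s rfl
    have hmgf := lintegral_exp_mul_le hc Measurable.of_discrete.aestronglyMeasurable
      (fun x => abs_le_euclNorm x i) hint (integral_coord_eq_zero θ i) htc
    rw [sq_abs, mul_comm _ (m : ℝ)]
    exact convPow_le_of_lintegral_exp_le θ ((AddMonoidHom.mulLeft s).comp
      ((Int.castAddHom ℝ).comp (Pi.evalAddMonoidHom (fun _ => ℤ) i))) hmgf m _
  have hcoord : ∀ i : Fin d, convPow θ m ({z | t * R ≤ t * z i} ∪ {z | t * R ≤ -t * z i}) ≤
      ENNReal.ofReal (2 * Real.exp (C * t ^ 2 * m - t * R)) := fun i => by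
    rw [two_mul, ENNReal.ofReal_add (Real.exp_pos _).le (Real.exp_pos _).le]
    exact (measure_union_le _ _).trans
      (add_le_add (hside i t (abs_of_pos ht)) (hside i (-t) (by rw [abs_neg, abs_of_pos ht])))
  calc convPow θ m {z | ∃ i, R ≤ |(z i : ℝ)|}
      ≤ ∑ i, convPow θ m ({z | t * R ≤ t * z i} ∪ {z | t * R ≤ -t * z i}) :=
        (measure_mono (setOf_exists_le_abs_subset ht R)).trans (measure_iUnion_fintype_le _ _)
    _ ≤ ∑ _i : Fin d, ENNReal.ofReal (2 * Real.exp (C * t ^ 2 * m - t * R)) := by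
        gcongr
        exact hcoord _
    _ = ENNReal.ofReal (2 * d * Real.exp (C * t ^ 2 * m - t * R)) := by
        rw [Finset.sum_const, Finset.card_univ, Fintype.card_fin, nsmul_eq_mul,
          ← ENNReal.ofReal_natCast, ← ENNReal.ofReal_mul (by positivity)]
        congr 1
        ring

theorem exists_brwLaw_displacement_le {μ : Measure ℕ} [IsProbabilityMeasure μ]
    (hmean : ∫⁻ n, (n : ℝ≥0∞) ∂μ = 1)
    (hexp : ∃ c : ℝ, 0 < c ∧ Integrable (fun x => Real.exp (c * euclNorm x)) θ) :
    ∃ C t₀ : ℝ, 0 < C ∧ 0 < t₀ ∧ ∀ (K H M : ℕ) (t R : ℝ), 0 < t → t ≤ t₀ → K ≤ M → H + 1 ≤ M →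
      brwLaw μ θ {ω | ∃ u, InTrunc ω.1 K H u ∧ ∃ i, R ≤ |(position ω.2 u i : ℝ)|} ≤
        ENNReal.ofReal (2 * d * M ^ 2 * Real.exp (C * t ^ 2 * (2 * M) - t * R)) := by
  obtain ⟨C, t₀, hC, ht₀, htail⟩ := exists_convPow_tail_le θ hexp
  refine ⟨C, t₀, hC, ht₀, fun K H M t R ht htt hK hH => ?_⟩
  have hvertex : ∀ u : Vertex, u.1 < K → u.2.length ≤ H →
      displacementLaw θ {X | ∃ i, R ≤ |(position X u i : ℝ)|} ≤
        ENNReal.ofReal (2 * d * Real.exp (C * t ^ 2 * (2 * M) - t * R)) := by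
    rintro ⟨k, x⟩ hk hx
    have hgen : ((k + x.length : ℕ) : ℝ) ≤ 2 * M := by
      rw [← Nat.cast_ofNat, ← Nat.cast_mul, Nat.cast_le]
      grind
    calc displacementLaw θ {X | ∃ i, R ≤ |(position X (k, x) i : ℝ)|}
        = convPow θ (k + x.length) {z | ∃ i, R ≤ |(z i : ℝ)|} := by
          rw [← map_position θ k x, Measure.map_apply (by fun_prop) MeasurableSet.of_discrete]
          rfl
      _ ≤ _ := (htail (k + x.length) t R ht htt).trans (ENNReal.ofReal_le_ofReal (by gcongr))
  have hsub : {ω : (Vertex → ℕ) × (Vertex → Lattice d) |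
      ∃ u, InTrunc ω.1 K H u ∧ ∃ i, R ≤ |(position ω.2 u i : ℝ)|} ⊆
      ⋃ u, {N | InTrunc N K H u} ×ˢ {X | ∃ i, R ≤ |(position X u i : ℝ)|} := by
    rintro ω ⟨u, hu, hR⟩
    exact Set.mem_iUnion.2 ⟨u, hu, hR⟩
  refine (measure_mono hsub).trans ((measure_iUnion_le _).trans ?_)
  simp_rw [brwLaw, Measure.prod_prod]
  refine (tsum_childLaw_inTrunc_mul_le hmean K H hvertex).trans ?_
  have hKM : (K : ℝ≥0∞) ≤ M := by exact_mod_cast hK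
  have hHM : (H : ℝ≥0∞) + 1 ≤ M := by exact_mod_cast hH
  calc (K : ℝ≥0∞) * (H + 1) * ENNReal.ofReal (2 * d * Real.exp (C * t ^ 2 * (2 * M) - t * R))
      ≤ M * M * ENNReal.ofReal (2 * d * Real.exp (C * t ^ 2 * (2 * M) - t * R)) := by gcongr
    _ = _ := by
      rw [← ENNReal.ofReal_natCast, ← ENNReal.ofReal_mul (by positivity),
        ← ENNReal.ofReal_mul (by positivity)]
      congr 1
      ring

end Displacement

section Survival

/-- The vertex `v`, provided it belongs to the forest, has descendants `h` generations further. -/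
def Reaches (N : Vertex → ℕ) : ℕ → Vertex → Prop
  | 0, _ => True
  | h + 1, (k, w) => ∃ j < N (k, w), Reaches N h (k, j :: w)

lemma reaches_of_inForest_append {N : Vertex → ℕ} {k : ℕ} (x w : List ℕ)
    (hx : InForest N (k, x ++ w)) : Reaches N x.length (k, w) := by
  induction x using List.reverseRecOn generalizing w with
  | nil => trivial
  | append_singleton x j ih =>
    rw [List.append_assoc, List.singleton_append] at hx
    rw [List.length_append]
    have hj : j < N (k, w) := by
      have hchild := ((inForest_append N k (j :: w) x).1 hx).2
      simp only [InForest] at hchild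
      exact hchild.2
    exact ⟨j, hj, ih _ hx⟩

lemma reaches_of_inForest {N : Vertex → ℕ} {k h : ℕ} {x : List ℕ} (hx : InForest N (k, x))
    (hh : h ≤ x.length) : Reaches N h (k, []) := by
  rw [← List.take_append_drop (x.length - h) x, inForest_append] at hx
  have hlength : (x.drop (x.length - h)).length = h := by
    rw [List.length_drop]
    omega
  rw [← hlength]
  exact reaches_of_inForest_append _ _ (by rw [List.append_nil]; exact hx.2)

lemma reaches_shift (N : Vertex → ℕ) (k : ℕ) (w : List ℕ) (h l : ℕ) (x : List ℕ) :
    Reaches (fun v => N (k + v.1, v.2 ++ w)) h (l, x) ↔ Reaches N h (k + l, x ++ w) := by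
  induction h generalizing x with
  | zero => rfl
  | succ h ih => simp only [Reaches, ih, List.cons_append]

lemma measurableSet_coordinateSigma_lt {S : Set Vertex} {v : Vertex} (hv : v ∈ S) (j : ℕ) :
    MeasurableSet[coordinateSigma ℕ S] {N : Vertex → ℕ | j < N v} :=
  measurable_eval_coordinateSigma hv (MeasurableSet.of_discrete (s := {n | j < n}))

lemma measurableSet_coordinateSigma_reaches (k h : ℕ) (w : List ℕ) {S : Set Vertex}
    (hS : {v : Vertex | w <:+ v.2} ⊆ S) :
    MeasurableSet[coordinateSigma ℕ S] {N : Vertex → ℕ | Reaches N h (k, w)} := by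
  induction h generalizing w with
  | zero => exact MeasurableSet.univ
  | succ h ih =>
    have hunion : {N : Vertex → ℕ | Reaches N (h + 1) (k, w)} =
        ⋃ j, {N | j < N (k, w)} ∩ {N | Reaches N h (k, j :: w)} := by
      ext N
      simp [Reaches]
    rw [hunion]
    exact MeasurableSet.iUnion fun j =>
      (measurableSet_coordinateSigma_lt (hS (List.suffix_refl w)) j).inter
        (ih (j :: w) fun v hv => hS ((List.suffix_cons j w).trans hv))

lemma measurableSet_reaches (h : ℕ) (v : Vertex) : MeasurableSet {N | Reaches N h v} :=
  coordinateSigma_le _ _ (measurableSet_coordinateSigma_reaches v.1 h v.2 Set.Subset.rfl)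

lemma measure_iUnion_add_measure_inter_le {Ω : Type*} [MeasurableSpace Ω] (P : Measure Ω)
    {A : ℕ → Set Ω} (hA : MeasurableSet (A 1)) :
    P (⋃ j, A j) + P (A 0 ∩ A 1) ≤ ∑' j, P (A j) := by
  have hcover : ⋃ j, A j ⊆ (A 0 ∪ A 1) ∪ ⋃ j, A (j + 2) := by
    refine Set.iUnion_subset fun j => ?_
    match j with
    | 0 => exact fun ω hω => Or.inl (Or.inl hω)
    | 1 => exact fun ω hω => Or.inl (Or.inr hω)
    | j + 2 => exact fun ω hω => Or.inr (Set.mem_iUnion_of_mem j hω)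
  calc P (⋃ j, A j) + P (A 0 ∩ A 1)
      ≤ P (A 0 ∪ A 1) + ∑' j, P (A (j + 2)) + P (A 0 ∩ A 1) := by
        gcongr
        exact (measure_mono hcover).trans
          ((measure_union_le _ _).trans (by gcongr; exact measure_iUnion_le _))
    _ = P (A 0) + P (A 1) + ∑' j, P (A (j + 2)) := by
        rw [add_right_comm, measure_union_add_inter _ hA]
    _ = ∑' j, P (A j) := by
        rw [tsum_eq_zero_add' (f := fun j => P (A j)) ENNReal.summable,
          tsum_eq_zero_add' (f := fun j => P (A (j + 1))) ENNReal.summable, add_assoc]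

variable (μ : Measure ℕ) [IsProbabilityMeasure μ]

/-- The probability that a Galton–Watson tree has vertices in generation `h`. -/
def survivalProb (h : ℕ) : ℝ≥0∞ := childLaw μ {N | Reaches N h (0, [])}

lemma childLaw_reaches (h : ℕ) (v : Vertex) :
    childLaw μ {N | Reaches N h v} = survivalProb μ h := by
  obtain ⟨k, w⟩ := v
  have hinj : Function.Injective fun v : Vertex => (k + v.1, v.2 ++ w) := by
    rintro ⟨a, x⟩ ⟨b, y⟩ hab
    simpa using hab
  have hmap := Measure.map_infinitePi_infinitePi_of_inj (P := fun _ : Vertex => μ) hinj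
  conv_rhs => rw [survivalProb, childLaw, ← hmap]
  rw [Measure.map_apply (by fun_prop) (measurableSet_reaches h _)]
  exact congrArg _ (Set.ext fun N => (reaches_shift N k w h 0 []).symm)

lemma childLaw_lt_eval (j : ℕ) (v : Vertex) : childLaw μ {N | j < N v} = tailProb μ j := by
  have heval := congrArg (fun ν : Measure ℕ => ν {n | j < n})
    (Measure.infinitePi_map_eval (fun _ : Vertex => μ) v)
  exact (Measure.map_apply (measurable_pi_apply _) MeasurableSet.of_discrete).symm.trans heval

/-- The numbers of children of the root `(0, [])` such that the child number `j` exists and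
has descendants `h` generations further. -/
def childReaches (h j : ℕ) : Set (Vertex → ℕ) := {N | j < N (0, []) ∧ Reaches N h (0, [j])}

lemma childLaw_inter {S T : Set Vertex} (hST : Disjoint S T) {A B : Set (Vertex → ℕ)}
    (hA : MeasurableSet[coordinateSigma ℕ S] A) (hB : MeasurableSet[coordinateSigma ℕ T] B) :
    childLaw μ (A ∩ B) = childLaw μ A * childLaw μ B :=
  (ProbabilityTheory.Indep_iff _ _ _).1 (indep_coordinateSigma μ hST) A B hA hB

lemma childLaw_childReaches (h j : ℕ) :
    childLaw μ (childReaches h j) = tailProb μ j * survivalProb μ h := by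
  have hroot : Disjoint {((0, []) : Vertex)} {v : Vertex | [j] <:+ v.2} := by
    rw [Set.disjoint_singleton_left]
    simp
  rw [← childLaw_lt_eval μ j (0, []), ← childLaw_reaches μ h (0, [j])]
  exact childLaw_inter μ hroot (measurableSet_coordinateSigma_lt (Set.mem_singleton _) j)
    (measurableSet_coordinateSigma_reaches 0 h [j] Set.Subset.rfl)

lemma childLaw_childReaches_inter (h : ℕ) :
    childLaw μ (childReaches h 0 ∩ childReaches h 1) = tailProb μ 1 * survivalProb μ h ^ 2 := by
  have hset : childReaches h 0 ∩ childReaches h 1 =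
      {N | 1 < N (0, [])} ∩ ({N | Reaches N h (0, [0])} ∩ {N | Reaches N h (0, [1])}) := by
    ext N
    simp only [childReaches, Set.mem_inter_iff, Set.mem_ofPred_eq]
    grind
  have hbranches : Disjoint {v : Vertex | [0] <:+ v.2} {v : Vertex | [1] <:+ v.2} :=
    Set.disjoint_left.2 fun v h0 h1 => zero_ne_one (eq_of_cons_suffix h0 h1)
  have hroot : Disjoint {((0, []) : Vertex)}
      ({v : Vertex | [0] <:+ v.2} ∪ {v : Vertex | [1] <:+ v.2}) := by
    rw [Set.disjoint_singleton_left]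
    simp
  rw [hset, childLaw_inter μ hroot (measurableSet_coordinateSigma_lt (Set.mem_singleton _) 1)
      ((measurableSet_coordinateSigma_reaches 0 h [0] Set.subset_union_left).inter
        (measurableSet_coordinateSigma_reaches 0 h [1] Set.subset_union_right)),
    childLaw_inter μ hbranches (measurableSet_coordinateSigma_reaches 0 h [0] Set.Subset.rfl)
      (measurableSet_coordinateSigma_reaches 0 h [1] Set.Subset.rfl),
    childLaw_lt_eval, childLaw_reaches, childLaw_reaches, sq]

lemma mul_one_add_mul_le_one {q : ℕ → ℝ} {c : ℝ} (hc0 : 0 ≤ c) (hc1 : c ≤ 1)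
    (hq : ∀ h, 0 ≤ q h) (hzero : q 0 ≤ 1) (hsucc : ∀ h, q (h + 1) + c * q h ^ 2 ≤ q h) (h : ℕ) :
    q h * (1 + c * h) ≤ 1 := by
  induction h with
  | zero => simpa using hzero
  | succ h ih =>
    have hle : q h ≤ 1 :=
      (le_mul_of_one_le_right (hq h) (le_add_of_nonneg_right (by positivity))).trans ih
    have hcq : c * q h ≤ 1 := mul_le_one₀ hc1 (hq h) hle
    push_cast
    calc q (h + 1) * (1 + c * (h + 1)) ≤ (q h - c * q h ^ 2) * (1 + c * (h + 1)) := by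
          gcongr
          linarith [hsucc h]
      _ = q h * (1 + c * h) + (c * q h) * (1 - q h * (1 + c * h)) - (c * q h) ^ 2 := by ring
      _ ≤ q h * (1 + c * h) + 1 * (1 - q h * (1 + c * h)) - 0 :=
          sub_le_sub (add_le_add_right (mul_le_mul_of_nonneg_right hcq (sub_nonneg.2 ih)) _)
            (sq_nonneg _)
      _ = 1 := by ring

section Critical

variable (hmean : ∫⁻ n, (n : ℝ≥0∞) ∂μ = 1)
include hmean

lemma survivalProb_succ_add_le (h : ℕ) :
    survivalProb μ (h + 1) + tailProb μ 1 * survivalProb μ h ^ 2 ≤ survivalProb μ h := by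
  have hunion : {N : Vertex → ℕ | Reaches N (h + 1) (0, [])} = ⋃ j, childReaches h j := by
    ext N
    simp [Reaches, childReaches]
  have hmeas : MeasurableSet (childReaches h 1) :=
    (measurableSet_lt measurable_const (measurable_pi_apply _)).inter (measurableSet_reaches h _)
  calc survivalProb μ (h + 1) + tailProb μ 1 * survivalProb μ h ^ 2
      = childLaw μ (⋃ j, childReaches h j) +
          childLaw μ (childReaches h 0 ∩ childReaches h 1) := by
        rw [childLaw_childReaches_inter, survivalProb, hunion]
    _ ≤ ∑' j, childLaw μ (childReaches h j) := measure_iUnion_add_measure_inter_le _ hmeas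
    _ = survivalProb μ h := by
        simp_rw [childLaw_childReaches, ENNReal.tsum_mul_right, tsum_tailProb, hmean, one_mul]

lemma survivalProb_le (h : ℕ) :
    survivalProb μ h ≤ ENNReal.ofReal (1 / (1 + (tailProb μ 1).toReal * h)) := by
  have hfin : ∀ h, survivalProb μ h ≠ ∞ := fun h => measure_ne_top _ _
  have hle : ∀ {a : ℝ≥0∞}, a ≤ 1 → a.toReal ≤ 1 := ENNReal.toReal_mono ENNReal.one_ne_top
  have hsucc : ∀ h, (survivalProb μ (h + 1)).toReal +
      (tailProb μ 1).toReal * (survivalProb μ h).toReal ^ 2 ≤ (survivalProb μ h).toReal :=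
    fun h => by
      have htail : tailProb μ 1 ≠ ∞ := measure_ne_top _ _
      have hprod : tailProb μ 1 * survivalProb μ h ^ 2 ≠ ∞ :=
        ENNReal.mul_ne_top htail (ENNReal.pow_ne_top (hfin h))
      rw [← ENNReal.toReal_pow, ← ENNReal.toReal_mul, ← ENNReal.toReal_add (hfin _) hprod]
      exact ENNReal.toReal_mono (hfin h) (survivalProb_succ_add_le μ hmean h)
  rw [← ENNReal.ofReal_toReal (hfin h)]
  refine ENNReal.ofReal_le_ofReal ((le_div_iff₀ (by positivity)).2 ?_)
  exact mul_one_add_mul_le_one (q := fun h => (survivalProb μ h).toReal) ENNReal.toReal_nonneg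
    (hle prob_le_one) (fun _ => ENNReal.toReal_nonneg) (hle prob_le_one) hsucc h

lemma childLaw_exists_reaches_le (K h : ℕ) :
    childLaw μ {N | ∃ k < K, Reaches N h (k, [])} ≤
      ENNReal.ofReal (K / (1 + (tailProb μ 1).toReal * h)) := by
  have hunion : {N : Vertex → ℕ | ∃ k < K, Reaches N h (k, [])} =
      ⋃ k ∈ Finset.range K, {N | Reaches N h (k, [])} := by
    ext N
    simp
  rw [hunion]
  refine (measure_biUnion_finset_le _ _).trans ?_
  simp_rw [childLaw_reaches]
  rw [Finset.sum_const, Finset.card_range, nsmul_eq_mul, div_eq_mul_one_div,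
    ENNReal.ofReal_mul (by positivity), ENNReal.ofReal_natCast]
  gcongr
  exact survivalProb_le μ hmean h

lemma tailProb_one_toReal_pos (hne : μ ≠ Measure.dirac 1) : 0 < (tailProb μ 1).toReal := by
  refine ENNReal.toReal_pos (fun hzero => hne ?_) (measure_ne_top _ _)
  have hle : ∀ᵐ n ∂μ, n ≤ 1 := by
    rw [ae_iff]
    simpa [tailProb] using hzero
  have hone : μ {1} = 1 := by
    rw [← hmean, ← lintegral_indicator_one (measurableSet_singleton 1)]
    refine lintegral_congr_ae ?_
    filter_upwards [hle] with n hn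
    interval_cases n <;> simp
  have hcompl : μ {1}ᶜ = 0 := by rwa [prob_compl_eq_zero_iff (measurableSet_singleton 1)]
  refine Measure.ext_of_singleton fun n => ?_
  by_cases hn : n = 1
  · simp [hn, hone]
  · rw [measure_mono_null (by simpa [eq_comm] using hn) hcompl]
    simp [Ne.symm hn]

end Critical

end Survival

section Exploration

/-- The position of a vertex in the exploration order, which is the lexicographic order: first on
the indices of the trees, then on the addresses read from the root. -/
def lexKey (u : Vertex) : ℕ ×ₗ List ℕ := toLex (u.1, u.2.reverse)

lemma lexKey_injective : Function.Injective lexKey := by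
  rintro ⟨k, x⟩ ⟨l, y⟩ h
  simpa [lexKey] using h

lemma lexKey_lt_lexKey {u v : Vertex} : lexKey u < lexKey v ↔ Precedes u v :=
  Prod.Lex.toLex_lt_toLex

lemma lexKey_root_le (v : Vertex) : lexKey (0, []) ≤ lexKey v := by
  rw [lexKey, lexKey, Prod.Lex.toLex_le_toLex]
  rcases Nat.eq_zero_or_pos v.1 with h | h
  · exact Or.inr ⟨h.symm, not_lt.1 (List.not_lt_nil _)⟩
  · exact Or.inl h

lemma lexKey_dfs_strictMono (N : Vertex → ℕ) : StrictMono (lexKey ∘ dfs N) :=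
  strictMono_nat_of_lt_succ fun i => lexKey_lt_lexKey.2 (dfs_spec N i).2.1

lemma dfs_injective (N : Vertex → ℕ) : Function.Injective (dfs N) :=
  (lexKey_dfs_strictMono N).injective.of_comp

lemma exists_dfs_eq_of_lexKey_lt {N : Vertex → ℕ} {v : Vertex} (hv : InForest N v) {n : ℕ}
    (hlt : lexKey v < lexKey (dfs N n)) : ∃ i < n, dfs N i = v := by
  induction n with
  | zero => exact absurd (lexKey_root_le v) (not_le.2 hlt)
  | succ n ih =>
    rcases lt_trichotomy (lexKey v) (lexKey (dfs N n)) with h | h | h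
    · obtain ⟨i, hi, hiv⟩ := ih h
      exact ⟨i, hi.trans n.lt_succ_self, hiv⟩
    · exact ⟨n, n.lt_succ_self, lexKey_injective h.symm⟩
    · rcases (dfs_spec N n).2.2 v hv (lexKey_lt_lexKey.1 h) with heq | hpre
      · exact absurd hlt (heq ▸ lt_irrefl _)
      · exact absurd hlt (lexKey_lt_lexKey.2 hpre).not_gt

lemma truncCount_le_of_le_dfs_fst {N : Vertex → ℕ} {K n : ℕ} (hn : K ≤ (dfs N n).1) (H : ℕ) :
    truncCount K H N ≤ n := by
  classical
  have hexplored : ∀ u ∉ (Finset.range n).image (dfs N), truncIndicator K H u N = 0 := by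
    refine fun u hu => if_neg fun htrunc => hu ?_
    have hlt : Precedes u (dfs N n) := Or.inl (htrunc.1.trans_le hn)
    simpa using exists_dfs_eq_of_lexKey_lt htrunc.2.2 (lexKey_lt_lexKey.2 hlt)
  have hone : ∀ u, truncIndicator K H u N ≤ 1 := fun u => by
    rw [truncIndicator]
    split_ifs <;> simp
  calc truncCount K H N = ∑ u ∈ (Finset.range n).image (dfs N), truncIndicator K H u N :=
        tsum_eq_sum hexplored
    _ ≤ ((Finset.range n).image (dfs N)).card := by
        simpa using Finset.sum_le_card_nsmul _ _ 1 fun u _ => hone u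
    _ ≤ n := by exact_mod_cast Finset.card_image_le.trans (Finset.card_range n).le

lemma dfs_fst_lt {N : Vertex → ℕ} {K H n : ℕ} (hcount : (n : ℝ≥0∞) < truncCount K H N) {i : ℕ}
    (hi : i ≤ n) : (dfs N i).1 < K := by
  have hmono : (dfs N i).1 ≤ (dfs N n).1 :=
    Prod.Lex.monotone_fst (lexKey (dfs N i)) (lexKey (dfs N n))
      ((lexKey_dfs_strictMono N).monotone hi)
  exact hmono.trans_lt (not_le.1 fun hn => hcount.not_ge (truncCount_le_of_le_dfs_fst hn H))

lemma dfs_inTrunc {N : Vertex → ℕ} {K H H' n : ℕ} (hcount : (n : ℝ≥0∞) < truncCount K H' N)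
    (hheight : ¬ ∃ k < K, Reaches N (H + 1) (k, [])) {i : ℕ} (hi : i ≤ n) :
    InTrunc N K H (dfs N i) := by
  have hforest := (dfs_spec N i).1
  have htree := dfs_fst_lt hcount hi
  refine ⟨htree, not_lt.1 fun hlong => hheight ⟨_, htree, ?_⟩, hforest⟩
  exact reaches_of_inForest (x := (dfs N i).2) hforest hlong

variable {d : ℕ} (η : Measure (Lattice d))

lemma sum_green_le_energy {K H n : ℕ} {ω : (Vertex → ℕ) × (Vertex → Lattice d)}
    (htrunc : ∀ i ≤ n, InTrunc ω.1 K H (dfs ω.1 i)) :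
    ∑ j ∈ Finset.range (n + 1), ∑ i ∈ Finset.range (n + 1),
      green η (position ω.2 (dfs ω.1 j) - position ω.2 (dfs ω.1 i)) ≤ energy η K H ω := by
  have hone : ∀ i ∈ Finset.range (n + 1), truncIndicator K H (dfs ω.1 i) ω.1 = 1 :=
    fun i hi => if_pos (htrunc i (Finset.mem_range_succ_iff.1 hi))
  have hinj : Set.InjOn (dfs ω.1) (Finset.range (n + 1)) := (dfs_injective ω.1).injOn
  classical
  set term : Vertex → Vertex → ℝ≥0∞ := fun u v =>
    truncIndicator K H u ω.1 * truncIndicator K H v ω.1 *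
      green η (position ω.2 u - position ω.2 v)
  calc _ = ∑ j ∈ Finset.range (n + 1), ∑ i ∈ Finset.range (n + 1),
        term (dfs ω.1 j) (dfs ω.1 i) := by
        refine Finset.sum_congr rfl fun j hj => Finset.sum_congr rfl fun i hi => ?_
        simp only [term, hone j hj, hone i hi, one_mul]
    _ = ∑ u ∈ (Finset.range (n + 1)).image (dfs ω.1),
          ∑ v ∈ (Finset.range (n + 1)).image (dfs ω.1), term u v := by
        simp only [Finset.sum_image hinj]
    _ ≤ ∑ u ∈ (Finset.range (n + 1)).image (dfs ω.1), ∑' v, term u v :=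
        Finset.sum_le_sum fun u _ => ENNReal.sum_le_tsum _
    _ ≤ energy η K H ω := ENNReal.sum_le_tsum _

variable {η}

theorem IsTransient.sq_le_mul_capacity_range [IsProbabilityMeasure η] (hη : IsTransient η)
    {ω : (Vertex → ℕ) × (Vertex → Lattice d)} {K H n : ℕ} {E : ℝ}
    (htrunc : ∀ i ≤ n, InTrunc ω.1 K H (dfs ω.1 i)) (hE : energy η K H ω ≤ ENNReal.ofReal E)
    (hE0 : 0 ≤ E) : (n : ℝ) ^ 2 ≤ 4 * E * capacity η (range ω.1 ω.2 n) := by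
  have hsum := (sum_green_le_energy η htrunc).trans hE
  have hcard : ((n : ℝ≥0∞) + 1) ^ 2 ≤
      4 * ENNReal.ofReal E * ecapacity η (range ω.1 ω.2 n) := by
    refine le_trans ?_ ((hη.card_sq_le_mul_ecapacity (Finset.range (n + 1))
      fun i => position ω.2 (dfs ω.1 i)).trans ?_)
    · simp
    · gcongr
      exact le_rfl
  have hreal := ENNReal.toReal_mono
    (ENNReal.mul_ne_top (by finiteness) (ecapacity_ne_top η _)) hcard
  rw [ENNReal.toReal_mul, ENNReal.toReal_mul, ENNReal.toReal_ofReal hE0, ← capacity_eq_toReal,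
    ENNReal.toReal_pow, ENNReal.toReal_add (by finiteness) (by finiteness),
    ENNReal.toReal_natCast] at hreal
  refine le_trans ?_ hreal
  gcongr
  simp

lemma IsTransient.capacity_range_mono [IsProbabilityMeasure η] (hη : IsTransient η)
    (N : Vertex → ℕ) (X : Vertex → Lattice d) : Monotone fun n => capacity η (range N X n) := by
  intro m n hmn
  simp only [capacity_eq_toReal]
  refine ENNReal.toReal_mono (ecapacity_ne_top η _) (hη.ecapacity_mono ?_)
  exact Finset.image_subset_image (Finset.range_mono (by lia))

end Exploration

section Asymptotics

lemma exists_exponent_of_forall {f : ℕ → ℝ} {s : ℝ}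
    (hf : ∀ m : ℕ, ∀ᶠ n : ℕ in atTop, (n : ℝ) ^ (s - 1 / ((m : ℝ) + 1)) ≤ f n ∧
      f n ≤ (n : ℝ) ^ (s + 1 / ((m : ℝ) + 1))) :
    ∃ ε : ℕ → ℝ, Tendsto ε atTop (𝓝 0) ∧ ∀ᶠ n : ℕ in atTop, f n = (n : ℝ) ^ (s + ε n) := by
  have hlarge : ∀ᶠ n : ℕ in atTop, (1 : ℝ) < n := by
    filter_upwards [eventually_gt_atTop 1] with n hn
    exact_mod_cast hn
  have hpos : ∀ᶠ n : ℕ in atTop, 0 < f n := by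
    filter_upwards [hf 0, hlarge] with n hn hn1
    exact (Real.rpow_pos_of_pos (by linarith) _).trans_le hn.1
  refine ⟨fun n => Real.logb n (f n) - s, Metric.tendsto_nhds.2 fun κ hκ => ?_, ?_⟩
  · obtain ⟨m, hm⟩ := exists_nat_one_div_lt hκ
    filter_upwards [hf m, hpos, hlarge] with n hn hfn hn1
    have hlower := (Real.le_logb_iff_rpow_le hn1 hfn).2 hn.1
    have hupper := (Real.logb_le_iff_le_rpow hn1 hfn).2 hn.2
    rw [Real.dist_eq, sub_zero]
    exact (abs_le.2 ⟨by linarith, by linarith⟩).trans_lt hm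
  · filter_upwards [hpos, hlarge] with n hfn hn1
    rw [add_sub_cancel, Real.rpow_logb (by linarith) hn1.ne' hfn]

lemma exists_forall_rpow_mul_exp_le (a : ℝ) {δ t : ℝ} (hδ : 0 < δ) (ht : 0 < t) :
    ∃ C, 0 < C ∧ ∀ x : ℝ, 1 ≤ x → x ^ a * Real.exp (-(t * x ^ δ)) ≤ C := by
  obtain ⟨m, hm⟩ := exists_nat_ge (a / δ)
  refine ⟨m.factorial / t ^ m, by positivity, fun x hx => ?_⟩
  have hpow : x ^ a ≤ (x ^ δ) ^ m := by
    rw [← Real.rpow_mul_natCast (by linarith)]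
    exact Real.rpow_le_rpow_of_exponent_le hx ((div_le_iff₀' hδ).1 hm)
  have hexp : (t * x ^ δ) ^ m / m.factorial ≤ Real.exp (t * x ^ δ) :=
    Real.pow_div_factorial_le_exp _ (by positivity) m
  rw [Real.exp_neg, ← div_eq_mul_inv, div_le_div_iff₀ (Real.exp_pos _) (by positivity)]
  calc x ^ a * t ^ m ≤ (x ^ δ) ^ m * t ^ m := by gcongr
    _ = (t * x ^ δ) ^ m := by rw [mul_pow, mul_comm]
    _ ≤ Real.exp (t * x ^ δ) * m.factorial := (div_le_iff₀ (by positivity)).1 hexp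
    _ = m.factorial * Real.exp (t * x ^ δ) := mul_comm _ _

lemma rpow_le_two_rpow_abs_mul_rpow {x y : ℝ} (a : ℝ) (hx : 0 < x) (hxy : x ≤ 2 * y)
    (hyx : y ≤ 2 * x) : x ^ a ≤ 2 ^ |a| * y ^ a := by
  have hy : 0 < y := by linarith
  rw [← div_le_iff₀ (by positivity), ← Real.div_rpow hx.le hy.le]
  rcases le_total 0 a with ha | ha
  · rw [abs_of_nonneg ha]
    exact Real.rpow_le_rpow (by positivity) ((div_le_iff₀ hy).2 hxy) ha
  · rw [abs_of_nonpos ha, ← inv_div, Real.inv_rpow (by positivity), ← Real.rpow_neg (by positivity)]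
    exact Real.rpow_le_rpow (by positivity) ((div_le_iff₀ hx).2 hyx) (neg_nonneg.2 ha)

lemma tendsto_natLog_two_atTop : Tendsto (Nat.log 2) atTop atTop :=
  tendsto_atTop.2 fun b => by
    filter_upwards [eventually_ge_atTop (2 ^ b)] with n hn
    exact Nat.le_log_of_pow_le one_lt_two hn

lemma tendsto_natCast_rpow_atTop {κ : ℝ} (hκ : 0 < κ) :
    Tendsto (fun n : ℕ => (n : ℝ) ^ κ) atTop atTop :=
  (tendsto_rpow_atTop hκ).comp tendsto_natCast_atTop_atTop

section Dyadic

variable {f : ℕ → ℝ} (hf : Monotone f) {C κ : ℝ} (a : ℝ) (hC : 0 < C) (hκ : 0 < κ)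
include hf hC hκ

lemma eventually_rpow_le_of_dyadic
    (h : ∀ᶠ k : ℕ in atTop, C * ((2 ^ k : ℕ) : ℝ) ^ a ≤ f (2 ^ k)) :
    ∀ᶠ n : ℕ in atTop, (n : ℝ) ^ (a - κ) ≤ f n := by
  filter_upwards [tendsto_natLog_two_atTop.eventually h,
    (tendsto_natCast_rpow_atTop hκ).eventually_ge_atTop (2 ^ |a| / C), eventually_gt_atTop 0]
    with n hdyadic hbig hn
  have hle : 2 ^ Nat.log 2 n ≤ n := Nat.pow_log_le_self 2 hn.ne'
  have hlt : n < 2 ^ (Nat.log 2 n + 1) := Nat.lt_pow_succ_log_self one_lt_two n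
  have hn0 : (0 : ℝ) < n := by exact_mod_cast hn
  calc (n : ℝ) ^ (a - κ) = (n : ℝ) ^ a / (n : ℝ) ^ κ := Real.rpow_sub hn0 _ _
    _ ≤ (n : ℝ) ^ a / (2 ^ |a| / C) := by gcongr
    _ ≤ 2 ^ |a| * ((2 ^ Nat.log 2 n : ℕ) : ℝ) ^ a / (2 ^ |a| / C) := by
        gcongr
        exact rpow_le_two_rpow_abs_mul_rpow a hn0 (by exact_mod_cast (by lia))
          (by exact_mod_cast (by lia))
    _ = C * ((2 ^ Nat.log 2 n : ℕ) : ℝ) ^ a := by field_simp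
    _ ≤ f (2 ^ Nat.log 2 n) := hdyadic
    _ ≤ f n := hf hle

lemma eventually_le_rpow_of_dyadic
    (h : ∀ᶠ k : ℕ in atTop, f (2 ^ k) ≤ C * ((2 ^ k : ℕ) : ℝ) ^ a) :
    ∀ᶠ n : ℕ in atTop, f n ≤ (n : ℝ) ^ (a + κ) := by
  have hsucc : Tendsto (fun n => Nat.log 2 n + 1) atTop atTop :=
    (tendsto_add_atTop_nat 1).comp tendsto_natLog_two_atTop
  filter_upwards [hsucc.eventually h,
    (tendsto_natCast_rpow_atTop hκ).eventually_ge_atTop (C * 2 ^ |a|), eventually_gt_atTop 0]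
    with n hdyadic hbig hn
  have hle : 2 ^ Nat.log 2 n ≤ n := Nat.pow_log_le_self 2 hn.ne'
  have hlt : n < 2 ^ (Nat.log 2 n + 1) := Nat.lt_pow_succ_log_self one_lt_two n
  have hn0 : (0 : ℝ) < n := by exact_mod_cast hn
  calc f n ≤ f (2 ^ (Nat.log 2 n + 1)) := hf hlt.le
    _ ≤ C * ((2 ^ (Nat.log 2 n + 1) : ℕ) : ℝ) ^ a := hdyadic
    _ ≤ C * (2 ^ |a| * (n : ℝ) ^ a) := by
        gcongr
        exact rpow_le_two_rpow_abs_mul_rpow a (by positivity) (by exact_mod_cast (by lia))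
          (by exact_mod_cast (by lia))
    _ = C * 2 ^ |a| * (n : ℝ) ^ a := (mul_assoc _ _ _).symm
    _ ≤ (n : ℝ) ^ κ * (n : ℝ) ^ a := by gcongr
    _ = (n : ℝ) ^ (a + κ) := by rw [← Real.rpow_add hn0, add_comm]

end Dyadic

lemma ae_eventually_notMem_two_pow {Ω : Type*} [MeasurableSpace Ω] {P : Measure Ω}
    {A : ℕ → Set Ω} {C δ : ℝ} (hδ : 0 < δ)
    (hA : ∀ n : ℕ, 1 ≤ n → P (A n) ≤ ENNReal.ofReal (C * (n : ℝ) ^ (-δ))) :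
    ∀ᵐ ω ∂P, ∀ᶠ k : ℕ in atTop, ω ∉ A (2 ^ k) := by
  refine ae_eventually_notMem (s := fun k => A (2 ^ k)) (ne_top_of_le_ne_top ?_
    (ENNReal.tsum_le_tsum fun k => hA (2 ^ k) Nat.one_le_two_pow))
  have hratio : (2 : ℝ) ^ (-δ) < 1 :=
    Real.rpow_lt_one_of_one_lt_of_neg one_lt_two (neg_neg_of_pos hδ)
  have hgeom : ∀ k : ℕ, ((2 ^ k : ℕ) : ℝ) ^ (-δ) = ((2 : ℝ) ^ (-δ)) ^ k := fun k => by
    rw [Nat.cast_pow, Nat.cast_ofNat, Real.rpow_pow_comm zero_le_two]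
  simp_rw [hgeom]
  exact ((summable_geometric_of_lt_one (by positivity) hratio).mul_left C).tsum_ofReal_ne_top

end Asymptotics

section Moments

lemma lintegral_natCast_eq_one {μ : Measure ℕ} [IsFiniteMeasure μ]
    (hmean : ∫ k, (k : ℝ) ∂μ = 1) (hvar : MemLp (fun k : ℕ => (k : ℝ)) 2 μ) :
    ∫⁻ n, (n : ℝ≥0∞) ∂μ = 1 := by
  have h := ofReal_integral_eq_lintegral_ofReal (hvar.integrable one_le_two)
    (ae_of_all _ fun n => Nat.cast_nonneg n)
  rw [hmean] at h
  simpa using h.symm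

lemma lintegral_natCast_sq_ne_top {μ : Measure ℕ} (hvar : MemLp (fun k : ℕ => (k : ℝ)) 2 μ) :
    ∫⁻ n, (n : ℝ≥0∞) ^ 2 ∂μ ≠ ∞ := by
  have h := hvar.integrable_sq.lintegral_lt_top.ne
  simpa only [ENNReal.ofReal_pow (Nat.cast_nonneg _), ENNReal.ofReal_natCast] using h

lemma memLp_two_coord {d p : ℕ} (hp : 2 ≤ p) {η : Measure (Lattice d)} [IsFiniteMeasure η]
    (hmom : Integrable (fun x => euclNorm x ^ p) η) (i : Fin d) :
    MemLp (fun x : Lattice d => (x i : ℝ)) 2 η := by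
  rw [memLp_two_iff_integrable_sq Measurable.of_discrete.aestronglyMeasurable]
  refine (hmom.add (integrable_const 1)).mono' Measurable.of_discrete.aestronglyMeasurable
    (ae_of_all _ fun x => ?_)
  have hnorm : 0 ≤ euclNorm x := Real.sqrt_nonneg _
  rw [Real.norm_of_nonneg (sq_nonneg _), ← sq_abs]
  calc |(x i : ℝ)| ^ 2 ≤ euclNorm x ^ 2 := by
        gcongr
        exact abs_le_euclNorm x i
    _ ≤ euclNorm x ^ p + 1 := by
        rcases le_total (euclNorm x) 1 with h | h
        · linarith [pow_le_one₀ (n := 2) hnorm h, pow_nonneg hnorm p]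
        · linarith [pow_le_pow_right₀ h hp]

end Moments

section GoodEvents

/-- The number of trees that contain the first `n` vertices with high probability. -/
def numTrees (δ : ℝ) (n : ℕ) : ℕ := 2 * ⌈(n : ℝ) ^ (1 / 2 + δ)⌉₊

/-- The height that the first `numTrees δ n` trees do not exceed with high probability. -/
def maxHeight (δ : ℝ) (n : ℕ) : ℕ := ⌈(n : ℝ) ^ (1 / 2 + 2 * δ)⌉₊

lemma ceil_rpow_le_two_mul {n : ℕ} (hn : 1 ≤ n) {a : ℝ} (ha : 0 ≤ a) :
    (⌈(n : ℝ) ^ a⌉₊ : ℝ) ≤ 2 * (n : ℝ) ^ a := by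
  have hone : 1 ≤ (n : ℝ) ^ a := Real.one_le_rpow (by exact_mod_cast hn) ha
  linarith [Nat.ceil_lt_add_one (zero_le_one.trans hone)]

lemma maxHeight_add_one_le (δ : ℝ) {n : ℕ} (hn : 1 ≤ n) :
    maxHeight δ n + 1 ≤ 2 * maxHeight δ n := by
  have hpos : 0 < maxHeight δ n :=
    Nat.ceil_pos.2 (Real.rpow_pos_of_pos (by exact_mod_cast hn) _)
  lia

lemma brwLaw_fst {d : ℕ} (μ : Measure ℕ) [IsProbabilityMeasure μ] (θ : Measure (Lattice d))
    [IsProbabilityMeasure θ] (A : Set (Vertex → ℕ)) :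
    brwLaw μ θ {ω | ω.1 ∈ A} = childLaw μ A := by
  have hprod : {ω : (Vertex → ℕ) × (Vertex → Lattice d) | ω.1 ∈ A} = A ×ˢ Set.univ :=
    Set.prod_univ.symm
  rw [hprod, brwLaw, Measure.prod_prod, measure_univ, mul_one, childLaw]

section Scale

variable {δ : ℝ} (hδ : 0 < δ)
include hδ

lemma numTrees_le {n : ℕ} (hn : 1 ≤ n) : numTrees δ n ≤ 2 * maxHeight δ n := by
  refine Nat.mul_le_mul_left 2 (Nat.ceil_mono ?_)
  exact Real.rpow_le_rpow_of_exponent_le (by exact_mod_cast hn) (by linarith)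

lemma two_mul_maxHeight_le {n : ℕ} (hn : 1 ≤ n) :
    ((2 * maxHeight δ n : ℕ) : ℝ) ≤ 4 * (n : ℝ) ^ (1 / 2 + 2 * δ) := by
  have hceil := ceil_rpow_le_two_mul hn (a := 1 / 2 + 2 * δ) (by linarith)
  rw [maxHeight, Nat.cast_mul, Nat.cast_ofNat]
  linarith

lemma two_mul_le_numTrees_mul {n : ℕ} (hn : 1 ≤ n) :
    2 * n ≤ numTrees δ n * (⌈(n : ℝ) ^ (1 / 2 : ℝ)⌉₊ + 1) := by
  have hn1 : (1 : ℝ) ≤ n := by exact_mod_cast hn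
  have hprod : (n : ℝ) ≤ ⌈(n : ℝ) ^ (1 / 2 + δ)⌉₊ * ⌈(n : ℝ) ^ (1 / 2 : ℝ)⌉₊ := by
    calc (n : ℝ) = (n : ℝ) ^ (1 : ℝ) := (Real.rpow_one _).symm
      _ ≤ (n : ℝ) ^ (1 / 2 + δ + 1 / 2) := Real.rpow_le_rpow_of_exponent_le hn1 (by linarith)
      _ = (n : ℝ) ^ (1 / 2 + δ) * (n : ℝ) ^ (1 / 2 : ℝ) := Real.rpow_add (by linarith) _ _
      _ ≤ _ := by gcongr <;> exact Nat.le_ceil _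
  have hnat : n ≤ ⌈(n : ℝ) ^ (1 / 2 + δ)⌉₊ * ⌈(n : ℝ) ^ (1 / 2 : ℝ)⌉₊ := by exact_mod_cast hprod
  rw [numTrees]
  linarith

lemma exists_sq_mul_exp_le {C t₀ : ℝ} (hC : 0 ≤ C) (ht₀ : 0 < t₀) :
    ∃ C', 0 < C' ∧ ∀ x M : ℝ, 1 ≤ x → 0 ≤ M → M ≤ 4 * x ^ (1 / 2 + 2 * δ) →
      M ^ 2 * Real.exp (C * (t₀ * x ^ (-(1 / 4 + δ))) ^ 2 * (2 * M) -
        t₀ * x ^ (-(1 / 4 + δ)) * x ^ (1 / 4 + 2 * δ)) ≤ C' * x ^ (-δ) := by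
  obtain ⟨C', hC', hdecay⟩ := exists_forall_rpow_mul_exp_le (1 + 5 * δ) hδ ht₀
  refine ⟨16 * Real.exp (8 * C * t₀ ^ 2) * C', by positivity, fun x M hx hM0 hM => ?_⟩
  have hx0 : 0 < x := by linarith
  have hvariance : C * (t₀ * x ^ (-(1 / 4 + δ))) ^ 2 * (2 * M) ≤ 8 * C * t₀ ^ 2 := by
    have hcancel : (x ^ (-(1 / 4 + δ))) ^ 2 * x ^ (1 / 2 + 2 * δ) = 1 := by
      rw [← Real.rpow_mul_natCast hx0.le, ← Real.rpow_add hx0, ← Real.rpow_zero x]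
      congr 1
      push_cast
      ring
    calc C * (t₀ * x ^ (-(1 / 4 + δ))) ^ 2 * (2 * M)
        ≤ C * (t₀ * x ^ (-(1 / 4 + δ))) ^ 2 * (2 * (4 * x ^ (1 / 2 + 2 * δ))) := by gcongr
      _ = 8 * C * t₀ ^ 2 * ((x ^ (-(1 / 4 + δ))) ^ 2 * x ^ (1 / 2 + 2 * δ)) := by ring
      _ = 8 * C * t₀ ^ 2 := by rw [hcancel, mul_one]
  have hlinear : t₀ * x ^ (-(1 / 4 + δ)) * x ^ (1 / 4 + 2 * δ) = t₀ * x ^ δ := by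
    rw [mul_assoc, ← Real.rpow_add hx0]
    ring_nf
  have hsq : (x ^ (1 / 2 + 2 * δ)) ^ 2 = x ^ (1 + 5 * δ) * x ^ (-δ) := by
    rw [← Real.rpow_mul_natCast hx0.le, ← Real.rpow_add hx0]
    congr 1
    push_cast
    ring
  rw [hlinear]
  calc M ^ 2 * Real.exp (C * (t₀ * x ^ (-(1 / 4 + δ))) ^ 2 * (2 * M) - t₀ * x ^ δ)
      ≤ (4 * x ^ (1 / 2 + 2 * δ)) ^ 2 * Real.exp (8 * C * t₀ ^ 2 - t₀ * x ^ δ) := by gcongr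
    _ = 16 * Real.exp (8 * C * t₀ ^ 2) * (x ^ (1 + 5 * δ) * Real.exp (-(t₀ * x ^ δ))) *
        x ^ (-δ) := by
        rw [mul_pow, hsq, sub_eq_add_neg, Real.exp_add]
        ring
    _ ≤ 16 * Real.exp (8 * C * t₀ ^ 2) * C' * x ^ (-δ) := by
        gcongr
        exact hdecay x hx

variable {μ : Measure ℕ} [IsProbabilityMeasure μ] (hmean : ∫⁻ n, (n : ℝ≥0∞) ∂μ = 1)
include hmean

lemma exists_childLaw_truncCount_le (hvar : ∫⁻ n, (n : ℝ≥0∞) ^ 2 ∂μ ≠ ∞) :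
    ∃ C, 0 < C ∧ ∀ n : ℕ, 1 ≤ n →
      childLaw μ {N | truncCount (numTrees δ n) ⌈(n : ℝ) ^ (1 / 2 : ℝ)⌉₊ N ≤ n} ≤
        ENNReal.ofReal (C * (n : ℝ) ^ (-δ)) := by
  set m := (∫⁻ n, (n : ℝ≥0∞) ^ 2 ∂μ).toReal with hm
  have _ : 0 ≤ m := ENNReal.toReal_nonneg
  refine ⟨4 * (2 + m) * 3, by positivity, fun n hn => ?_⟩
  have hn1 : (1 : ℝ) ≤ n := by exact_mod_cast hn
  have hK : (n : ℝ) ^ (1 / 2 + δ) ≤ numTrees δ n := by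
    rw [numTrees, Nat.cast_mul, Nat.cast_ofNat]
    linarith [Nat.le_ceil ((n : ℝ) ^ (1 / 2 + δ)),
      Nat.cast_nonneg (α := ℝ) ⌈(n : ℝ) ^ (1 / 2 + δ)⌉₊]
  have hKpos : 0 < numTrees δ n := by
    exact_mod_cast (Real.rpow_pos_of_pos (by linarith) (1 / 2 + δ)).trans_le hK
  have hH : (⌈(n : ℝ) ^ (1 / 2 : ℝ)⌉₊ : ℝ) + 1 ≤ 3 * (n : ℝ) ^ (1 / 2 : ℝ) := by
    linarith [ceil_rpow_le_two_mul hn (a := 1 / 2) (by norm_num),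
      Real.one_le_rpow hn1 (z := 1 / 2) (by norm_num)]
  refine (childLaw_truncCount_le hmean hKpos (two_mul_le_numTrees_mul hδ hn)).trans ?_
  rw [ENNReal.le_ofReal_iff_toReal_le (by finiteness) (by positivity)]
  simp only [ENNReal.toReal_div, ENNReal.toReal_mul, ENNReal.toReal_natCast,
    ENNReal.toReal_add ENNReal.ofNat_ne_top hvar, ENNReal.toReal_ofNat, ENNReal.toReal_one, ← hm,
    ENNReal.toReal_add (ENNReal.natCast_ne_top _) ENNReal.one_ne_top]
  calc 4 * (2 + m) * ((⌈(n : ℝ) ^ (1 / 2 : ℝ)⌉₊ : ℝ) + 1) / numTrees δ n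
      ≤ 4 * (2 + m) * (3 * (n : ℝ) ^ (1 / 2 : ℝ)) / (n : ℝ) ^ (1 / 2 + δ) := by gcongr
    _ = 4 * (2 + m) * 3 * ((n : ℝ) ^ (1 / 2 : ℝ) / (n : ℝ) ^ (1 / 2 + δ)) := by ring
    _ = 4 * (2 + m) * 3 * (n : ℝ) ^ (-δ) := by
        rw [← Real.rpow_sub (by linarith), sub_add_cancel_left]

lemma exists_childLaw_reaches_le (hne : μ ≠ Measure.dirac 1) :
    ∃ C, 0 < C ∧ ∀ n : ℕ, 1 ≤ n →
      childLaw μ {N | ∃ k < numTrees δ n, Reaches N (maxHeight δ n + 1) (k, [])} ≤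
        ENNReal.ofReal (C * (n : ℝ) ^ (-δ)) := by
  have hp := tailProb_one_toReal_pos μ hmean hne
  set p := (tailProb μ 1).toReal
  refine ⟨4 / p, by positivity, fun n hn => ?_⟩
  have hn0 : (0 : ℝ) < n := by exact_mod_cast hn
  have hK : (numTrees δ n : ℝ) ≤ 4 * (n : ℝ) ^ (1 / 2 + δ) := by
    rw [numTrees, Nat.cast_mul, Nat.cast_ofNat]
    linarith [ceil_rpow_le_two_mul hn (a := 1 / 2 + δ) (by linarith)]
  have hH : (n : ℝ) ^ (1 / 2 + 2 * δ) ≤ maxHeight δ n := Nat.le_ceil _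
  refine (childLaw_exists_reaches_le μ hmean _ _).trans (ENNReal.ofReal_le_ofReal ?_)
  calc (numTrees δ n : ℝ) / (1 + p * ((maxHeight δ n + 1 : ℕ) : ℝ))
      ≤ 4 * (n : ℝ) ^ (1 / 2 + δ) / (p * (n : ℝ) ^ (1 / 2 + 2 * δ)) := by
        gcongr
        push_cast
        linarith [mul_le_mul_of_nonneg_left hH hp.le]
    _ = 4 / p * ((n : ℝ) ^ (1 / 2 + δ) / (n : ℝ) ^ (1 / 2 + 2 * δ)) := by field_simp
    _ = 4 / p * (n : ℝ) ^ (-δ) := by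
        rw [← Real.rpow_sub hn0]
        ring_nf

lemma exists_brwLaw_not_inTrunc_le {d : ℕ} (θ : Measure (Lattice d)) [IsProbabilityMeasure θ]
    (hvar : ∫⁻ n, (n : ℝ≥0∞) ^ 2 ∂μ ≠ ∞) (hne : μ ≠ Measure.dirac 1) :
    ∃ C, 0 < C ∧ ∀ n : ℕ, 1 ≤ n →
      brwLaw μ θ {ω | ¬ ∀ i ≤ n, InTrunc ω.1 (numTrees δ n) (maxHeight δ n) (dfs ω.1 i)} ≤
        ENNReal.ofReal (C * (n : ℝ) ^ (-δ)) := by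
  obtain ⟨C₁, hC₁, hcount⟩ := exists_childLaw_truncCount_le hδ hmean hvar
  obtain ⟨C₂, hC₂, hheight⟩ := exists_childLaw_reaches_le hδ hmean hne
  refine ⟨C₁ + C₂, by positivity, fun n hn => ?_⟩
  rw [add_mul, ENNReal.ofReal_add (by positivity) (by positivity)]
  refine le_trans ?_ (add_le_add (hcount n hn) (hheight n hn))
  rw [← brwLaw_fst μ θ, ← brwLaw_fst μ θ]
  refine (measure_mono fun ω hω => ?_).trans (measure_union_le _ _)
  by_contra hgood
  rw [Set.mem_union, not_or] at hgood
  exact hω fun i hi => dfs_inTrunc (not_le.1 hgood.1) hgood.2 hi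

variable {d : ℕ} {θ : Measure (Lattice d)} [IsProbabilityMeasure θ] [θ.IsNegInvariant]

lemma exists_brwLaw_energy_le {η : Measure (Lattice d)}
    [IsProbabilityMeasure η] (hd3 : 3 ≤ d) (hd5 : d ≤ 5)
    (hvar : ∫⁻ n, (n : ℝ≥0∞) ^ 2 ∂μ ≠ ∞) (hθ : IsIrreducible θ) (hη : IsIrreducible η) :
    ∃ C, 0 < C ∧ ∀ n : ℕ, 1 ≤ n →
      brwLaw μ θ {ω | ENNReal.ofReal (C * (n : ℝ) ^ (2 - ((d : ℝ) - 2) / 4 + 9 * δ)) ≤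
        energy η (numTrees δ n) (maxHeight δ n) ω} ≤ ENNReal.ofReal ((n : ℝ) ^ (-δ)) := by
  obtain ⟨C, hC, henergy⟩ := exists_lintegral_energy_le hmean hd3 hd5 hvar hθ hη
  have hd3' : (3 : ℝ) ≤ d := by exact_mod_cast hd3
  have hd5' : (d : ℝ) ≤ 5 := by exact_mod_cast hd5
  set p : ℝ := 4 - ((d : ℝ) - 2) / 2 with hp
  have hp0 : 0 ≤ p := by linarith
  have hδp : δ * p ≤ δ * 4 := by
    gcongr
    linarith
  refine ⟨C * 4 ^ p, by positivity, fun n hn => ?_⟩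
  have hn0 : (0 : ℝ) < n := by exact_mod_cast hn
  have hmean_energy : C * ((2 * maxHeight δ n : ℕ) : ℝ) ^ p ≤
      (n : ℝ) ^ (-δ) * (C * 4 ^ p * (n : ℝ) ^ (2 - ((d : ℝ) - 2) / 4 + 9 * δ)) := by
    calc C * ((2 * maxHeight δ n : ℕ) : ℝ) ^ p ≤ C * (4 * (n : ℝ) ^ (1 / 2 + 2 * δ)) ^ p := by
          gcongr
          exact two_mul_maxHeight_le hδ hn
      _ = C * 4 ^ p * (n : ℝ) ^ ((1 / 2 + 2 * δ) * p) := by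
          rw [Real.mul_rpow (by norm_num) (by positivity), ← Real.rpow_mul hn0.le, mul_assoc]
      _ ≤ C * 4 ^ p * (n : ℝ) ^ (-δ + (2 - ((d : ℝ) - 2) / 4 + 9 * δ)) := by
          gcongr
          · exact_mod_cast hn
          · linarith
      _ = _ := by
          rw [Real.rpow_add hn0]
          ring
  have hlevel : ENNReal.ofReal (C * 4 ^ p * (n : ℝ) ^ (2 - ((d : ℝ) - 2) / 4 + 9 * δ)) ≠ 0 :=
    (ENNReal.ofReal_pos.2 (by positivity)).ne'
  refine (meas_ge_le_lintegral_div (measurable_energy η _ _).aemeasurable hlevel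
    ENNReal.ofReal_ne_top).trans (ENNReal.div_le_of_le_mul ?_)
  rw [← ENNReal.ofReal_mul (by positivity)]
  exact (henergy _ _ _ (numTrees_le hδ hn) (maxHeight_add_one_le δ hn)).trans
    (ENNReal.ofReal_le_ofReal hmean_energy)

lemma exists_brwLaw_displacement_at_scale_le
    (hexp : ∃ c : ℝ, 0 < c ∧ Integrable (fun x => Real.exp (c * euclNorm x)) θ) :
    ∃ C, 0 < C ∧ ∀ n : ℕ, 1 ≤ n →
      brwLaw μ θ {ω | ∃ u, InTrunc ω.1 (numTrees δ n) (maxHeight δ n) u ∧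
        ∃ i, (n : ℝ) ^ (1 / 4 + 2 * δ) ≤ |(position ω.2 u i : ℝ)|} ≤
          ENNReal.ofReal (C * (n : ℝ) ^ (-δ)) := by
  obtain ⟨C, t₀, hC, ht₀, hdisp⟩ := exists_brwLaw_displacement_le θ hmean hexp
  obtain ⟨C', hC', hdecay⟩ := exists_sq_mul_exp_le hδ hC.le ht₀
  refine ⟨(2 * d + 1) * C', by positivity, fun n hn => ?_⟩
  have hn1 : (1 : ℝ) ≤ n := by exact_mod_cast hn
  have ht : t₀ * (n : ℝ) ^ (-(1 / 4 + δ)) ≤ t₀ :=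
    mul_le_of_le_one_right ht₀.le (Real.rpow_le_one_of_one_le_of_nonpos hn1 (by linarith))
  refine (hdisp _ _ (2 * maxHeight δ n) (t₀ * (n : ℝ) ^ (-(1 / 4 + δ))) _ (by positivity) ht
    (numTrees_le hδ hn) (maxHeight_add_one_le δ hn)).trans (ENNReal.ofReal_le_ofReal ?_)
  rw [mul_assoc (2 * (d : ℝ)), mul_assoc (2 * (d : ℝ) + 1)]
  refine mul_le_mul (by linarith) ?_ (by positivity) (by positivity)
  exact hdecay n _ hn1 (Nat.cast_nonneg _) (two_mul_maxHeight_le hδ hn)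

end Scale

end GoodEvents

section CapacityOfRange

variable {d : ℕ} {μ : Measure ℕ} [IsProbabilityMeasure μ] {θ η : Measure (Lattice d)}
  [IsProbabilityMeasure θ] [θ.IsNegInvariant] [IsProbabilityMeasure η]

lemma IsTransient.exists_capacity_range_le_of_displacement (hη : IsTransient η) (hd : 2 ≤ d)
    (hη_mean : ∀ i, ∫ x, (x i : ℝ) ∂η = 0)
    (hη_L2 : ∀ i, MemLp (fun x : Lattice d => (x i : ℝ)) 2 η) :
    ∃ C, 0 < C ∧ ∀ (N : Vertex → ℕ) (X : Vertex → Lattice d) (n : ℕ) (r : ℝ), 1 ≤ r →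
      (∀ i ≤ n, ∀ l, |(position X (dfs N i) l : ℝ)| ≤ r) →
        capacity η (range N X n) ≤ C * r ^ ((d : ℝ) - 2) := by
  obtain ⟨C, hC, hbox⟩ := hη.exists_ecapacity_le_of_subset_box hd hη_mean hη_L2
  refine ⟨C, hC, fun N X n r hr hdisp => ?_⟩
  have hfloor : range N X n ⊆ box d ⌊r⌋₊ := by
    intro x hx
    obtain ⟨i, hi, rfl⟩ := Finset.mem_image.1 hx
    refine mem_box.2 fun l => ?_
    have hl := hdisp i (Finset.mem_range_succ_iff.1 hi) l
    rw [Int.abs_eq_natAbs, Nat.cast_le, Nat.le_floor_iff (by linarith), Nat.cast_natAbs]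
    exact_mod_cast hl
  have hcap := hbox _ _ (Nat.floor_pos.2 hr) hfloor
  rw [ENNReal.le_ofReal_iff_toReal_le (ecapacity_ne_top η _) (by positivity),
    ← capacity_eq_toReal] at hcap
  calc capacity η (range N X n) ≤ C * (⌊r⌋₊ : ℝ) ^ (d - 2) := hcap
    _ ≤ C * r ^ (d - 2) := by
        gcongr
        exact Nat.floor_le (by linarith)
    _ = C * r ^ ((d : ℝ) - 2) := by
        rw [← Real.rpow_natCast, Nat.cast_sub hd, Nat.cast_ofNat]

variable (hμ_mean : ∫⁻ n, (n : ℝ≥0∞) ∂μ = 1) (hμ_var : ∫⁻ n, (n : ℝ≥0∞) ^ 2 ∂μ ≠ ∞)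
  (hμ_ne : μ ≠ Measure.dirac 1)
include hμ_mean hμ_var hμ_ne

lemma exists_brwLaw_capacity_range_lt_le (hd3 : 3 ≤ d) (hd5 : d ≤ 5) (hη : IsIrreducible η)
    (hθ : IsIrreducible θ) {δ : ℝ} (hδ : 0 < δ) :
    ∃ c C, 0 < c ∧ ∀ n : ℕ, 1 ≤ n →
      brwLaw μ θ {ω | capacity η (range ω.1 ω.2 n) <
        c * (n : ℝ) ^ (((d : ℝ) - 2) / 4 - 9 * δ)} ≤ ENNReal.ofReal (C * (n : ℝ) ^ (-δ)) := by
  obtain ⟨C₁, hC₁, hescape⟩ := exists_brwLaw_not_inTrunc_le hδ hμ_mean θ hμ_var hμ_ne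
  obtain ⟨C₂, hC₂, henergy⟩ := exists_brwLaw_energy_le hδ hμ_mean hd3 hd5 hμ_var hθ hη
  refine ⟨(4 * C₂)⁻¹, C₁ + 1, by positivity, fun n hn => ?_⟩
  have hn0 : (0 : ℝ) < n := by exact_mod_cast hn
  set s : ℝ := ((d : ℝ) - 2) / 4
  rw [add_mul, one_mul, ENNReal.ofReal_add (by positivity) (by positivity)]
  refine le_trans ?_ (add_le_add (hescape n hn) (henergy n hn))
  refine (measure_mono fun ω hω => ?_).trans (measure_union_le _ _)
  by_contra hgood
  rw [Set.mem_union, not_or, Set.mem_ofPred_eq, not_not, Set.mem_ofPred_eq, not_le] at hgood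
  have hlower := (hη.isTransient hd3).sq_le_mul_capacity_range hgood.1 hgood.2.le (by positivity)
  have hsq : (n : ℝ) ^ 2 = (n : ℝ) ^ (s - 9 * δ) * (n : ℝ) ^ (2 - s + 9 * δ) := by
    rw [← Real.rpow_add hn0, ← Real.rpow_natCast]
    congr 1
    push_cast
    ring
  rw [Set.mem_ofPred_eq] at hω
  refine not_le.2 hω ((inv_mul_le_iff₀ (by positivity)).2 ?_)
  refine le_of_mul_le_mul_right ?_ (Real.rpow_pos_of_pos hn0 (2 - s + 9 * δ))
  linarith

lemma IsTransient.exists_brwLaw_lt_capacity_range_le (hη : IsTransient η) (hd : 2 ≤ d)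
    (hη_mean : ∀ i, ∫ x, (x i : ℝ) ∂η = 0)
    (hη_L2 : ∀ i, MemLp (fun x : Lattice d => (x i : ℝ)) 2 η)
    (hθ_exp : ∃ c : ℝ, 0 < c ∧ Integrable (fun x => Real.exp (c * euclNorm x)) θ)
    {δ : ℝ} (hδ : 0 < δ) :
    ∃ c C, 0 < c ∧ ∀ n : ℕ, 1 ≤ n →
      brwLaw μ θ {ω | c * (n : ℝ) ^ ((1 / 4 + 2 * δ) * ((d : ℝ) - 2)) <
        capacity η (range ω.1 ω.2 n)} ≤ ENNReal.ofReal (C * (n : ℝ) ^ (-δ)) := by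
  obtain ⟨C₁, hC₁, hescape⟩ := exists_brwLaw_not_inTrunc_le hδ hμ_mean θ hμ_var hμ_ne
  obtain ⟨C₂, hC₂, hdisp⟩ := exists_brwLaw_displacement_at_scale_le hδ hμ_mean hθ_exp
  obtain ⟨c, hc, hcap⟩ := hη.exists_capacity_range_le_of_displacement hd hη_mean hη_L2
  refine ⟨c, C₁ + C₂, hc, fun n hn => ?_⟩
  have hn1 : (1 : ℝ) ≤ n := by exact_mod_cast hn
  rw [add_mul C₁, ENNReal.ofReal_add (by positivity) (by positivity)]
  refine le_trans ?_ (add_le_add (hescape n hn) (hdisp n hn))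
  refine (measure_mono fun ω hω => ?_).trans (measure_union_le _ _)
  by_contra hgood
  rw [Set.mem_union, not_or, Set.mem_ofPred_eq, not_not, Set.mem_ofPred_eq] at hgood
  rw [Set.mem_ofPred_eq, Real.rpow_mul (by positivity)] at hω
  refine not_le.2 hω (hcap _ _ _ _ (Real.one_le_rpow hn1 (by positivity)) fun i hi l => ?_)
  exact le_of_not_ge fun hfar => hgood.2 ⟨_, hgood.1 i hi, l, hfar⟩

theorem ae_eventually_rpow_le_capacity_range (hd3 : 3 ≤ d) (hd5 : d ≤ 5) (hη : IsIrreducible η)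
    (hθ : IsIrreducible θ) {κ : ℝ} (hκ : 0 < κ) :
    ∀ᵐ ω ∂brwLaw μ θ, ∀ᶠ n : ℕ in atTop,
      (n : ℝ) ^ (((d : ℝ) - 2) / 4 - κ) ≤ capacity η (range ω.1 ω.2 n) := by
  have hδ : 0 < κ / 18 := by positivity
  obtain ⟨c, C, hc, hprob⟩ := exists_brwLaw_capacity_range_lt_le (θ := θ) hμ_mean hμ_var hμ_ne
    hd3 hd5 hη hθ hδ
  filter_upwards [ae_eventually_notMem_two_pow hδ hprob] with ω hω
  have hdyadic := eventually_rpow_le_of_dyadic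
    ((hη.isTransient hd3).capacity_range_mono ω.1 ω.2) (((d : ℝ) - 2) / 4 - 9 * (κ / 18)) hc
    (half_pos hκ) (hω.mono fun k hk => not_lt.1 hk)
  have hexponent : ((d : ℝ) - 2) / 4 - 9 * (κ / 18) - κ / 2 = ((d : ℝ) - 2) / 4 - κ := by ring
  rwa [hexponent] at hdyadic

theorem IsTransient.ae_eventually_capacity_range_le_rpow (hη : IsTransient η) (hd : 2 ≤ d)
    (hη_mean : ∀ i, ∫ x, (x i : ℝ) ∂η = 0)
    (hη_L2 : ∀ i, MemLp (fun x : Lattice d => (x i : ℝ)) 2 η)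
    (hθ_exp : ∃ c : ℝ, 0 < c ∧ Integrable (fun x => Real.exp (c * euclNorm x)) θ)
    {κ : ℝ} (hκ : 0 < κ) :
    ∀ᵐ ω ∂brwLaw μ θ, ∀ᶠ n : ℕ in atTop,
      capacity η (range ω.1 ω.2 n) ≤ (n : ℝ) ^ (((d : ℝ) - 2) / 4 + κ) := by
  have _ : (0 : ℝ) < d := by exact_mod_cast (by lia)
  have hδ : 0 < κ / (2 * d) := by positivity
  obtain ⟨c, C, hc, hprob⟩ := hη.exists_brwLaw_lt_capacity_range_le (θ := θ) hμ_mean hμ_var hμ_ne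
    hd hη_mean hη_L2 hθ_exp hδ
  filter_upwards [ae_eventually_notMem_two_pow hδ hprob] with ω hω
  have hdyadic := eventually_le_rpow_of_dyadic (hη.capacity_range_mono ω.1 ω.2)
    ((1 / 4 + 2 * (κ / (2 * d))) * ((d : ℝ) - 2)) hc (κ := 2 * κ / d) (by positivity)
    (hω.mono fun k hk => not_lt.1 hk)
  have hexponent : (1 / 4 + 2 * (κ / (2 * d))) * ((d : ℝ) - 2) + 2 * κ / d =
      ((d : ℝ) - 2) / 4 + κ := by
    field_simp
    ring
  rwa [hexponent] at hdyadic

end CapacityOfRange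

end BRWCapacity

end

theorem proposition2p1_general {d : ℕ} (hd3 : 3 ≤ d) (hd5 : d ≤ 5)
    {μ : Measure ℕ} [IsProbabilityMeasure μ]
    {θ η : Measure (BRWCapacity.Lattice d)} [IsProbabilityMeasure θ] [IsProbabilityMeasure η]
    (hμ_mean : ∫ k, (k : ℝ) ∂μ = 1)
    (hμ_var : MemLp (fun k : ℕ => (k : ℝ)) 2 μ)
    (hμ_ne : μ ≠ Measure.dirac 1)
    (hη_irr : BRWCapacity.IsIrreducible η)
    (hη_mean : ∀ i : Fin d, ∫ x, (x i : ℝ) ∂η = 0)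
    (hη_L2 : ∀ i : Fin d, MemLp (fun x : BRWCapacity.Lattice d => (x i : ℝ)) 2 η)
    (hθ_symm : θ.map (fun x => -x) = θ)
    (hθ_irr : BRWCapacity.IsIrreducible θ)
    (hθ_exp : ∃ c : ℝ, 0 < c ∧ Integrable (fun x => Real.exp (c * BRWCapacity.euclNorm x)) θ) :
    ∀ᵐ ω ∂(BRWCapacity.brwLaw μ θ),
      ∃ ε : ℕ → ℝ, Tendsto ε atTop (𝓝 0) ∧
        ∀ᶠ n : ℕ in atTop,
          BRWCapacity.capacity η (BRWCapacity.range ω.1 ω.2 n) =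
            (n : ℝ) ^ (((d : ℝ) - 2) / 4 + ε n) := by
  have : θ.IsNegInvariant := ⟨hθ_symm⟩
  have hmean := BRWCapacity.lintegral_natCast_eq_one hμ_mean hμ_var
  have hvar := BRWCapacity.lintegral_natCast_sq_ne_top hμ_var
  have hlower := ae_all_iff.2 fun m : ℕ =>
    BRWCapacity.ae_eventually_rpow_le_capacity_range (θ := θ) hmean hvar hμ_ne hd3 hd5 hη_irr
      hθ_irr (Nat.one_div_pos_of_nat (n := m))
  have hupper := ae_all_iff.2 fun m : ℕ =>
    (hη_irr.isTransient hd3).ae_eventually_capacity_range_le_rpow hmean hvar hμ_ne (by lia)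
      hη_mean hη_L2 hθ_exp (Nat.one_div_pos_of_nat (n := m))
  filter_upwards [hlower, hupper] with ω hω_lower hω_upper
  exact BRWCapacity.exists_exponent_of_forall fun m => (hω_lower m).and (hω_upper m)

theorem proposition2p1 (d : ℕ) (hd : d = 3 ∨ d = 4 ∨ d = 5)
    (μ : Measure ℕ) [IsProbabilityMeasure μ]
    (θ η : Measure (BRWCapacity.Lattice d)) [IsProbabilityMeasure θ] [IsProbabilityMeasure η]
    -- `μ` has mean 1 and finite variance, and is not the Dirac mass at 1
    (hμ_mean : ∫ k, (k : ℝ) ∂μ = 1)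
    (hμ_var : MemLp (fun k : ℕ => (k : ℝ)) 2 μ)
    (hμ_ne : μ ≠ Measure.dirac 1)
    -- `η` is aperiodic, irreducible, centred, with finite moment of order `d + 1`
    (hη_aper : BRWCapacity.IsAperiodic η)
    (hη_irr : BRWCapacity.IsIrreducible η)
    (hη_mean : ∀ i : Fin d, ∫ x, (x i : ℝ) ∂η = 0)
    (hη_mom : Integrable (fun x => BRWCapacity.euclNorm x ^ (d + 1)) η)
    -- `θ` is symmetric, irreducible, with some finite exponential moment
    (hθ_symm : θ.map (fun x => -x) = θ)
    (hθ_irr : BRWCapacity.IsIrreducible θ)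
    (hθ_exp : ∃ c : ℝ, 0 < c ∧ Integrable (fun x => Real.exp (c * BRWCapacity.euclNorm x)) θ) :
    ∀ᵐ ω ∂(BRWCapacity.brwLaw μ θ),
      ∃ ε : ℕ → ℝ, Tendsto ε atTop (𝓝 0) ∧
        ∀ᶠ n : ℕ in atTop,
          BRWCapacity.capacity η (BRWCapacity.range ω.1 ω.2 n) =
            (n : ℝ) ^ (((d : ℝ) - 2) / 4 + ε n) := by
  exact proposition2p1_general (by lia) (by lia) hμ_mean hμ_var hμ_ne hη_irr hη_mean
    (BRWCapacity.memLp_two_coord (by lia) hη_mom) hθ_symm hθ_irr hθ_exp
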